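/- Let $\mathbb D$ be the open unit disc, $\mathbb T$ the unit circle, $m$ normalized Lebesgue measure on $\mathbb T$, $dA=\frac{dx\,dy}{\pi}$, and let $\mu$ be a finite positive Borel measure on $\mathbb D$. Put $$G_\mu(z)=\int_{\mathbb D}\log\left|\frac{1-\overline w z}{z-w}\right|d\mu(w),\qquad \mathcal D_\mu=\Big\{f\in H^2:\ \mathcal D_\mu(f):=\int_{\mathbb D}|f'(z)|^2G_\mu(z)\,dA(z)<\infty\Big\},$$ with norm $\|f\|_{\mathcal D_\mu}^2=\|f\|_{H^2}^2+\mathcal D_\mu(f)$. For $f\in\mathcal D_\mu$ let $[f]_{\mathcal D_\mu}$ be the smallest closed subspace of $\mathcal D_\mu$ that contains $f$ and is invariant under multiplication by $z$; $f$ is called cyclic in $\mathcal D_\mu$ if $[f]_{\mathcal D_\mu}=\mathcal D_\mu$. A function $f\in H^1$ is called outer if $f(z)=\alpha\exp\left(\int_{\mathbb T}\frac{\zeta+z}{\zeta-z}h(\zeta)\,dm(\zeta)\right)$ on $\mathbb D$ for some real-valued $h\in L^1(\mathbb T)$ and some $|\alpha|=1$. Put $\mathcal Z(f)=\{\zeta\in\mathbb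 T:\lim_{r\to1^-}f(r\zeta)=0\}$. For $g\in L^2(\mathbb T)$ let $$\mathcal D_\mu^h(g)=\int_{\mathbb T}\int_{\mathbb T}|g(\zeta)-g(\lambda)|^2A_\mu(\zeta,\lambda)\,dm(\zeta)\,dm(\lambda),\qquad A_\mu(\zeta,\lambda)=\int_{\mathbb D}\frac{1-|z|^2}{|\zeta-z|^2}\,\frac{1-|z|^2}{|\lambda-z|^2}\,d\mu(z),$$ and for $E\subset\mathbb T$ let $c_\mu(E)$ be the infimum of $\|g\|_{L^2(\mathbb T)}^2+\mathcal D^h_\mu(g)$ over all $g\in L^2(\mathbb T)$ with $\mathcal D^h_\mu(g)<\infty$ and $|g|\ge1$ $m$-a.e. on a neighbourhood of $E$. Then: 1. for every $f\in\mathcal D_\mu$, $f$ is cyclic in $\mathcal D_\mu$ if and only if $f$ is outer; 2. (the Brown–Shields conjecture for $\mathcal D_\mu$) for every $f\in\mathcal D_\mu$, $f$ is cyclic in $\mathcal D_\mu$ if and only if $f$ is outer and $c_\mu(\mathcal Z(f))=0$; 3. for every $E\subset\mathbb T$, $c_\mu(E)=0$ if and only if $E$ is Lebesgue-null. -/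

import Mathlib

open MeasureTheory Set Filter Topology
open scoped ENNReal ComplexConjugate

/-! Functions on the unit disc `𝔻 = Metric.ball 0 1` are represented by functions `ℂ → ℂ`; only the
values on `𝔻` enter the definitions below, so two functions that agree on `𝔻` are identified by all
of them (their difference has norm `0`). Likewise, functions on the unit circle
`𝕋 = Metric.sphere 0 1` are represented by functions `ℂ → ℂ`, considered almost everywhere with
respect to the normalized arc length measure `arcLength`, which is carried by `𝕋`. -/

namespace BrownShields

/-- Normalized Lebesgue measure `m` on the unit circle, as a measure on `ℂ`: the image of
`dθ / (2π)` on `(0, 2π]` under `θ ↦ e^{iθ}`. -/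
noncomputable def arcLength : Measure ℂ :=
  Measure.map (circleMap 0 1)
    ((ENNReal.ofReal (2 * Real.pi))⁻¹ • volume.restrict (Ioc 0 (2 * Real.pi)))

/-- Normalized area measure `dA = dx dy / π` on the unit disc. -/
noncomputable def discArea : Measure ℂ :=
  (ENNReal.ofReal Real.pi)⁻¹ • volume.restrict (Metric.ball 0 1)

/-- The Hardy norm `sup_{0 ≤ r < 1} (∫_𝕋 |f(rζ)|^p dm(ζ))^{1/p}`. -/
noncomputable def hardyNorm (p : ℝ≥0∞) (f : ℂ → ℂ) : ℝ≥0∞ :=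
  ⨆ r ∈ Ico (0 : ℝ) 1, eLpNorm (fun ζ : ℂ => f (r * ζ)) p arcLength

/-- Membership in the Hardy space `H^p` of the unit disc. -/
def MemHardy (p : ℝ≥0∞) (f : ℂ → ℂ) : Prop :=
  DifferentiableOn ℂ f (Metric.ball 0 1) ∧ hardyNorm p f < ∞

/-- Outer functions: elements of `H^1` of the form
`f(z) = α exp (∫_𝕋 (ζ + z) / (ζ - z) h(ζ) dm(ζ))` with `h` real-valued and integrable, `|α| = 1`. -/
def IsOuter (f : ℂ → ℂ) : Prop :=
  MemHardy 1 f ∧ ∃ (α : ℂ) (h : ℂ → ℝ), ‖α‖ = 1 ∧ Integrable h arcLength ∧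
    ∀ z ∈ Metric.ball (0 : ℂ) 1,
      f z = α * Complex.exp (∫ ζ, (ζ + z) / (ζ - z) * (h ζ : ℂ) ∂arcLength)

open Classical in
/-- The Green kernel `log |(1 - \bar w z) / (z - w)|` of the unit disc, with value `∞` at `z = w`. -/
noncomputable def greenKernel (z w : ℂ) : ℝ≥0∞ :=
  if z = w then ∞ else ENNReal.ofReal (Real.log ‖(1 - conj w * z) / (z - w)‖)

/-- The Green potential `G_μ` of a measure `μ` on the unit disc. -/
noncomputable def greenPotential (μ : Measure ℂ) (z : ℂ) : ℝ≥0∞ :=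
  ∫⁻ w, greenKernel z w ∂μ

/-- The weighted Dirichlet integral `𝓓_μ(f) = ∫_𝔻 |f'|² G_μ dA`. -/
noncomputable def dirichletIntegral (μ : Measure ℂ) (f : ℂ → ℂ) : ℝ≥0∞ :=
  ∫⁻ z, ‖deriv f z‖ₑ ^ 2 * greenPotential μ z ∂discArea

/-- The square of the norm of `𝓓_μ`: `‖f‖² = ‖f‖²_{H²} + 𝓓_μ(f)`. -/
noncomputable def dirichletNormSq (μ : Measure ℂ) (f : ℂ → ℂ) : ℝ≥0∞ :=
  hardyNorm 2 f ^ 2 + dirichletIntegral μ f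

theorem measurable_greenPotential (μ : Measure ℂ) [SFinite μ] :
    Measurable (greenPotential μ) := by
  refine Measurable.lintegral_prod_right' (f := fun p : ℂ × ℂ => greenKernel p.1 p.2) ?_
  unfold greenKernel
  refine Measurable.ite (measurableSet_eq_fun measurable_fst measurable_snd) measurable_const ?_
  have h : Measurable fun p : ℂ × ℂ => (1 - conj p.2 * p.1) / (p.1 - p.2) := by
    refine Measurable.div ?_ (measurable_fst.sub measurable_snd)
    exact (by fun_prop : Continuous fun p : ℂ × ℂ => 1 - conj p.2 * p.1).measurable
  exact (Real.measurable_log.comp h.norm).ennreal_ofReal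

theorem arcLength_compl_sphere : arcLength (Metric.sphere (0 : ℂ) 1)ᶜ = 0 := by
  rw [arcLength, Measure.map_apply (continuous_circleMap 0 1).measurable
    (Metric.isClosed_sphere.measurableSet.compl)]
  have : circleMap 0 1 ⁻¹' (Metric.sphere (0 : ℂ) 1)ᶜ = ∅ := by
    ext θ
    simp
  simp [this]

theorem aestronglyMeasurable_dilation {f : ℂ → ℂ}
    (hf : DifferentiableOn ℂ f (Metric.ball 0 1)) {r : ℝ} (hr : r ∈ Ico (0 : ℝ) 1) :
    AEStronglyMeasurable (fun ζ : ℂ => f (r * ζ)) arcLength := by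
  have h : ContinuousOn (fun ζ : ℂ => f (r * ζ)) (Metric.sphere 0 1) := by
    refine hf.continuousOn.comp (by fun_prop) ?_
    intro ζ hζ
    have : ‖ζ‖ = 1 := by simpa using hζ
    simp [this, abs_of_nonneg hr.1, hr.2]
  have h2 : arcLength.restrict (Metric.sphere (0 : ℂ) 1) = arcLength :=
    Measure.restrict_eq_self_of_ae_mem arcLength_compl_sphere
  rw [← h2]
  exact h.aestronglyMeasurable Metric.isClosed_sphere.measurableSet

theorem MemHardy.add {f g : ℂ → ℂ} (hf : MemHardy 2 f) (hg : MemHardy 2 g) :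
    MemHardy 2 (f + g) := by
  refine ⟨hf.1.add hg.1, lt_of_le_of_lt ?_ (ENNReal.add_lt_top.2 ⟨hf.2, hg.2⟩)⟩
  refine iSup₂_le fun r hr => ?_
  refine (eLpNorm_add_le (aestronglyMeasurable_dilation hf.1 hr)
    (aestronglyMeasurable_dilation hg.1 hr) (by norm_num)).trans ?_
  exact add_le_add (le_iSup₂_of_le r hr le_rfl) (le_iSup₂_of_le r hr le_rfl)

theorem MemHardy.const_smul {f : ℂ → ℂ} (c : ℂ) (hf : MemHardy 2 f) : MemHardy 2 (c • f) := by
  refine ⟨hf.1.const_smul c, lt_of_le_of_lt ?_ (ENNReal.mul_lt_top (enorm_lt_top (x := c)) hf.2)⟩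
  refine iSup₂_le fun r hr => ?_
  refine (eLpNorm_const_smul_le (c := c) (f := fun ζ : ℂ => f (r * ζ))).trans ?_
  gcongr
  exact le_iSup₂_of_le r hr le_rfl

theorem dirichletIntegral_add_lt_top {μ : Measure ℂ} [SFinite μ] {f g : ℂ → ℂ}
    (hf : DifferentiableOn ℂ f (Metric.ball 0 1)) (hg : DifferentiableOn ℂ g (Metric.ball 0 1))
    (hf' : dirichletIntegral μ f < ∞) (hg' : dirichletIntegral μ g < ∞) :
    dirichletIntegral μ (f + g) < ∞ := by
  have hmeas : Measurable fun z => 2 * (‖deriv f z‖ₑ ^ 2 * greenPotential μ z) :=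
    (((measurable_deriv f).enorm.pow_const 2).mul (measurable_greenPotential μ)).const_mul 2
  have hle : dirichletIntegral μ (f + g) ≤
      ∫⁻ z, 2 * (‖deriv f z‖ₑ ^ 2 * greenPotential μ z) +
        2 * (‖deriv g z‖ₑ ^ 2 * greenPotential μ z) ∂discArea := by
    refine lintegral_mono_ae ?_
    have hball : ∀ᵐ z ∂discArea, z ∈ Metric.ball (0 : ℂ) 1 :=
      Measure.ae_smul_measure (ae_restrict_mem Metric.isOpen_ball.measurableSet) _
    filter_upwards [hball] with z hz
    rw [deriv_add (hf.differentiableAt (Metric.isOpen_ball.mem_nhds hz))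
      (hg.differentiableAt (Metric.isOpen_ball.mem_nhds hz)), ← mul_add, ← add_mul, ← mul_assoc]
    gcongr
    have h1 : ‖deriv f z + deriv g z‖ ^ 2 ≤ 2 * (‖deriv f z‖ ^ 2 + ‖deriv g z‖ ^ 2) := by
      nlinarith [norm_add_le (deriv f z) (deriv g z), norm_nonneg (deriv f z + deriv g z),
        sq_nonneg (‖deriv f z‖ - ‖deriv g z‖)]
    simp only [← ofReal_norm]
    rw [← ENNReal.ofReal_pow (norm_nonneg _), ← ENNReal.ofReal_pow (norm_nonneg _),
      ← ENNReal.ofReal_pow (norm_nonneg _), ← ENNReal.ofReal_add (by positivity) (by positivity),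
      ← ENNReal.ofReal_ofNat 2, ← ENNReal.ofReal_mul (by norm_num)]
    exact ENNReal.ofReal_le_ofReal h1
  refine hle.trans_lt ?_
  rw [lintegral_add_left hmeas, lintegral_const_mul' _ _ (by simp),
    lintegral_const_mul' _ _ (by simp)]
  exact ENNReal.add_lt_top.2 ⟨ENNReal.mul_lt_top (by simp) hf', ENNReal.mul_lt_top (by simp) hg'⟩

theorem dirichletIntegral_const_smul_lt_top {μ : Measure ℂ} {f : ℂ → ℂ} (c : ℂ)
    (hf' : dirichletIntegral μ f < ∞) : dirichletIntegral μ (c • f) < ∞ := by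
  have : dirichletIntegral μ (c • f) = ‖c‖ₑ ^ 2 * dirichletIntegral μ f := by
    unfold dirichletIntegral
    rw [← lintegral_const_mul' _ _ (by simp)]
    refine lintegral_congr fun z => ?_
    rw [deriv_const_smul_field, enorm_smul, mul_pow, mul_assoc]
  rw [this]
  exact ENNReal.mul_lt_top (by simp) hf'

/-- The Dirichlet space `𝓓_μ = {f ∈ H² : 𝓓_μ(f) < ∞}`. -/
def dirichletSpace (μ : Measure ℂ) [SFinite μ] : Submodule ℂ (ℂ → ℂ) where
  carrier := {f | MemHardy 2 f ∧ dirichletIntegral μ f < ∞}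
  add_mem' hf hg := ⟨hf.1.add hg.1, dirichletIntegral_add_lt_top hf.1.1 hg.1.1 hf.2 hg.2⟩
  zero_mem' := by
    refine ⟨⟨differentiableOn_const 0, ?_⟩, ?_⟩
    · simp [hardyNorm]
    · have h : deriv (0 : ℂ → ℂ) = 0 := by
        ext z
        exact deriv_const z 0
      simp [dirichletIntegral, h]
  smul_mem' c _ hf := ⟨hf.1.const_smul c, dirichletIntegral_const_smul_lt_top c hf.2⟩

/-- `M` is a closed subspace of `𝓓_μ`, invariant under the shift `g ↦ z g`. -/
structure IsClosedInvariant (μ : Measure ℂ) [SFinite μ] (M : Submodule ℂ (ℂ → ℂ)) : Prop where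
  le : M ≤ dirichletSpace μ
  closed : ∀ g ∈ dirichletSpace μ,
    (∀ ε : ℝ≥0∞, 0 < ε → ∃ u ∈ M, dirichletNormSq μ (g - u) < ε) → g ∈ M
  shift : ∀ g ∈ M, (fun z => z * g z) ∈ M

/-- `[f]`, the smallest closed invariant subspace of `𝓓_μ` that contains `f`. -/
def generatedSubspace (μ : Measure ℂ) [SFinite μ] (f : ℂ → ℂ) : Submodule ℂ (ℂ → ℂ) :=
  sInf {M | IsClosedInvariant μ M ∧ f ∈ M}

/-- `f` is cyclic in `𝓓_μ`: it belongs to `𝓓_μ` and `[f] = 𝓓_μ`. -/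
def IsCyclic (μ : Measure ℂ) [SFinite μ] (f : ℂ → ℂ) : Prop :=
  f ∈ dirichletSpace μ ∧ generatedSubspace μ f = dirichletSpace μ

/-- `A_μ(ζ, λ) = ∫_𝔻 (1 - |z|²) / |ζ - z|² · (1 - |z|²) / |λ - z|² dμ(z)`. -/
noncomputable def douglasKernel (μ : Measure ℂ) (ζ l : ℂ) : ℝ≥0∞ :=
  ∫⁻ z, ENNReal.ofReal
    ((1 - ‖z‖ ^ 2) / ‖ζ - z‖ ^ 2 * ((1 - ‖z‖ ^ 2) / ‖l - z‖ ^ 2)) ∂μ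

/-- The Dirichlet integral `∫_𝕋 ∫_𝕋 |g(ζ) - g(λ)|² A_μ(ζ, λ) dm(ζ) dm(λ)` of the harmonic
version `𝓓_μ^h` of `𝓓_μ`. -/
noncomputable def harmonicDirichletIntegral (μ : Measure ℂ) (g : ℂ → ℂ) : ℝ≥0∞ :=
  ∫⁻ l, ∫⁻ ζ, ‖g ζ - g l‖ₑ ^ 2 * douglasKernel μ ζ l ∂arcLength ∂arcLength

/-- Membership in `𝓓_μ^h = {g ∈ L²(𝕋) : 𝓓_μ^h(g) < ∞}`. -/
def MemHarmonicDirichlet (μ : Measure ℂ) (g : ℂ → ℂ) : Prop :=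
  MemLp g 2 arcLength ∧ harmonicDirichletIntegral μ g < ∞

/-- The capacity `c_μ(E)` of `E ⊆ 𝕋`: the infimum of `‖g‖²_{L²(𝕋)} + 𝓓_μ^h(g)` over all
`g ∈ 𝓓_μ^h` with `|g| ≥ 1` almost everywhere on `U ∩ 𝕋` for some open `U ⊇ E`. -/
noncomputable def capacity (μ : Measure ℂ) (E : Set ℂ) : ℝ≥0∞ :=
  ⨅ (g : ℂ → ℂ) (_ : MemHarmonicDirichlet μ g)
    (_ : ∃ U : Set ℂ, IsOpen U ∧ E ⊆ U ∧ ∀ᵐ ζ ∂arcLength, ζ ∈ U → 1 ≤ ‖g ζ‖),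
    eLpNorm g 2 arcLength ^ 2 + harmonicDirichletIntegral μ g

/-- `Z(f)`, the set of points of `𝕋` at which `f` has radial limit `0`. -/
def radialZeroSet (f : ℂ → ℂ) : Set ℂ :=
  {ζ | ζ ∈ Metric.sphere (0 : ℂ) 1 ∧ Tendsto (fun r : ℝ => f (r * ζ)) (𝓝[<] 1) (𝓝 0)}

end BrownShields

/-! The proof rests on `localDirichlet_eq`. The Dirichlet integral of f with the Green kernel of one
pole w as weight equals ½ (1 - |w|²) times the squared H² norm of the difference quotient (f -
f(w))/(z - w). A Möbius involution moves the pole to 0, where the identity is read off from Taylor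
coefficients. By Tonelli, 𝓓_μ(f) is the μ-integral of these local integrals, so estimates in 𝓓_μ
become H² estimates of difference quotients. For |f| ≤ A the local integral is at most 4A² for every
w; as μ is finite, bounded analytic functions lie in 𝓓_μ. A dilation costs at most a factor 9. For
fixed w the local integral is bounded by C_w times the squared H² norm. Dominated convergence then
turns H² convergence with a μ-integrable majorant of the local integrals into convergence in 𝓓_μ
(`tendsto_dirichletNormSq`).

Outer implies cyclic. By `mul_mem_of_bound`, a bounded ψ with ψf in 𝓓_μ satisfies ψf ∈ [f]. For
outer f with data h, let ψ_n be the reciprocal of the outer function with data max(h, -n). Then ψ_n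
is bounded by e^n, and ψ_n f is bounded by 1 and tends in H² to a unimodular constant. Hence 1 ∈
[f], and dilations show that the multiples of 1 by polynomials are dense.

Cyclic implies outer. The norm of 𝓓_μ dominates that of H², so 1 is an H² limit of polynomial
multiples pf. This excludes zeros of f and, through Jensen's inequality for p, gives ∫ log|F| dm ≤
log|f(0)| for the boundary function F. With Scheffé's lemma, log|f| is the Poisson integral of
log|F|, so f is outer.

Capacity. Integrating the kernel A_μ in one variable gives the sweep of μ to the circle, an
integrable density. Testing with the indicator of an open set U bounds the capacity by m(U) plus
twice the integral of that density over U, which is small for suitable U around a null set. The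
reverse bound m(E) ≤ c_μ(E) is immediate. The radial zeros of an outer function form a null set, so
the capacity condition in the second statement is automatic. -/

namespace BrownShields

local notation "𝔻" => Metric.ball (0 : ℂ) 1

/-! ### Normalized arc length -/

instance : IsProbabilityMeasure arcLength := by
  constructor
  rw [arcLength, Measure.map_apply (continuous_circleMap 0 1).measurable MeasurableSet.univ]
  simp only [preimage_univ, Measure.smul_apply, Measure.restrict_apply MeasurableSet.univ,
    univ_inter, Real.volume_Ioc, sub_zero, smul_eq_mul]
  exact ENNReal.inv_mul_cancel (by simp [Real.pi_pos]) ENNReal.ofReal_ne_top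

theorem ae_norm_eq_one : ∀ᵐ ζ ∂arcLength, ‖ζ‖ = 1 := by
  have := arcLength_compl_sphere
  rw [← mem_ae_iff] at this
  filter_upwards [this] with ζ hζ
  simpa using hζ

theorem arcLength_restrict_sphere : arcLength.restrict (Metric.sphere (0 : ℂ) 1) = arcLength :=
  Measure.restrict_eq_self_of_ae_mem arcLength_compl_sphere

theorem aestronglyMeasurable_arcLength {E : Type*} [NormedAddCommGroup E] {f : ℂ → E}
    (hf : ContinuousOn f (Metric.sphere 0 1)) : AEStronglyMeasurable f arcLength := by
  rw [← arcLength_restrict_sphere]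
  exact hf.aestronglyMeasurable_of_isCompact (isCompact_sphere _ _) Metric.isClosed_sphere.measurableSet

theorem integrable_arcLength {E : Type*} [NormedAddCommGroup E] {f : ℂ → E}
    (hf : ContinuousOn f (Metric.sphere 0 1)) : Integrable f arcLength := by
  obtain ⟨C, hC⟩ := (isCompact_sphere (0 : ℂ) 1).exists_bound_of_continuousOn hf
  refine Integrable.of_bound (aestronglyMeasurable_arcLength hf) C ?_
  filter_upwards [ae_norm_eq_one] with ζ hζ
  exact hC ζ (by simpa using hζ)

theorem integral_arcLength {E : Type*} [NormedAddCommGroup E] [NormedSpace ℝ E] {f : ℂ → E}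
    (hf : AEStronglyMeasurable f arcLength) :
    ∫ ζ, f ζ ∂arcLength = Real.circleAverage f 0 1 := by
  rw [arcLength] at hf ⊢
  rw [integral_map (continuous_circleMap 0 1).aemeasurable hf, integral_smul_measure,
    Real.circleAverage_def, intervalIntegral.integral_of_le Real.two_pi_pos.le]
  simp [Real.pi_pos.le]

theorem circleIntegrable_of_integrable {E : Type*} [NormedAddCommGroup E] {f : ℂ → E}
    (hf : Integrable f arcLength) : CircleIntegrable f 0 1 := by
  have h := hf
  rw [arcLength, integrable_map_measure hf.1 (continuous_circleMap 0 1).aemeasurable] at h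
  rw [CircleIntegrable, intervalIntegrable_iff_integrableOn_Ioc_of_le Real.two_pi_pos.le]
  rwa [integrable_smul_measure (ENNReal.inv_ne_zero.2 ENNReal.ofReal_ne_top)
    (by simp [Real.pi_pos])] at h

theorem integrable_of_circleIntegrable {E : Type*} [NormedAddCommGroup E] {f : ℂ → E}
    (hm : AEStronglyMeasurable f arcLength) (hf : CircleIntegrable f 0 1) :
    Integrable f arcLength := by
  rw [arcLength] at hm ⊢
  rw [integrable_map_measure hm (continuous_circleMap 0 1).aemeasurable]
  rw [CircleIntegrable, intervalIntegrable_iff_integrableOn_Ioc_of_le Real.two_pi_pos.le] at hf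
  rwa [integrable_smul_measure (ENNReal.inv_ne_zero.2 ENNReal.ofReal_ne_top)
    (by simp [Real.pi_pos])]

theorem mul_mem_ball {r : ℝ} {z : ℂ} (h0 : 0 ≤ r) (h1 : r < 1) (hz : ‖z‖ ≤ 1) :
    (r : ℂ) * z ∈ Metric.ball (0 : ℂ) 1 := by
  have : ‖(r : ℂ) * z‖ = r * ‖z‖ := by simp [abs_of_nonneg h0]
  simp only [mem_ball_zero_iff, this]
  nlinarith [norm_nonneg z]

theorem diffContOnCl_dilation {f : ℂ → ℂ} (hf : DifferentiableOn ℂ f (Metric.ball 0 1)) {r : ℝ}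
    (h0 : 0 ≤ r) (h1 : r < 1) : DiffContOnCl ℂ (fun z => f (r * z)) (Metric.ball 0 1) := by
  refine DifferentiableOn.diffContOnCl ?_
  rw [closure_ball _ one_ne_zero]
  refine hf.comp (by fun_prop) fun z hz => mul_mem_ball h0 h1 (by simpa using hz)

theorem continuousOn_sphere_of_diffContOnCl {f : ℂ → ℂ} (hf : DiffContOnCl ℂ f (Metric.ball 0 1)) :
    ContinuousOn f (Metric.sphere 0 1) := by
  refine hf.continuousOn.mono ?_
  rw [closure_ball _ one_ne_zero]
  exact Metric.sphere_subset_closedBall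

theorem integral_arcLength_eq {f : ℂ → ℂ} (hf : DiffContOnCl ℂ f (Metric.ball 0 1)) :
    ∫ ζ, f ζ ∂arcLength = f 0 := by
  rw [integral_arcLength (aestronglyMeasurable_arcLength (continuousOn_sphere_of_diffContOnCl hf))]
  exact DiffContOnCl.circleAverage (by simpa using hf)

theorem continuousOn_poisson {w : ℂ} (hw : w ∈ Metric.ball (0 : ℂ) 1) :
    ContinuousOn (fun ζ : ℂ => (1 - ‖w‖ ^ 2) / ‖ζ - w‖ ^ 2) (Metric.sphere 0 1) := by
  refine ContinuousOn.div (by fun_prop) (by fun_prop) fun ζ hζ => ?_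
  have : ζ ≠ w := by
    rintro rfl
    simp at hζ hw
    linarith
  have := norm_pos_iff.2 (sub_ne_zero.2 this)
  positivity

theorem integral_poisson_mul {f : ℂ → ℂ} (hf : DiffContOnCl ℂ f (Metric.ball 0 1)) {w : ℂ}
    (hw : w ∈ Metric.ball (0 : ℂ) 1) :
    ∫ ζ, ((1 - ‖w‖ ^ 2) / ‖ζ - w‖ ^ 2) • f ζ ∂arcLength = f w := by
  rw [integral_arcLength, ← hf.circleAverage_poissonKernel_smul' hw]
  · refine Real.circleAverage_congr_sphere fun ζ hζ => ?_
    have : ‖ζ‖ = 1 := by simpa using hζ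
    simp [this]
  · exact aestronglyMeasurable_arcLength
      ((continuousOn_poisson hw).smul (continuousOn_sphere_of_diffContOnCl hf))

theorem one_sub_sq_pos {w : ℂ} (hw : w ∈ Metric.ball (0 : ℂ) 1) : 0 < 1 - ‖w‖ ^ 2 := by
  have : ‖w‖ < 1 := by simpa using hw
  nlinarith [norm_nonneg w]

theorem lintegral_poisson {w : ℂ} (hw : w ∈ Metric.ball (0 : ℂ) 1) :
    ∫⁻ ζ, ENNReal.ofReal ((1 - ‖w‖ ^ 2) / ‖ζ - w‖ ^ 2) ∂arcLength = 1 := by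
  have h := integral_poisson_mul (f := fun _ => 1) diffContOnCl_const hw
  rw [← ofReal_integral_eq_lintegral_ofReal (integrable_arcLength (continuousOn_poisson hw))]
  · simp only [Complex.real_smul, mul_one] at h
    rw [integral_complex_ofReal] at h
    rw [Complex.ofReal_eq_one.1 h]
    simp
  · exact ae_of_all _ fun ζ => div_nonneg (one_sub_sq_pos hw).le (sq_nonneg _)

/-! ### Parseval's identity for powers of a unimodular function -/

theorem integral_pow_mul_conj_pow {ν : Measure ℂ} {e : ℂ → ℂ} (he : ∀ᵐ ζ ∂ν, ‖e ζ‖ = 1)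
    (hν : ∀ k : ℕ, ∫ ζ, e ζ ^ k ∂ν = if k = 0 then 1 else 0) (n m : ℕ) :
    ∫ ζ, e ζ ^ n * conj (e ζ ^ m) ∂ν = if n = m then 1 else 0 := by
  wlog h : m ≤ n generalizing n m
  · have := this m n (le_of_not_ge h)
    rw [← Complex.conj_conj (∫ ζ, e ζ ^ n * conj (e ζ ^ m) ∂ν), ← integral_conj]
    simp only [map_mul, Complex.conj_conj]
    simp_rw [mul_comm (conj _) (_ ^ m), this, eq_comm (a := n)]
    split_ifs <;> simp
  obtain ⟨k, rfl⟩ := Nat.exists_eq_add_of_le h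
  have h1 : ∫ ζ, e ζ ^ (m + k) * conj (e ζ ^ m) ∂ν = ∫ ζ, e ζ ^ k ∂ν := by
    refine integral_congr_ae ?_
    filter_upwards [he] with ζ hζ
    rw [pow_add, mul_right_comm, Complex.mul_conj]
    simp [Complex.normSq_eq_norm_sq, hζ]
  rw [h1, hν]
  simp

/-- The powers of e are orthonormal, so expanding the square as an absolutely convergent double
series leaves only the diagonal. The generality in ν and e serves two uses: e = id with arc length,
and e a Möbius map with a Poisson-weighted measure. -/
theorem lintegral_enorm_sq_tsum {ν : Measure ℂ} [IsProbabilityMeasure ν] {e : ℂ → ℂ}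
    (hm : Measurable e) (he : ∀ᵐ ζ ∂ν, ‖e ζ‖ = 1)
    (hν : ∀ k : ℕ, ∫ ζ, e ζ ^ k ∂ν = if k = 0 then 1 else 0)
    {c : ℕ → ℂ} (hc : Summable fun n => ‖c n‖) :
    ∫⁻ ζ, ‖∑' n, c n * e ζ ^ n‖ₑ ^ 2 ∂ν = ∑' n, ‖c n‖ₑ ^ 2 := by
  have hsq : Summable fun n => ‖c n‖ ^ 2 := by
    refine hc.of_norm_bounded_eventually_nat ?_
    filter_upwards [(hc.tendsto_atTop_zero).eventually_le_const one_pos] with n hn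
    rw [norm_pow, norm_norm]
    nlinarith [norm_nonneg (c n)]
  have hprod : Summable fun p : ℕ × ℕ => ‖c p.1‖ * ‖c p.2‖ :=
    hc.mul_of_nonneg hc (fun _ => norm_nonneg _) (fun _ => norm_nonneg _)
  set F : ℕ × ℕ → ℂ → ℂ := fun p ζ =>
    (c p.1 * conj (c p.2)) * (e ζ ^ p.1 * conj (e ζ ^ p.2)) with hF
  have hFm : ∀ p, Measurable (F p) := fun p =>
    ((hm.pow_const _).mul (Complex.continuous_conj.measurable.comp (hm.pow_const _))).const_mul _
  have hFb : ∀ p, ∀ᵐ ζ ∂ν, ‖F p ζ‖ = ‖c p.1‖ * ‖c p.2‖ := by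
    intro p
    filter_upwards [he] with ζ hζ
    simp [hF, hζ]
  have hFi : ∀ p, Integrable (F p) ν := fun p =>
    Integrable.of_bound (hFm p).aestronglyMeasurable _ ((hFb p).mono fun ζ h => h.le)
  have hFn : ∀ p, ∫ ζ, ‖F p ζ‖ ∂ν = ‖c p.1‖ * ‖c p.2‖ := by
    intro p
    rw [integral_congr_ae (hFb p)]
    simp
  have h1 := hasSum_integral_of_summable_integral_norm hFi (by simpa only [hFn] using hprod)
  have h2 : ∀ p, ∫ ζ, F p ζ ∂ν = if p.1 = p.2 then (‖c p.1‖ ^ 2 : ℂ) else 0 := by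
    intro p
    rw [hF]
    simp only
    rw [integral_const_mul, integral_pow_mul_conj_pow he hν]
    split_ifs with h
    · rw [h, Complex.mul_conj, Complex.normSq_eq_norm_sq]; simp
    · simp
  have h3 : HasSum (fun p : ℕ × ℕ => if p.1 = p.2 then (‖c p.1‖ ^ 2 : ℂ) else 0)
      (∑' n, (‖c n‖ ^ 2 : ℂ)) := by
    have hinj : Function.Injective (fun n : ℕ => (n, n)) := fun a b h => by simpa using h
    rw [← hinj.hasSum_iff]
    · simp only [Function.comp_def, if_true]
      refine Summable.hasSum ?_
      simpa using Complex.ofRealCLM.summable hsq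
    · rintro ⟨a, b⟩ hab
      rw [if_neg]
      rintro h
      exact hab ⟨a, by simpa using h⟩
  simp_rw [h2] at h1
  have h4 := h1.unique h3
  have hsum : ∀ᵐ ζ ∂ν, Summable fun n => ‖c n * e ζ ^ n‖ := by
    filter_upwards [he] with ζ hζ
    simpa [hζ] using hc
  have hpt : ∀ᵐ ζ ∂ν, ∑' p, F p ζ = ((‖∑' n, c n * e ζ ^ n‖ ^ 2 : ℝ) : ℂ) := by
    filter_upwards [hsum] with ζ hs
    have hs' : Summable fun n => ‖conj (c n * e ζ ^ n)‖ := by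
      simpa only [RCLike.norm_conj] using hs
    rw [← Complex.normSq_eq_norm_sq, ← Complex.mul_conj, Complex.conj_tsum,
      tsum_mul_tsum_of_summable_norm hs hs']
    refine tsum_congr fun p => ?_
    simp only [hF, map_mul]
    ring
  rw [integral_congr_ae hpt, integral_complex_ofReal] at h4
  have h5 : ∫ ζ, ‖∑' n, c n * e ζ ^ n‖ ^ 2 ∂ν = ∑' n, ‖c n‖ ^ 2 := by
    exact_mod_cast h4
  have hmeas : AEStronglyMeasurable (fun ζ => ∑' n, c n * e ζ ^ n) ν := by
    refine aestronglyMeasurable_of_tendsto_ae atTop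
      (f := fun k ζ => ∑ n ∈ Finset.range k, c n * e ζ ^ n) (fun k => ?_) ?_
    · exact (Finset.measurable_fun_sum _ fun n _ => (hm.pow_const _).const_mul _).aestronglyMeasurable
    · filter_upwards [hsum] with ζ hs
      exact hs.of_norm.hasSum.tendsto_sum_nat
  have hint : Integrable (fun ζ => ‖∑' n, c n * e ζ ^ n‖ ^ 2) ν := by
    refine Integrable.of_bound (hmeas.norm.pow 2) ((∑' n, ‖c n‖) ^ 2) ?_
    filter_upwards [he, hsum] with ζ hζ hs
    rw [norm_pow, norm_norm]
    gcongr
    refine (norm_tsum_le_tsum_norm hs).trans (le_of_eq ?_)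
    simp [hζ]
  have h6 := ofReal_integral_eq_lintegral_ofReal hint (ae_of_all _ fun ζ => sq_nonneg _)
  rw [h5, ENNReal.ofReal_tsum_of_nonneg (fun n => sq_nonneg _) hsq] at h6
  simp only [ENNReal.ofReal_pow (norm_nonneg _), ofReal_norm] at h6
  exact h6.symm

/-- A sequence of radii increasing to `1`. -/
noncomputable def radius (k : ℕ) : ℝ := 1 - 1 / ((k : ℝ) + 2)

theorem radius_mem (k : ℕ) : radius k ∈ Ioo (0 : ℝ) 1 := by
  have h : (0 : ℝ) < (k : ℝ) + 2 := by positivity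
  have h1 : 1 / ((k : ℝ) + 2) < 1 := by
    rw [div_lt_one h]
    linarith [(Nat.cast_nonneg k : (0 : ℝ) ≤ k)]
  have h2 : 0 < 1 / ((k : ℝ) + 2) := by positivity
  constructor <;> simp only [radius] <;> linarith

theorem tendsto_radius : Tendsto radius atTop (𝓝[<] 1) := by
  refine tendsto_nhdsWithin_iff.2 ⟨?_, Eventually.of_forall fun k => (radius_mem k).2⟩
  have h : Tendsto (fun k : ℕ => 1 / ((k : ℝ) + 2)) atTop (𝓝 0) :=
    tendsto_const_nhds.div_atTop (tendsto_natCast_atTop_atTop.atTop_add tendsto_const_nhds)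
  have h1 := h.const_sub 1
  rw [sub_zero] at h1
  exact h1

theorem integral_pow_arcLength (k : ℕ) : ∫ ζ, ζ ^ k ∂arcLength = if k = 0 then 1 else 0 := by
  rw [integral_arcLength_eq (f := fun ζ => ζ ^ k) (Differentiable.diffContOnCl (by fun_prop))]
  exact zero_pow_eq k

/-! ### The Hardy norm -/

theorem eLpNorm_two_sq {f : ℂ → ℂ} {ν : Measure ℂ} :
    eLpNorm f 2 ν ^ 2 = ∫⁻ x, ‖f x‖ₑ ^ 2 ∂ν := by
  have := eLpNorm_nnreal_pow_eq_lintegral (f := f) (μ := ν) (p := 2) two_ne_zero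
  simpa using this

theorem sq_le_of_le_rpow {a C : ℝ≥0∞} : a ^ 2 ≤ C ↔ a ≤ C ^ (1 / 2 : ℝ) := by
  rw [← ENNReal.rpow_natCast, one_div, ENNReal.le_rpow_inv_iff (by norm_num)]
  norm_num

theorem hardyNorm_sq_le_iff {f : ℂ → ℂ} {C : ℝ≥0∞} :
    hardyNorm 2 f ^ 2 ≤ C ↔
      ∀ r ∈ Ico (0 : ℝ) 1, ∫⁻ ζ, ‖f (r * ζ)‖ₑ ^ 2 ∂arcLength ≤ C := by
  simp_rw [sq_le_of_le_rpow, hardyNorm, iSup₂_le_iff, ← sq_le_of_le_rpow, eLpNorm_two_sq]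

theorem lintegral_le_hardyNorm_sq (f : ℂ → ℂ) {r : ℝ} (hr : r ∈ Ico (0 : ℝ) 1) :
    ∫⁻ ζ, ‖f (r * ζ)‖ₑ ^ 2 ∂arcLength ≤ hardyNorm 2 f ^ 2 :=
  hardyNorm_sq_le_iff.1 le_rfl r hr

theorem hardyNorm_congr {p : ℝ≥0∞} {f g : ℂ → ℂ} (h : EqOn f g 𝔻) :
    hardyNorm p f = hardyNorm p g := by
  refine iSup_congr fun r => iSup_congr fun hr => eLpNorm_congr_ae ?_
  filter_upwards [ae_norm_eq_one] with ζ hζ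
  exact h (mul_mem_ball hr.1 hr.2 hζ.le)

theorem exists_hasSum {f : ℂ → ℂ} (hf : DifferentiableOn ℂ f 𝔻) :
    ∃ a : ℕ → ℂ, ∀ z ∈ 𝔻, HasSum (fun n => a n * z ^ n) (f z) := by
  refine ⟨fun n => (n.factorial : ℂ)⁻¹ * iteratedDeriv n f 0, fun z hz => ?_⟩
  have := Complex.hasSum_taylorSeries_on_ball (c := 0) (r := 1) hf (z := z) (by simpa using hz)
  refine this.congr_fun fun n => ?_
  simp [mul_comm, mul_left_comm]

theorem lintegral_dilation_eq {f : ℂ → ℂ} {a : ℕ → ℂ} {r : ℝ} (hr : 0 ≤ r)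
    (hf : ∀ z : ℂ, ‖z‖ = r → HasSum (fun n => a n * z ^ n) (f z)) :
    ∫⁻ ζ, ‖f (r * ζ)‖ₑ ^ 2 ∂arcLength = ∑' n, ‖a n * r ^ n‖ₑ ^ 2 := by
  rw [← lintegral_enorm_sq_tsum measurable_id ae_norm_eq_one integral_pow_arcLength
    (c := fun n => a n * r ^ n)]
  · refine lintegral_congr_ae ?_
    filter_upwards [ae_norm_eq_one] with ζ hζ
    rw [← (hf (r * ζ) (by simp [hζ, abs_of_nonneg hr])).tsum_eq]
    simp [mul_pow, mul_assoc]
  · exact (hf r (by simp [abs_of_nonneg hr])).summable.norm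

/-- On the circle of radius r Parseval gives ∑ |a_n|² r^(2n). This is at most the full sum, and each
of its partial sums converges to that of the full series as r → 1. -/
theorem hardyNorm_sq_eq {f : ℂ → ℂ} {a : ℕ → ℂ}
    (hf : ∀ z ∈ 𝔻, HasSum (fun n => a n * z ^ n) (f z)) :
    hardyNorm 2 f ^ 2 = ∑' n, ‖a n‖ₑ ^ 2 := by
  have key : ∀ r ∈ Ico (0 : ℝ) 1,
      ∫⁻ ζ, ‖f (r * ζ)‖ₑ ^ 2 ∂arcLength = ∑' n, ‖a n * r ^ n‖ₑ ^ 2 := fun r hr =>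
    lintegral_dilation_eq hr.1 fun z hz => hf z (by simp [hz, hr.2])
  apply le_antisymm
  · rw [hardyNorm_sq_le_iff]
    intro r hr
    rw [key r hr]
    refine ENNReal.tsum_le_tsum fun n => ?_
    gcongr
    rw [enorm_mul, enorm_pow]
    refine mul_le_of_le_one_right' (pow_le_one' ?_ n)
    rw [← ofReal_norm, ENNReal.ofReal_le_one]
    simpa [abs_of_nonneg hr.1] using hr.2.le
  · refine ENNReal.tsum_le_of_sum_range_le fun k => ?_
    have ht : Tendsto (fun r : ℝ => ∑ n ∈ Finset.range k, ‖a n * r ^ n‖ₑ ^ 2) (𝓝[<] 1)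
        (𝓝 (∑ n ∈ Finset.range k, ‖a n‖ₑ ^ 2)) := by
      have hc : Continuous (fun r : ℝ => ∑ n ∈ Finset.range k, ‖a n * r ^ n‖ₑ ^ 2) := by fun_prop
      have := (hc.tendsto 1).mono_left (nhdsWithin_le_nhds (s := Iio 1))
      simpa using this
    refine le_of_tendsto ht ?_
    filter_upwards [Ioo_mem_nhdsLT zero_lt_one] with r hr
    exact (ENNReal.sum_le_tsum _).trans
      ((key r ⟨hr.1.le, hr.2⟩).symm.le.trans (lintegral_le_hardyNorm_sq f ⟨hr.1.le, hr.2⟩))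

theorem lintegral_dilation_mono {f : ℂ → ℂ} (hf : DifferentiableOn ℂ f 𝔻) {r s : ℝ} (hr : 0 ≤ r)
    (hrs : r ≤ s) (hs : s < 1) :
    ∫⁻ ζ, ‖f (r * ζ)‖ₑ ^ 2 ∂arcLength ≤ ∫⁻ ζ, ‖f (s * ζ)‖ₑ ^ 2 ∂arcLength := by
  obtain ⟨a, ha⟩ := exists_hasSum hf
  rw [lintegral_dilation_eq hr fun z hz => ha z (by simp [hz, hrs.trans_lt hs]),
    lintegral_dilation_eq (hr.trans hrs) fun z hz => ha z (by simp [hz, hs])]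
  refine ENNReal.tsum_le_tsum fun n => ?_
  gcongr ?_ ^ 2
  rw [enorm_le_iff_norm_le]
  simp only [norm_mul, norm_pow, Complex.norm_real, Real.norm_eq_abs]
  gcongr

/-- The means increase with the radius, so a bound for radii near 1 suffices, and it may depend on
the radius as long as it converges. -/
theorem hardyNorm_sq_le_of_tendsto {f : ℂ → ℂ} (hf : DifferentiableOn ℂ f 𝔻) {C : ℝ → ℝ≥0∞}
    {C₀ : ℝ≥0∞} (h : ∀ᶠ s : ℝ in 𝓝[<] 1, ∫⁻ ζ, ‖f (s * ζ)‖ₑ ^ 2 ∂arcLength ≤ C s)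
    (hC : Tendsto C (𝓝[<] 1) (𝓝 C₀)) : hardyNorm 2 f ^ 2 ≤ C₀ := by
  rw [hardyNorm_sq_le_iff]
  intro r hr
  refine ge_of_tendsto hC ?_
  filter_upwards [h, Ioo_mem_nhdsLT hr.2] with s hs hrs
  exact (lintegral_dilation_mono hf hr.1 hrs.1.le hrs.2).trans hs

theorem hardyNorm_add_le {f g : ℂ → ℂ} (hf : DifferentiableOn ℂ f 𝔻)
    (hg : DifferentiableOn ℂ g 𝔻) :
    hardyNorm 2 (f + g) ≤ hardyNorm 2 f + hardyNorm 2 g := by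
  refine iSup₂_le fun r hr => ?_
  refine (eLpNorm_add_le (aestronglyMeasurable_dilation hf hr)
    (aestronglyMeasurable_dilation hg hr) (by norm_num)).trans ?_
  exact add_le_add (le_iSup₂_of_le r hr le_rfl) (le_iSup₂_of_le r hr le_rfl)

theorem hardyNorm_mul_le {f ψ : ℂ → ℂ} {A : ℝ} (hψ : ∀ z ∈ 𝔻, ‖ψ z‖ ≤ A) :
    hardyNorm 2 (ψ * f) ≤ ENNReal.ofReal A * hardyNorm 2 f := by
  refine iSup₂_le fun r hr => ?_
  refine (eLpNorm_le_mul_eLpNorm_of_ae_le_mul (g := fun ζ : ℂ => f (r * ζ)) (c := A) ?_ 2).trans ?_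
  · filter_upwards [ae_norm_eq_one] with ζ hζ
    simp only [Pi.mul_apply, norm_mul]
    gcongr
    exact hψ _ (mul_mem_ball hr.1 hr.2 hζ.le)
  · gcongr
    exact le_iSup₂_of_le r hr le_rfl

theorem hardyNorm_const (c : ℂ) : hardyNorm 2 (fun _ => c) ≤ ‖c‖ₑ := by
  refine iSup₂_le fun r hr => ?_
  rw [eLpNorm_const _ (by simp) (NeZero.ne _)]
  simp

theorem hardyNorm_le_of_bound {f : ℂ → ℂ} {A : ℝ} (hf : ∀ z ∈ 𝔻, ‖f z‖ ≤ A) :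
    hardyNorm 2 f ≤ ENNReal.ofReal A := by
  have := hardyNorm_mul_le (f := fun _ => 1) hf
  have h1 : hardyNorm 2 (fun _ => (1 : ℂ)) ≤ 1 := by simpa using hardyNorm_const 1
  calc hardyNorm 2 f = hardyNorm 2 (f * fun _ => 1) := hardyNorm_congr fun z _ => by simp
    _ ≤ _ := this
    _ ≤ ENNReal.ofReal A * 1 := by gcongr
    _ = _ := mul_one _

theorem hardyNorm_neg (f : ℂ → ℂ) : hardyNorm 2 (-f) = hardyNorm 2 f :=
  iSup_congr fun r => iSup_congr fun _ => eLpNorm_neg (fun ζ : ℂ => f (r * ζ)) 2 arcLength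

theorem hardyNorm_sub_comm (f g : ℂ → ℂ) : hardyNorm 2 (f - g) = hardyNorm 2 (g - f) := by
  rw [← hardyNorm_neg, neg_sub]

theorem hardyNorm_sub_le {f g : ℂ → ℂ} (hf : DifferentiableOn ℂ f 𝔻)
    (hg : DifferentiableOn ℂ g 𝔻) :
    hardyNorm 2 (f - g) ≤ hardyNorm 2 f + hardyNorm 2 g := by
  rw [sub_eq_add_neg, ← hardyNorm_neg g]
  exact hardyNorm_add_le hf hg.neg

theorem add_sq_le_two_mul (a b : ℝ≥0∞) : (a + b) ^ 2 ≤ 2 * a ^ 2 + 2 * b ^ 2 := by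
  have := ENNReal.rpow_add_le_mul_rpow_add_rpow a b (p := 2) (by norm_num)
  norm_num at this
  rwa [mul_add] at this

theorem hardyNorm_dilate_le (f : ℂ → ℂ) {s : ℝ} (hs : 0 ≤ s) (hs' : s ≤ 1) :
    hardyNorm 2 (fun z => f (s * z)) ≤ hardyNorm 2 f := by
  refine iSup₂_le fun r hr => ?_
  refine le_iSup₂_of_le (s * r) ⟨mul_nonneg hs hr.1, ?_⟩ (le_of_eq ?_)
  · nlinarith [hr.1, hr.2]
  · simp [mul_assoc]

theorem differentiableOn_dilate {f : ℂ → ℂ} (hf : DifferentiableOn ℂ f 𝔻) {s : ℝ} (hs : 0 ≤ s)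
    (hs' : s ≤ 1) : DifferentiableOn ℂ (fun z => f (s * z)) 𝔻 := by
  refine hf.comp (by fun_prop) fun z hz => ?_
  simp only [mem_ball_zero_iff] at hz ⊢
  simp only [norm_mul, Complex.norm_real, Real.norm_eq_abs, abs_of_nonneg hs]
  nlinarith [norm_nonneg z]

theorem tendsto_of_tendsto_sq {ι : Type*} {l : Filter ι} {u : ι → ℝ≥0∞}
    (hsq : Tendsto (fun i => u i ^ 2) l (𝓝 0)) : Tendsto u l (𝓝 0) := by
  have := (ENNReal.continuous_rpow_const (y := (1 / 2 : ℝ))).tendsto 0 |>.comp hsq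
  simp only [Function.comp_def] at this
  rw [ENNReal.zero_rpow_of_pos (by norm_num)] at this
  refine this.congr fun i => ?_
  rw [← ENNReal.rpow_natCast, ← ENNReal.rpow_mul]
  norm_num

/-- In coefficients this is dominated convergence for the counting measure: |s^n - 1| ≤ 1 and s^n →
1 for each n. -/
theorem tendsto_hardyNorm_dilate_sub {f : ℂ → ℂ} (hf : MemHardy 2 f) :
    Tendsto (fun s : ℝ => hardyNorm 2 ((fun z => f (s * z)) - f)) (𝓝[<] 1) (𝓝 0) := by
  obtain ⟨a, ha⟩ := exists_hasSum hf.1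
  have hfin : ∑' n, ‖a n‖ₑ ^ 2 < ∞ := by
    rw [← hardyNorm_sq_eq ha]
    exact ENNReal.pow_lt_top hf.2
  have hsq : Tendsto (fun s : ℝ => hardyNorm 2 ((fun z => f (s * z)) - f) ^ 2) (𝓝[<] 1) (𝓝 0) := by
    have h1 : (fun s : ℝ => hardyNorm 2 ((fun z => f (s * z)) - f) ^ 2) =ᶠ[𝓝[<] 1]
        fun s : ℝ => ∫⁻ n, ‖a n * (s ^ n - 1)‖ₑ ^ 2 ∂(Measure.count : Measure ℕ) := by
      filter_upwards [Ioo_mem_nhdsLT zero_lt_one] with s hs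
      rw [lintegral_count]
      refine hardyNorm_sq_eq fun z hz => ?_
      have h2 := (ha (s * z) (mul_mem_ball hs.1.le hs.2
        (by simpa using (mem_ball_zero_iff.1 hz).le))).sub (ha z hz)
      refine h2.congr_fun fun n => ?_
      ring
    refine Tendsto.congr' h1.symm ?_
    have h0 : (0 : ℝ≥0∞) = ∫⁻ n, 0 ∂(Measure.count : Measure ℕ) := by simp
    rw [h0]
    refine tendsto_lintegral_filter_of_dominated_convergence (fun n => ‖a n‖ₑ ^ 2) ?_ ?_ ?_ ?_
    · exact Eventually.of_forall fun _ => Measurable.of_discrete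
    · filter_upwards [Ioo_mem_nhdsLT zero_lt_one] with s hs
      refine ae_of_all _ fun n => ?_
      gcongr
      rw [enorm_mul]
      refine mul_le_of_le_one_right' ?_
      rw [← ofReal_norm, ENNReal.ofReal_le_one]
      have h3 : s ^ n ≤ 1 := pow_le_one₀ hs.1.le hs.2.le
      have h4 : 0 ≤ s ^ n := pow_nonneg hs.1.le n
      have : ((s : ℂ) ^ n - 1) = ((s ^ n - 1 : ℝ) : ℂ) := by push_cast; ring
      rw [this, Complex.norm_real, Real.norm_eq_abs, abs_le]
      constructor <;> linarith
    · rw [lintegral_count]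
      exact hfin.ne
    · refine ae_of_all _ fun n => ?_
      have hc : Continuous fun s : ℝ => ‖a n * ((s : ℂ) ^ n - 1)‖ₑ ^ 2 := by fun_prop
      simpa using (hc.tendsto 1).mono_left (nhdsWithin_le_nhds (s := Iio 1))
  exact tendsto_of_tendsto_sq hsq

/-- Cauchy–Schwarz for the Taylor series against the geometric series ∑ |w|^(2n) = 1/(1 - |w|²). -/
theorem enorm_sq_mul_le_hardyNorm_sq {f : ℂ → ℂ} (hf : DifferentiableOn ℂ f 𝔻) {w : ℂ}
    (hw : w ∈ 𝔻) : ‖f w‖ₑ ^ 2 * ENNReal.ofReal (1 - ‖w‖ ^ 2) ≤ hardyNorm 2 f ^ 2 := by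
  obtain ⟨a, ha⟩ := exists_hasSum hf
  rw [hardyNorm_sq_eq ha]
  by_cases hfin : ∑' n, ‖a n‖ₑ ^ 2 = ∞
  · simp [hfin]
  have hsum : Summable fun n => ‖a n‖ ^ 2 := by
    have := ENNReal.summable_toReal hfin
    simpa using this
  have hw1 : ‖w‖ < 1 := by simpa using hw
  have hgeo : HasSum (fun n => (‖w‖ ^ n) ^ 2) (1 - ‖w‖ ^ 2)⁻¹ := by
    have := hasSum_geometric_of_lt_one (sq_nonneg ‖w‖) (by nlinarith [norm_nonneg w])
    simpa [← pow_mul, mul_comm] using this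
  have hcs := Real.inner_le_Lp_mul_Lq_tsum_of_nonneg Real.HolderConjugate.two_two
    (f := fun n => ‖a n‖) (g := fun n => ‖w‖ ^ n) (fun n => norm_nonneg _)
    (fun n => pow_nonneg (norm_nonneg _) n) (by simpa using hsum) (by simpa using hgeo.summable)
  have hle : ‖f w‖ ≤ ∑' n, ‖a n‖ * ‖w‖ ^ n := by
    rw [← (ha w hw).tsum_eq]
    have := norm_tsum_le_tsum_norm (f := fun n => a n * w ^ n) (ha w hw).summable.norm
    simpa using this
  have hle2 := hle.trans hcs
  simp only [Real.rpow_two] at hle2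
  rw [hgeo.tsum_eq, ← Real.sqrt_eq_rpow, ← Real.sqrt_eq_rpow] at hle2
  have h3 : ‖f w‖ ^ 2 ≤ (∑' n, ‖a n‖ ^ 2) * (1 - ‖w‖ ^ 2)⁻¹ := by
    refine (pow_le_pow_left₀ (norm_nonneg _) hle2 2).trans (le_of_eq ?_)
    rw [mul_pow, Real.sq_sqrt (tsum_nonneg fun _ => sq_nonneg _),
      Real.sq_sqrt (inv_nonneg.2 (one_sub_sq_pos hw).le)]
  have h4 : ‖f w‖ ^ 2 * (1 - ‖w‖ ^ 2) ≤ ∑' n, ‖a n‖ ^ 2 := by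
    rwa [← div_eq_mul_inv, le_div_iff₀ (one_sub_sq_pos hw)] at h3
  have h5 := ENNReal.ofReal_le_ofReal h4
  rw [ENNReal.ofReal_tsum_of_nonneg (fun n => sq_nonneg _) hsum,
    ENNReal.ofReal_mul (sq_nonneg _)] at h5
  simpa only [ENNReal.ofReal_pow (norm_nonneg _), ofReal_norm] using h5

/-! ### Difference quotients in the Hardy space -/

theorem differentiableOn_dslope_disc {f : ℂ → ℂ} (hf : DifferentiableOn ℂ f 𝔻) {w : ℂ}
    (hw : w ∈ 𝔻) : DifferentiableOn ℂ (dslope f w) 𝔻 :=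
  (Complex.differentiableOn_dslope (Metric.isOpen_ball.mem_nhds hw)).2 hf

theorem eq_add_sub_mul_dslope (f : ℂ → ℂ) (w z : ℂ) : f z = f w + (z - w) * dslope f w z := by
  have := sub_smul_dslope f w z
  rw [smul_eq_mul] at this
  rw [this]
  ring

/-- A difference quotient is determined by the factorization f = c + (z - w) q, also at z = w.
Product, difference and dilation rules for quotients thereby reduce to algebraic identities. -/
theorem dslope_eqOn {f q : ℂ → ℂ} {w c : ℂ} (hw : w ∈ 𝔻) (hq : DifferentiableOn ℂ q 𝔻)
    (h : ∀ z ∈ 𝔻, f z = c + (z - w) * q z) : EqOn (dslope f w) q 𝔻 := by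
  intro z hz
  rcases eq_or_ne z w with rfl | hzw
  · rw [dslope_same]
    have h1 : f =ᶠ[𝓝 z] fun y => c + (y - z) * q y := by
      filter_upwards [Metric.isOpen_ball.mem_nhds hz] with y hy using h y hy
    rw [h1.deriv_eq]
    have h2 : HasDerivAt (fun y => c + (y - z) * q y) (1 * q z + (z - z) * deriv q z) z :=
      (((hasDerivAt_id z).sub_const z).mul
        (hq.differentiableAt (Metric.isOpen_ball.mem_nhds hz)).hasDerivAt).const_add c
    rw [h2.deriv]
    simp
  · have h1 := eq_add_sub_mul_dslope f w z
    rw [h z hz, h w hw] at h1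
    have h2 : (z - w) * (dslope f w z - q z) = 0 := by linear_combination -h1
    rcases mul_eq_zero.1 h2 with h3 | h3
    · exact absurd (sub_eq_zero.1 h3) hzw
    · exact sub_eq_zero.1 h3

theorem sub_norm_le {w ζ : ℂ} {s : ℝ} (hs : 0 ≤ s) (hζ : ‖ζ‖ = 1) : s - ‖w‖ ≤ ‖s * ζ - w‖ := by
  have := norm_sub_norm_le (s * ζ) w
  simpa [hζ, abs_of_nonneg hs] using this

/-- Rescaled by s, the integrand is a multiple of the Poisson kernel at w/s, which has total mass 1.
-/
theorem lintegral_inv_sq_norm_sub {w : ℂ} {s : ℝ} (hs : ‖w‖ < s) :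
    ∫⁻ ζ, ENNReal.ofReal (1 / ‖s * ζ - w‖ ^ 2) ∂arcLength =
      ENNReal.ofReal (1 / (s ^ 2 - ‖w‖ ^ 2)) := by
  have hs0 : 0 < s := (norm_nonneg w).trans_lt hs
  have hsc : (s : ℂ) ≠ 0 := by exact_mod_cast hs0.ne'
  have hws : ‖w / s‖ = ‖w‖ / s := by simp [abs_of_pos hs0]
  have hmem : w / s ∈ 𝔻 := by
    rw [mem_ball_zero_iff, hws, div_lt_one hs0]
    exact hs
  have hpos : 0 < s ^ 2 - ‖w‖ ^ 2 := by nlinarith [norm_nonneg w]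
  rw [← mul_one (ENNReal.ofReal (1 / (s ^ 2 - ‖w‖ ^ 2))), ← lintegral_poisson hmem,
    ← lintegral_const_mul' _ _ ENNReal.ofReal_ne_top]
  refine lintegral_congr fun ζ => ?_
  rw [← ENNReal.ofReal_mul (by positivity), hws]
  congr 1
  have : ζ - w / s = (s * ζ - w) / s := by field_simp
  rw [this, norm_div, Complex.norm_real, Real.norm_eq_abs, abs_of_pos hs0]
  rcases eq_or_ne (‖s * ζ - w‖) 0 with h0 | h0
  · simp [h0]
  · field_simp

theorem dslope_norm_of_ne {f : ℂ → ℂ} {w z : ℂ} (h : z ≠ w) :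
    ‖dslope f w z‖ = ‖f z - f w‖ / ‖z - w‖ := by
  rw [eq_div_iff (norm_ne_zero_iff.2 (sub_ne_zero.2 h)), ← norm_mul, mul_comm]
  congr 1
  rw [eq_add_sub_mul_dslope f w z]
  ring

theorem ne_of_norm_lt {w ζ : ℂ} {s : ℝ} (hζ : ‖ζ‖ = 1) (hs : ‖w‖ < s) : (s : ℂ) * ζ ≠ w := by
  rintro rfl
  simp [hζ] at hs
  exact absurd (le_abs_self s) (not_le.2 hs)

/-- The numerator satisfies |f - f(w)|² ≤ 4A², and the denominator is integrated exactly. The loss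
1/(1 - |w|²) is what the factor 1 - |w|² in `localDirichlet_eq` compensates. -/
theorem hardyNorm_dslope_sq_le_of_bound {f : ℂ → ℂ} (hf : DifferentiableOn ℂ f 𝔻) {A : ℝ}
    (hA : ∀ z ∈ 𝔻, ‖f z‖ ≤ A) {w : ℂ} (hw : w ∈ 𝔻) :
    hardyNorm 2 (dslope f w) ^ 2 ≤ ENNReal.ofReal (4 * A ^ 2 / (1 - ‖w‖ ^ 2)) := by
  have hw1 : ‖w‖ < 1 := by simpa using hw
  refine hardyNorm_sq_le_of_tendsto (differentiableOn_dslope_disc hf hw)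
    (C := fun s => ENNReal.ofReal (4 * A ^ 2 / (s ^ 2 - ‖w‖ ^ 2))) ?_ ?_
  · filter_upwards [Ioo_mem_nhdsLT hw1] with s hs
    have hs0 : 0 ≤ s := (norm_nonneg w).trans hs.1.le
    calc ∫⁻ ζ, ‖dslope f w (s * ζ)‖ₑ ^ 2 ∂arcLength
        ≤ ∫⁻ ζ, ENNReal.ofReal (4 * A ^ 2) *
            ENNReal.ofReal (1 / ‖s * ζ - w‖ ^ 2) ∂arcLength := by
          refine lintegral_mono_ae ?_
          filter_upwards [ae_norm_eq_one] with ζ hζ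
          rw [← ENNReal.ofReal_mul (by positivity), ← ofReal_norm,
            ← ENNReal.ofReal_pow (norm_nonneg _), dslope_norm_of_ne (ne_of_norm_lt hζ hs.1)]
          refine ENNReal.ofReal_le_ofReal ?_
          rw [div_pow, mul_one_div]
          gcongr
          have h1 := hA _ (mul_mem_ball hs0 hs.2 hζ.le)
          have h2 := hA w hw
          have h3 := norm_sub_le (f (s * ζ)) (f w)
          nlinarith [norm_nonneg (f (s * ζ) - f w)]
      _ = _ := by
          rw [lintegral_const_mul' _ _ ENNReal.ofReal_ne_top, lintegral_inv_sq_norm_sub hs.1,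
            ← ENNReal.ofReal_mul (by positivity), mul_one_div]
  · refine ENNReal.tendsto_ofReal ?_
    refine Tendsto.div tendsto_const_nhds ?_ (one_sub_sq_pos hw).ne'
    have hc : Continuous fun s : ℝ => s ^ 2 - ‖w‖ ^ 2 := by fun_prop
    simpa using (hc.tendsto 1).mono_left (nhdsWithin_le_nhds (s := Iio 1))

/-- Of the two terms of f - f(w), the first is estimated through |sζ - w| ≥ s - |w|, the second by
the exact integral of 1/|sζ - w|² and the point evaluation bound. Each contributes at most 2‖f‖² to
the square after multiplication by (1 - |w|)². -/
theorem hardyNorm_dslope_le {f : ℂ → ℂ} (hf : DifferentiableOn ℂ f 𝔻) {w : ℂ} (hw : w ∈ 𝔻) :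
    ENNReal.ofReal (1 - ‖w‖) * hardyNorm 2 (dslope f w) ≤ 2 * hardyNorm 2 f := by
  by_cases hfin : hardyNorm 2 f = ∞
  · simp [hfin]
  have hw1 : ‖w‖ < 1 := by simpa using hw
  have hpos := one_sub_sq_pos hw
  obtain ⟨n, hn0, hn⟩ : ∃ n : ℝ, 0 ≤ n ∧ hardyNorm 2 f = ENNReal.ofReal n :=
    ⟨_, ENNReal.toReal_nonneg, (ENNReal.ofReal_toReal hfin).symm⟩
  have hfw : ‖f w‖ ^ 2 * (1 - ‖w‖ ^ 2) ≤ n ^ 2 := by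
    have h := enorm_sq_mul_le_hardyNorm_sq hf hw
    rw [hn, ← ofReal_norm, ← ENNReal.ofReal_pow (norm_nonneg _), ← ENNReal.ofReal_pow hn0,
      ← ENNReal.ofReal_mul (by positivity)] at h
    exact (ENNReal.ofReal_le_ofReal_iff (by positivity)).1 h
  have key : hardyNorm 2 (dslope f w) ^ 2 ≤
      ENNReal.ofReal (2 * n ^ 2 / (1 - ‖w‖) ^ 2 + 2 * ‖f w‖ ^ 2 / (1 - ‖w‖ ^ 2)) := by
    refine hardyNorm_sq_le_of_tendsto (differentiableOn_dslope_disc hf hw)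
      (C := fun s => ENNReal.ofReal
        (2 * n ^ 2 / (s - ‖w‖) ^ 2 + 2 * ‖f w‖ ^ 2 / (s ^ 2 - ‖w‖ ^ 2))) ?_ ?_
    · filter_upwards [Ioo_mem_nhdsLT hw1] with s hs
      have hs0 : 0 ≤ s := (norm_nonneg w).trans hs.1.le
      have hsw : 0 < s - ‖w‖ := sub_pos.2 hs.1
      have hpos' : 0 < s ^ 2 - ‖w‖ ^ 2 := by nlinarith [norm_nonneg w]
      calc ∫⁻ ζ, ‖dslope f w (s * ζ)‖ₑ ^ 2 ∂arcLength
          ≤ ∫⁻ ζ, ENNReal.ofReal (2 / (s - ‖w‖) ^ 2) * ‖f (s * ζ)‖ₑ ^ 2 +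
              ENNReal.ofReal (2 * ‖f w‖ ^ 2) *
              ENNReal.ofReal (1 / ‖s * ζ - w‖ ^ 2) ∂arcLength := by
            refine lintegral_mono_ae ?_
            filter_upwards [ae_norm_eq_one] with ζ hζ
            rw [← ENNReal.ofReal_mul (by positivity), ← ofReal_norm, ← ofReal_norm,
              ← ENNReal.ofReal_pow (norm_nonneg _), ← ENNReal.ofReal_pow (norm_nonneg _),
              dslope_norm_of_ne (ne_of_norm_lt hζ hs.1), ← ENNReal.ofReal_mul (by positivity),
              ← ENNReal.ofReal_add (by positivity) (by positivity)]
            refine ENNReal.ofReal_le_ofReal ?_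
            have h1 : s - ‖w‖ ≤ ‖s * ζ - w‖ := sub_norm_le hs0 hζ
            have h3 : ‖f (s * ζ) - f w‖ ^ 2 ≤ 2 * ‖f (s * ζ)‖ ^ 2 + 2 * ‖f w‖ ^ 2 := by
              nlinarith [norm_sub_le (f (s * ζ)) (f w), norm_nonneg (f (s * ζ) - f w),
                sq_nonneg (‖f (s * ζ)‖ - ‖f w‖)]
            rw [div_pow]
            calc ‖f (s * ζ) - f w‖ ^ 2 / ‖s * ζ - w‖ ^ 2
                ≤ (2 * ‖f (s * ζ)‖ ^ 2 + 2 * ‖f w‖ ^ 2) / ‖s * ζ - w‖ ^ 2 := by gcongr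
              _ = 2 * ‖f (s * ζ)‖ ^ 2 / ‖s * ζ - w‖ ^ 2 + 2 * ‖f w‖ ^ 2 / ‖s * ζ - w‖ ^ 2 :=
                  add_div _ _ _
              _ ≤ 2 * ‖f (s * ζ)‖ ^ 2 / (s - ‖w‖) ^ 2 + 2 * ‖f w‖ ^ 2 / ‖s * ζ - w‖ ^ 2 := by
                  gcongr
              _ = _ := by ring
        _ = ENNReal.ofReal (2 / (s - ‖w‖) ^ 2) * ∫⁻ ζ, ‖f (s * ζ)‖ₑ ^ 2 ∂arcLength +
              ENNReal.ofReal (2 * ‖f w‖ ^ 2 / (s ^ 2 - ‖w‖ ^ 2)) := by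
            rw [lintegral_add_right, lintegral_const_mul' _ _ ENNReal.ofReal_ne_top,
              lintegral_const_mul' _ _ ENNReal.ofReal_ne_top, lintegral_inv_sq_norm_sub hs.1,
              ← ENNReal.ofReal_mul (by positivity), mul_one_div]
            fun_prop
        _ ≤ ENNReal.ofReal (2 / (s - ‖w‖) ^ 2) * hardyNorm 2 f ^ 2 +
              ENNReal.ofReal (2 * ‖f w‖ ^ 2 / (s ^ 2 - ‖w‖ ^ 2)) := by
            gcongr
            exact lintegral_le_hardyNorm_sq f ⟨hs0, hs.2⟩
        _ = _ := by
            rw [hn, ← ENNReal.ofReal_pow hn0, ← ENNReal.ofReal_mul (by positivity),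
              ← ENNReal.ofReal_add (by positivity) (by positivity)]
            ring_nf
    · refine ENNReal.tendsto_ofReal ?_
      have hc : Continuous fun s : ℝ => s ^ 2 - ‖w‖ ^ 2 := by fun_prop
      have hc' : Continuous fun s : ℝ => (s - ‖w‖) ^ 2 := by fun_prop
      refine Tendsto.add (Tendsto.div tendsto_const_nhds ?_ ?_)
        (Tendsto.div tendsto_const_nhds ?_ hpos.ne')
      · simpa using (hc'.tendsto 1).mono_left (nhdsWithin_le_nhds (s := Iio 1))
      · exact pow_ne_zero 2 (sub_pos.2 hw1).ne'
      · simpa using (hc.tendsto 1).mono_left (nhdsWithin_le_nhds (s := Iio 1))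
  have h2 : (ENNReal.ofReal (1 - ‖w‖) * hardyNorm 2 (dslope f w)) ^ 2 ≤ (2 * hardyNorm 2 f) ^ 2 := by
    rw [mul_pow, mul_pow, hn]
    have hw2 : 0 < 1 - ‖w‖ := sub_pos.2 hw1
    calc _ ≤ ENNReal.ofReal (1 - ‖w‖) ^ 2 * ENNReal.ofReal
          (2 * n ^ 2 / (1 - ‖w‖) ^ 2 + 2 * ‖f w‖ ^ 2 / (1 - ‖w‖ ^ 2)) := by gcongr
      _ = ENNReal.ofReal (2 * n ^ 2 + 2 * ‖f w‖ ^ 2 * (1 - ‖w‖) ^ 2 / (1 - ‖w‖ ^ 2)) := by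
          rw [← ENNReal.ofReal_pow hw2.le, ← ENNReal.ofReal_mul (by positivity)]
          congr 1
          field_simp
      _ ≤ ENNReal.ofReal (4 * n ^ 2) := by
          refine ENNReal.ofReal_le_ofReal ?_
          have : 2 * ‖f w‖ ^ 2 * (1 - ‖w‖) ^ 2 / (1 - ‖w‖ ^ 2) ≤ 2 * n ^ 2 := by
            rw [div_le_iff₀ hpos]
            have h4 : 1 - ‖w‖ ≤ 1 - ‖w‖ ^ 2 := by nlinarith [norm_nonneg w]
            calc 2 * ‖f w‖ ^ 2 * (1 - ‖w‖) ^ 2 ≤ 2 * ‖f w‖ ^ 2 * (1 - ‖w‖ ^ 2) ^ 2 := by gcongr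
              _ = 2 * (‖f w‖ ^ 2 * (1 - ‖w‖ ^ 2)) * (1 - ‖w‖ ^ 2) := by ring
              _ ≤ 2 * n ^ 2 * (1 - ‖w‖ ^ 2) := by gcongr
          linarith
      _ = _ := by
          rw [ENNReal.ofReal_mul (by norm_num), ENNReal.ofReal_pow hn0]
          norm_num
  exact (ENNReal.pow_le_pow_left_iff two_ne_zero).1 h2

/-- With u = rw, the quotient of the dilated function at w is r times the dilated quotient of f at
u. If q is the quotient of f at w, the one at u is q + (u - w) times the quotient of q at u. Since
|u - w| = (1 - r)|w| ≤ 1 - |u|, `hardyNorm_dslope_le` bounds the last term by 2‖q‖, whence 3 = 1 +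
2. -/
theorem hardyNorm_dslope_dilate_le {f : ℂ → ℂ} (hf : DifferentiableOn ℂ f 𝔻) {w : ℂ} (hw : w ∈ 𝔻)
    {r : ℝ} (h0 : 0 ≤ r) (h1 : r < 1) :
    hardyNorm 2 (dslope (fun z => f (r * z)) w) ≤ 3 * hardyNorm 2 (dslope f w) := by
  have hw1 : ‖w‖ < 1 := by simpa using hw
  set u : ℂ := r * w with hu
  have hu1 : u ∈ 𝔻 := mul_mem_ball h0 h1 hw1.le
  set q := dslope f w with hq
  have hqd : DifferentiableOn ℂ q 𝔻 := differentiableOn_dslope_disc hf hw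
  have hqu : DifferentiableOn ℂ (dslope q u) 𝔻 := differentiableOn_dslope_disc hqd hu1
  have hfu : EqOn (dslope f u) (q + fun z => (u - w) * dslope q u z) 𝔻 := by
    refine dslope_eqOn (c := f u) hu1 (hqd.add (hqu.const_mul _)) fun z hz => ?_
    have e1 := eq_add_sub_mul_dslope f w z
    have e2 := eq_add_sub_mul_dslope f w u
    have e3 := eq_add_sub_mul_dslope q u z
    simp only [Pi.add_apply]
    linear_combination e1 - e2 + (u - w) * e3
  have hfr : EqOn (dslope (fun z => f (r * z)) w)
      ((fun _ => (r : ℂ)) * fun z => dslope f u (r * z)) 𝔻 := by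
    refine dslope_eqOn (c := f u) hw ?_ fun z hz => ?_
    · exact (differentiableOn_const _).mul
        (differentiableOn_dilate (differentiableOn_dslope_disc hf hu1) h0 h1.le)
    · have e1 := eq_add_sub_mul_dslope f u (r * z)
      simp only [Pi.mul_apply]
      rw [e1, hu]
      ring
  calc hardyNorm 2 (dslope (fun z => f (r * z)) w)
      = hardyNorm 2 ((fun _ => (r : ℂ)) * fun z => dslope f u (r * z)) := hardyNorm_congr hfr
    _ ≤ ENNReal.ofReal 1 * hardyNorm 2 (fun z => dslope f u (r * z)) :=
        hardyNorm_mul_le fun z _ => by simpa [abs_of_nonneg h0] using h1.le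
    _ ≤ hardyNorm 2 (dslope f u) := by
        rw [ENNReal.ofReal_one, one_mul]
        exact hardyNorm_dilate_le _ h0 h1.le
    _ = hardyNorm 2 (q + (fun _ => u - w) * dslope q u) := hardyNorm_congr hfu
    _ ≤ hardyNorm 2 q + hardyNorm 2 ((fun _ => u - w) * dslope q u) :=
        hardyNorm_add_le hqd ((differentiableOn_const _).mul hqu)
    _ ≤ hardyNorm 2 q + ENNReal.ofReal (1 - ‖u‖) * hardyNorm 2 (dslope q u) := by
        gcongr
        refine hardyNorm_mul_le fun z _ => ?_
        have e1 : u - w = ((r - 1 : ℝ) : ℂ) * w := by rw [hu]; push_cast; ring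
        rw [e1, hu, norm_mul, norm_mul, Complex.norm_real, Complex.norm_real, Real.norm_eq_abs,
          Real.norm_eq_abs, abs_of_nonneg h0, abs_of_neg (by linarith)]
        nlinarith [norm_nonneg w]
    _ ≤ hardyNorm 2 q + 2 * hardyNorm 2 q := by
        exact add_le_add_right (hardyNorm_dslope_le hqd hu1) _
    _ = 3 * hardyNorm 2 q := by ring

/-! ### The Möbius involutions and the associated isometries of the Hardy space -/

/-- The involutive automorphism `z ↦ (w - z) / (1 - \bar w z)` of the disc. -/
noncomputable def mobius (w z : ℂ) : ℂ := (w - z) / (1 - conj w * z)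

theorem one_sub_conj_mul_ne_zero {w z : ℂ} (hw : w ∈ 𝔻) (hz : ‖z‖ ≤ 1) : 1 - conj w * z ≠ 0 := by
  intro h
  have h1 : ‖conj w * z‖ = 1 := by rw [← sub_eq_zero.1 h, norm_one]
  rw [norm_mul, RCLike.norm_conj] at h1
  have hw1 : ‖w‖ < 1 := by simpa using hw
  nlinarith [norm_nonneg w, norm_nonneg z]

theorem conj_mul_self_eq (w : ℂ) : conj w * w = (‖w‖ : ℂ) ^ 2 := by
  rw [mul_comm, Complex.mul_conj, Complex.normSq_eq_norm_sq]
  push_cast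
  rfl

theorem mobius_sub {w z : ℂ} (hw : w ∈ 𝔻) (hz : ‖z‖ ≤ 1) :
    mobius w z - w = -(z * ((1 - ‖w‖ ^ 2) / (1 - conj w * z))) := by
  have := one_sub_conj_mul_ne_zero hw hz
  have h' : 1 - z * conj w ≠ 0 := by rwa [mul_comm]
  rw [mobius]
  field_simp
  rw [← conj_mul_self_eq]
  ring

theorem one_sub_conj_mul_mobius {w z : ℂ} (hw : w ∈ 𝔻) (hz : ‖z‖ ≤ 1) :
    1 - conj w * mobius w z = (1 - ‖w‖ ^ 2) / (1 - conj w * z) := by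
  have := one_sub_conj_mul_ne_zero hw hz
  have h' : 1 - z * conj w ≠ 0 := by rwa [mul_comm]
  rw [mobius]
  field_simp
  rw [← conj_mul_self_eq]
  ring

theorem one_sub_sq_norm_mobius {w z : ℂ} (hw : w ∈ 𝔻) (hz : ‖z‖ ≤ 1) :
    1 - ‖mobius w z‖ ^ 2 = (1 - ‖w‖ ^ 2) * (1 - ‖z‖ ^ 2) / ‖1 - conj w * z‖ ^ 2 := by
  have h := one_sub_conj_mul_ne_zero hw hz
  have h' := norm_ne_zero_iff.2 h
  rw [mobius, norm_div, div_pow, eq_div_iff (pow_ne_zero 2 h'), sub_mul,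
    div_mul_cancel₀ _ (pow_ne_zero 2 h'), one_mul]
  have h3 : ∀ x : ℂ, ‖x‖ ^ 2 = x.re ^ 2 + x.im ^ 2 := fun x => by
    rw [← Complex.normSq_eq_norm_sq, Complex.normSq_apply]; ring
  simp only [h3]
  simp
  ring

theorem norm_mobius_le_one {w z : ℂ} (hw : w ∈ 𝔻) (hz : ‖z‖ ≤ 1) : ‖mobius w z‖ ≤ 1 := by
  have h := one_sub_sq_norm_mobius hw hz
  have h2 : 0 ≤ 1 - ‖mobius w z‖ ^ 2 := by
    rw [h]
    have := (one_sub_sq_pos hw).le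
    have : 0 ≤ 1 - ‖z‖ ^ 2 := by nlinarith [norm_nonneg z]
    positivity
  nlinarith [norm_nonneg (mobius w z)]

theorem mobius_mem {w z : ℂ} (hw : w ∈ 𝔻) (hz : z ∈ 𝔻) : mobius w z ∈ 𝔻 := by
  have hz1 : ‖z‖ < 1 := by simpa using hz
  have h := one_sub_sq_norm_mobius hw hz1.le
  have h2 : 0 < 1 - ‖mobius w z‖ ^ 2 := by
    rw [h]
    have := one_sub_sq_pos hw
    have := one_sub_sq_pos hz
    have := norm_pos_iff.2 (one_sub_conj_mul_ne_zero hw hz1.le)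
    positivity
  rw [mem_ball_zero_iff]
  nlinarith [norm_nonneg (mobius w z)]

theorem norm_mobius_eq_one {w z : ℂ} (hw : w ∈ 𝔻) (hz : ‖z‖ = 1) : ‖mobius w z‖ = 1 := by
  have h := one_sub_sq_norm_mobius hw hz.le
  rw [hz] at h
  norm_num at h
  have : ‖mobius w z‖ ^ 2 = 1 := by linarith
  exact (pow_eq_one_iff_of_nonneg (norm_nonneg _) two_ne_zero).1 this

theorem mobius_mobius {w z : ℂ} (hw : w ∈ 𝔻) (hz : ‖z‖ ≤ 1) : mobius w (mobius w z) = z := by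
  have h := one_sub_conj_mul_ne_zero hw hz
  have h1 := one_sub_conj_mul_mobius hw hz
  have h2 := mobius_sub hw hz
  have h3 : (1 - (‖w‖ : ℂ) ^ 2) ≠ 0 := by exact_mod_cast (one_sub_sq_pos hw).ne'
  have h' : 1 - z * conj w ≠ 0 := by rwa [mul_comm]
  rw [mobius, h1, ← neg_sub, h2]
  field_simp

theorem hasDerivAt_mobius {w z : ℂ} (hw : w ∈ 𝔻) (hz : ‖z‖ ≤ 1) :
    HasDerivAt (mobius w) (-((1 - ‖w‖ ^ 2) / (1 - conj w * z) ^ 2)) z := by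
  have h := one_sub_conj_mul_ne_zero hw hz
  have h1 : HasDerivAt (fun z => w - z) (-1) z := by simpa using (hasDerivAt_id z).const_sub w
  have h2 : HasDerivAt (fun z => 1 - conj w * z) (-conj w) z := by
    simpa using ((hasDerivAt_id z).const_mul (conj w)).const_sub 1
  refine (h1.div h2 h).congr_deriv ?_
  rw [← conj_mul_self_eq]
  field_simp
  ring

theorem measurable_mobius (w : ℂ) : Measurable (mobius w) := by
  unfold mobius
  fun_prop

/-- Under the Poisson measure at w, the k-th moment of φ_w is φ_w(w)^k = 0^k by the Poisson formula,
so Parseval applies with e = φ_w. -/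
theorem lintegral_poisson_enorm_sq_tsum {w : ℂ} (hw : w ∈ 𝔻) {c : ℕ → ℂ}
    (hc : Summable fun n => ‖c n‖) :
    ∫⁻ ζ, ENNReal.ofReal ((1 - ‖w‖ ^ 2) / ‖ζ - w‖ ^ 2) *
      ‖∑' n, c n * mobius w ζ ^ n‖ₑ ^ 2 ∂arcLength = ∑' n, ‖c n‖ₑ ^ 2 := by
  have hPm : Measurable fun ζ : ℂ => (1 - ‖w‖ ^ 2) / ‖ζ - w‖ ^ 2 := by fun_prop
  set ν := arcLength.withDensity fun ζ => ENNReal.ofReal ((1 - ‖w‖ ^ 2) / ‖ζ - w‖ ^ 2) with hν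
  have : IsProbabilityMeasure ν := by
    constructor
    rw [hν, withDensity_apply _ MeasurableSet.univ, setLIntegral_univ, lintegral_poisson hw]
  have he : ∀ᵐ ζ ∂ν, ‖mobius w ζ‖ = 1 := by
    refine (withDensity_absolutelyContinuous _ _).ae_le ?_
    filter_upwards [ae_norm_eq_one] with ζ hζ using norm_mobius_eq_one hw hζ
  have hk : ∀ k : ℕ, ∫ ζ, mobius w ζ ^ k ∂ν = if k = 0 then 1 else 0 := by
    intro k
    rw [hν, integral_withDensity_eq_integral_toReal_smul hPm.ennreal_ofReal
      (ae_of_all _ fun _ => ENNReal.ofReal_lt_top)]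
    have h1 : DiffContOnCl ℂ (fun ζ => mobius w ζ ^ k) 𝔻 := by
      refine DifferentiableOn.diffContOnCl ?_
      rw [closure_ball _ one_ne_zero]
      refine DifferentiableOn.pow (fun z hz => ?_) k
      exact (hasDerivAt_mobius hw (by simpa using hz)).differentiableAt.differentiableWithinAt
    have h2 := integral_poisson_mul h1 hw
    rw [mobius, sub_self, zero_div, zero_pow_eq] at h2
    rw [← h2]
    refine integral_congr_ae (ae_of_all _ fun ζ => ?_)
    simp only
    rw [ENNReal.toReal_ofReal]
    exact div_nonneg (one_sub_sq_pos hw).le (sq_nonneg _)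
  rw [← lintegral_enorm_sq_tsum (measurable_mobius w) he hk hc, hν,
    lintegral_withDensity_eq_lintegral_mul_non_measurable _ hPm.ennreal_ofReal
      (ae_of_all _ fun _ => ENNReal.ofReal_lt_top)]
  rfl

/-- By dominated convergence the means over radii s → 1 tend to the boundary integral, and by
monotonicity their limit bounds the supremum. -/
theorem hardyNorm_sq_le_lintegral {F : ℂ → ℂ} (hF : DiffContOnCl ℂ F 𝔻) :
    hardyNorm 2 F ^ 2 ≤ ∫⁻ ζ, ‖F ζ‖ₑ ^ 2 ∂arcLength := by
  have hcont : ContinuousOn F (Metric.closedBall 0 1) := by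
    have := hF.continuousOn
    rwa [closure_ball _ one_ne_zero] at this
  obtain ⟨A, hA⟩ := (isCompact_closedBall (0 : ℂ) 1).exists_bound_of_continuousOn hcont
  have hmem : ∀ s ∈ Ioo (0 : ℝ) 1, ∀ ζ : ℂ, ‖ζ‖ = 1 → (s : ℂ) * ζ ∈ Metric.closedBall (0 : ℂ) 1 :=
    fun s hs ζ hζ => Metric.ball_subset_closedBall (mul_mem_ball hs.1.le hs.2 hζ.le)
  refine hardyNorm_sq_le_of_tendsto hF.differentiableOn (Eventually.of_forall fun s => le_rfl) ?_
  refine tendsto_lintegral_filter_of_dominated_convergence' (fun _ => ENNReal.ofReal (A ^ 2))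
    ?_ ?_ ?_ ?_
  · filter_upwards [Ioo_mem_nhdsLT zero_lt_one] with s hs
    exact (aestronglyMeasurable_dilation hF.differentiableOn ⟨hs.1.le, hs.2⟩).enorm.pow_const 2
  · filter_upwards [Ioo_mem_nhdsLT zero_lt_one] with s hs
    filter_upwards [ae_norm_eq_one] with ζ hζ
    rw [← ofReal_norm, ← ENNReal.ofReal_pow (norm_nonneg _)]
    gcongr
    exact hA _ (hmem s hs ζ hζ)
  · simp
  · filter_upwards [ae_norm_eq_one] with ζ hζ
    have h1 : Tendsto (fun s : ℝ => (s : ℂ) * ζ) (𝓝[<] 1)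
        (𝓝[Metric.closedBall (0 : ℂ) 1] ζ) := by
      refine tendsto_nhdsWithin_iff.2 ⟨?_, ?_⟩
      · have hc : Continuous fun s : ℝ => (s : ℂ) * ζ := by fun_prop
        simpa using (hc.tendsto 1).mono_left (nhdsWithin_le_nhds (s := Iio 1))
      · filter_upwards [Ioo_mem_nhdsLT zero_lt_one] with s hs using hmem s hs ζ hζ
    have h2 := (hcont ζ (by simp [hζ])).tendsto.comp h1
    exact ((ENNReal.continuous_pow 2).tendsto _).comp h2.enorm

/-- The weighted composition operator `q ↦ √(1 - |w|²) / (1 - \bar w z) · q ∘ φ_w`. -/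
noncomputable def mobiusLift (w : ℂ) (q : ℂ → ℂ) (z : ℂ) : ℂ :=
  (√(1 - ‖w‖ ^ 2) : ℝ) / (1 - conj w * z) * q (mobius w z)

theorem mobiusLift_mobiusLift {w : ℂ} (hw : w ∈ 𝔻) (q : ℂ → ℂ) :
    EqOn (mobiusLift w (mobiusLift w q)) q 𝔻 := by
  intro z hz
  have hz1 : ‖z‖ ≤ 1 := by simpa using (mem_ball_zero_iff.1 hz).le
  have h := one_sub_conj_mul_ne_zero hw hz1
  have h3 : (1 - (‖w‖ : ℂ) ^ 2) ≠ 0 := by exact_mod_cast (one_sub_sq_pos hw).ne'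
  have h4 : ((√(1 - ‖w‖ ^ 2) : ℝ) : ℂ) ^ 2 = 1 - (‖w‖ : ℂ) ^ 2 := by
    rw [← Complex.ofReal_pow, Real.sq_sqrt (one_sub_sq_pos hw).le]
    push_cast
    rfl
  rw [mobiusLift, mobiusLift, mobius_mobius hw hz1, one_sub_conj_mul_mobius hw hz1]
  field_simp
  rw [h4]

theorem differentiableOn_mobiusLift {w : ℂ} (hw : w ∈ 𝔻) {q : ℂ → ℂ} {s : Set ℂ}
    (hs : s ⊆ Metric.closedBall 0 1) (hq : DifferentiableOn ℂ (q ∘ mobius w) s) :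
    DifferentiableOn ℂ (mobiusLift w q) s := by
  refine DifferentiableOn.mul (DifferentiableOn.div (differentiableOn_const _) (by fun_prop)
    fun z hz => one_sub_conj_mul_ne_zero hw (by simpa using hs hz)) hq

theorem differentiableOn_mobius {w : ℂ} (hw : w ∈ 𝔻) :
    DifferentiableOn ℂ (mobius w) (Metric.closedBall 0 1) := fun z hz =>
  (hasDerivAt_mobius hw (by simpa using hz)).differentiableAt.differentiableWithinAt

theorem norm_one_sub_conj_mul {w ζ : ℂ} (hζ : ‖ζ‖ = 1) : ‖1 - conj w * ζ‖ = ‖ζ - w‖ := by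
  have h1 : 1 - conj w * ζ = ζ * conj (ζ - w) := by
    have : ζ * conj ζ = 1 := by rw [Complex.mul_conj, Complex.normSq_eq_norm_sq, hζ]; simp
    rw [map_sub, mul_sub, this]
    ring
  rw [h1, norm_mul, hζ, one_mul, RCLike.norm_conj]

/-- On the circle the squared modulus of the weight is the Poisson kernel at w, so the weighted
Parseval identity computes the boundary norm. Dilating q first makes the lift continuous up to the
circle; Fatou's lemma removes the dilation. -/
theorem hardyNorm_mobiusLift_le {w : ℂ} (hw : w ∈ 𝔻) {q : ℂ → ℂ} (hq : DifferentiableOn ℂ q 𝔻) :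
    hardyNorm 2 (mobiusLift w q) ≤ hardyNorm 2 q := by
  refine (ENNReal.pow_le_pow_left_iff two_ne_zero).1 ?_
  obtain ⟨a, ha⟩ := exists_hasSum hq
  have hmaps : MapsTo (mobius w) 𝔻 𝔻 := fun z hz => mobius_mem hw hz
  have hdil : ∀ r ∈ Ioo (0 : ℝ) 1, DiffContOnCl ℂ (mobiusLift w fun z => q (r * z)) 𝔻 ∧
      hardyNorm 2 (mobiusLift w fun z => q (r * z)) ^ 2 ≤ hardyNorm 2 q ^ 2 := by
    intro r hr
    have hd : DiffContOnCl ℂ (mobiusLift w fun z => q (r * z)) 𝔻 := by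
      refine DifferentiableOn.diffContOnCl ?_
      rw [closure_ball _ one_ne_zero]
      refine differentiableOn_mobiusLift hw subset_rfl ?_
      refine hq.comp ((differentiableOn_mobius hw).const_mul _) fun z hz => ?_
      exact mul_mem_ball hr.1.le hr.2 (norm_mobius_le_one hw (by simpa using hz))
    refine ⟨hd, (hardyNorm_sq_le_lintegral hd).trans ?_⟩
    have hc : Summable fun n => ‖a n * (r : ℂ) ^ n‖ :=
      (ha r (by simpa [abs_of_pos hr.1] using hr.2)).summable.norm
    calc ∫⁻ ζ, ‖mobiusLift w (fun z => q (r * z)) ζ‖ₑ ^ 2 ∂arcLength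
        = ∫⁻ ζ, ENNReal.ofReal ((1 - ‖w‖ ^ 2) / ‖ζ - w‖ ^ 2) *
            ‖∑' n, (a n * (r : ℂ) ^ n) * mobius w ζ ^ n‖ₑ ^ 2 ∂arcLength := by
          refine lintegral_congr_ae ?_
          filter_upwards [ae_norm_eq_one] with ζ hζ
          have h1 : ∑' n, (a n * (r : ℂ) ^ n) * mobius w ζ ^ n = q (r * mobius w ζ) := by
            rw [← (ha (r * mobius w ζ)
              (mul_mem_ball hr.1.le hr.2 (norm_mobius_le_one hw hζ.le))).tsum_eq]
            simp [mul_pow, mul_assoc]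
          rw [h1, mobiusLift, enorm_mul, mul_pow, ← ofReal_norm (_ / _), norm_div,
            norm_one_sub_conj_mul hζ, ← ENNReal.ofReal_pow (by positivity), div_pow,
            Complex.norm_real, Real.norm_eq_abs, sq_abs, Real.sq_sqrt (one_sub_sq_pos hw).le]
      _ = ∑' n, ‖a n * (r : ℂ) ^ n‖ₑ ^ 2 := lintegral_poisson_enorm_sq_tsum hw hc
      _ = ∫⁻ ζ, ‖q (r * ζ)‖ₑ ^ 2 ∂arcLength :=
          (lintegral_dilation_eq hr.1.le fun z hz => ha z (by simp [hz, hr.2])).symm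
      _ ≤ _ := lintegral_le_hardyNorm_sq q ⟨hr.1.le, hr.2⟩
  rw [hardyNorm_sq_le_iff]
  intro s hs
  calc ∫⁻ ζ, ‖mobiusLift w q (s * ζ)‖ₑ ^ 2 ∂arcLength
      = ∫⁻ ζ, liminf (fun k => ‖mobiusLift w (fun z => q (radius k * z)) (s * ζ)‖ₑ ^ 2)
          atTop ∂arcLength := by
        refine lintegral_congr_ae ?_
        filter_upwards [ae_norm_eq_one] with ζ hζ
        refine (Tendsto.liminf_eq ?_).symm
        refine ((ENNReal.continuous_pow 2).tendsto _).comp (Tendsto.enorm ?_)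
        refine Tendsto.const_mul _ ?_
        have h1 := mobius_mem hw (mul_mem_ball hs.1 hs.2 hζ.le)
        have h2 : Tendsto (fun r : ℝ => (r : ℂ) * mobius w (s * ζ)) (𝓝[<] 1)
            (𝓝 (mobius w (s * ζ))) := by
          have hc : Continuous fun r : ℝ => (r : ℂ) * mobius w (s * ζ) := by fun_prop
          simpa using (hc.tendsto 1).mono_left (nhdsWithin_le_nhds (s := Iio 1))
        exact ((hq.differentiableAt (Metric.isOpen_ball.mem_nhds h1)).continuousAt.tendsto).comp
          (h2.comp tendsto_radius)
    _ ≤ liminf (fun k => ∫⁻ ζ, ‖mobiusLift w (fun z => q (radius k * z)) (s * ζ)‖ₑ ^ 2 ∂arcLength)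
          atTop :=
        lintegral_liminf_le' fun k => (aestronglyMeasurable_dilation
          (hdil _ (radius_mem k)).1.differentiableOn hs).enorm.pow_const 2
    _ ≤ hardyNorm 2 q ^ 2 := by
        refine liminf_le_of_frequently_le' (Eventually.frequently (Eventually.of_forall fun k => ?_))
        exact (lintegral_le_hardyNorm_sq _ hs).trans (hdil _ (radius_mem k)).2

/-- The lift is an involution on the disc, so contractivity applied twice gives equality. -/
theorem hardyNorm_mobiusLift {w : ℂ} (hw : w ∈ 𝔻) {q : ℂ → ℂ} (hq : DifferentiableOn ℂ q 𝔻) :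
    hardyNorm 2 (mobiusLift w q) = hardyNorm 2 q := by
  refine le_antisymm (hardyNorm_mobiusLift_le hw hq) ?_
  rw [← hardyNorm_congr (mobiusLift_mobiusLift hw q)]
  refine hardyNorm_mobiusLift_le hw (differentiableOn_mobiusLift hw Metric.ball_subset_closedBall ?_)
  exact hq.comp ((differentiableOn_mobius hw).mono Metric.ball_subset_closedBall)
    fun z hz => mobius_mem hw hz

/-! ### The local Dirichlet integral -/

theorem measurable_greenKernel : Measurable fun p : ℂ × ℂ => greenKernel p.1 p.2 := by
  unfold greenKernel
  refine Measurable.ite (measurableSet_eq_fun measurable_fst measurable_snd) measurable_const ?_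
  have h : Measurable fun p : ℂ × ℂ => (1 - conj p.2 * p.1) / (p.1 - p.2) := by
    refine Measurable.div ?_ (measurable_fst.sub measurable_snd)
    exact (by fun_prop : Continuous fun p : ℂ × ℂ => 1 - conj p.2 * p.1).measurable
  exact (Real.measurable_log.comp h.norm).ennreal_ofReal

/-! ### Polar coordinates on the disc -/

theorem lintegral_arcLength {g : ℂ → ℝ≥0∞} (hg : Measurable g) :
    ∫⁻ ζ, g ζ ∂arcLength = (ENNReal.ofReal (2 * Real.pi))⁻¹ *
      ∫⁻ θ in Ioo (-Real.pi) Real.pi, g (circleMap 0 1 θ) := by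
  rw [arcLength, lintegral_map hg (continuous_circleMap 0 1).measurable, lintegral_smul_measure,
    smul_eq_mul]
  congr 1
  -- `arcLength` is parametrized over (0, 2π], polar coordinates over (-π, π). Both intervals are,
  -- up to a null set, fundamental domains for translation by 2π.
  have h1 := isAddFundamentalDomain_Ioc Real.two_pi_pos 0
  have h2 := isAddFundamentalDomain_Ioc Real.two_pi_pos (-Real.pi)
  have h3 := h1.setLIntegral_eq h2 (fun θ => g (circleMap 0 1 θ)) (by
    rintro ⟨x, hx⟩ θ
    obtain ⟨n, rfl⟩ := AddSubgroup.mem_zmultiples_iff.1 hx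
    have := (periodic_circleMap 0 1).zsmul n θ
    rw [AddSubgroup.mk_vadd, vadd_eq_add, add_comm, this])
  rw [zero_add, show -Real.pi + 2 * Real.pi = Real.pi by ring] at h3
  rw [h3]
  exact setLIntegral_congr Ioo_ae_eq_Ioc.symm

theorem lintegral_discArea {g : ℂ → ℝ≥0∞} (hg : Measurable g) :
    ∫⁻ z, g z ∂discArea = ∫⁻ r in Ioo (0 : ℝ) 1, ENNReal.ofReal (2 * r) *
      ∫⁻ ζ, g (r * ζ) ∂arcLength := by
  have hpi : ENNReal.ofReal Real.pi ≠ 0 := by simp [Real.pi_pos]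
  have hpi' : ENNReal.ofReal Real.pi ≠ ∞ := ENNReal.ofReal_ne_top
  have hm : Measurable fun p : ℝ × ℝ =>
      ENNReal.ofReal p.1 • (𝔻).indicator g (Complex.polarCoord.symm p) := by
    simp only [Complex.polarCoord_symm_apply]
    refine Measurable.smul measurable_fst.ennreal_ofReal ?_
    refine (hg.indicator Metric.isOpen_ball.measurableSet).comp ?_
    exact (by fun_prop : Continuous fun p : ℝ × ℝ =>
      (p.1 : ℂ) * ((Real.cos p.2 : ℂ) + (Real.sin p.2 : ℂ) * Complex.I)).measurable
  rw [discArea, lintegral_smul_measure, smul_eq_mul, ← lintegral_indicator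
    Metric.isOpen_ball.measurableSet, ← Complex.lintegral_comp_polarCoord_symm,
    polarCoord_target, Measure.volume_eq_prod, setLIntegral_prod _ hm.aemeasurable,
    ← lintegral_const_mul' _ _ (ENNReal.inv_ne_top.2 hpi)]
  have hsplit : (Ioo (0 : ℝ) 1) = Ioi 0 ∩ Iio 1 := rfl
  rw [hsplit, inter_comm, ← Measure.restrict_restrict measurableSet_Iio,
    ← lintegral_indicator measurableSet_Iio]
  refine setLIntegral_congr_fun measurableSet_Ioi fun r (hr : 0 < r) => ?_
  have hpt : ∀ θ : ℝ, Complex.polarCoord.symm (r, θ) = r * circleMap 0 1 θ := by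
    intro θ
    rw [Complex.polarCoord_symm_apply, circleMap, Complex.exp_mul_I]
    simp
  simp only [hpt, smul_eq_mul]
  by_cases h1 : r < 1
  · rw [indicator_of_mem (by exact h1)]
    have h2 : ∀ θ : ℝ, (𝔻).indicator g (r * circleMap 0 1 θ) = g (r * circleMap 0 1 θ) := by
      intro θ
      rw [indicator_of_mem]
      exact mul_mem_ball hr.le h1 (by simp)
    simp only [h2]
    rw [lintegral_arcLength (g := fun ζ => g (r * ζ)) (by fun_prop), lintegral_const_mul' _ _
      ENNReal.ofReal_ne_top, ← mul_assoc, ← mul_assoc]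
    congr 1
    rw [ENNReal.ofReal_mul two_pos.le, ENNReal.ofReal_mul two_pos.le,
      ENNReal.mul_inv (by simp) (by simp)]
    have : (ENNReal.ofReal 2) * (ENNReal.ofReal 2)⁻¹ = 1 :=
      ENNReal.mul_inv_cancel (by simp) ENNReal.ofReal_ne_top
    calc _ = (ENNReal.ofReal 2 * (ENNReal.ofReal 2)⁻¹) *
          ((ENNReal.ofReal Real.pi)⁻¹ * ENNReal.ofReal r) := by rw [this, one_mul]
      _ = _ := by ring
  · rw [indicator_of_notMem (by exact h1)]
    have h2 : ∀ θ : ℝ, (𝔻).indicator g (r * circleMap 0 1 θ) = 0 := by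
      intro θ
      rw [indicator_of_notMem]
      simp only [mem_ball_zero_iff, norm_mul, Complex.norm_real, Real.norm_eq_abs, norm_circleMap_zero,
        abs_one, mul_one, abs_of_pos hr]
      exact h1
    simp [h2]

theorem lintegral_pow_mul_neg_log (n : ℕ) :
    ∫⁻ r in Ioo (0 : ℝ) 1, ENNReal.ofReal (r ^ (2 * n + 1) * (-Real.log r)) =
      ENNReal.ofReal (1 / (2 * n + 2) ^ 2) := by
  set G : ℝ → ℝ := fun r =>
    r ^ (2 * n + 2) / (2 * n + 2) ^ 2 - r ^ (2 * n + 1) * (r * Real.log r) / (2 * n + 2) with hG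
  have hpos : (0 : ℝ) < 2 * n + 2 := by positivity
  have hGc : Continuous G := by
    have := Real.continuous_mul_log
    fun_prop
  have hc : Continuous fun r : ℝ => r ^ (2 * n + 1) * (-Real.log r) := by
    have h1 := Real.continuous_mul_log
    have h2 : (fun r : ℝ => r ^ (2 * n + 1) * (-Real.log r)) =
        fun r => -(r ^ (2 * n) * (r * Real.log r)) := by
      ext r
      ring
    rw [h2]
    fun_prop
  have hderiv : ∀ r ∈ Ioo (0 : ℝ) 1, HasDerivAt G (r ^ (2 * n + 1) * (-Real.log r)) r := by
    intro r hr
    have e1 : HasDerivAt (fun r : ℝ => r ^ (2 * n + 2) / (2 * n + 2) ^ 2)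
        (((2 * n + 2 : ℕ) : ℝ) * r ^ (2 * n + 1) / (2 * n + 2) ^ 2) r :=
      (hasDerivAt_pow (2 * n + 2) r).div_const _
    have e2 : HasDerivAt (fun r : ℝ => r ^ (2 * n + 1) * (r * Real.log r) / (2 * n + 2))
        ((((2 * n + 1 : ℕ) : ℝ) * r ^ (2 * n) * (r * Real.log r) +
          r ^ (2 * n + 1) * (Real.log r + 1)) / (2 * n + 2)) r :=
      ((hasDerivAt_pow (2 * n + 1) r).mul (Real.hasDerivAt_mul_log hr.1.ne')).div_const _
    refine (e1.sub e2).congr_deriv ?_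
    push_cast
    field_simp
    ring
  have h1 := intervalIntegral.integral_eq_sub_of_hasDerivAt_of_le zero_le_one hGc.continuousOn
    hderiv (hc.intervalIntegrable 0 1)
  rw [intervalIntegral.integral_of_le zero_le_one, integral_Ioc_eq_integral_Ioo] at h1
  rw [← ofReal_integral_eq_lintegral_ofReal, h1]
  · simp [hG]
  · exact (hc.continuousOn.integrableOn_Icc (a := 0) (b := 1)).mono_set Ioo_subset_Icc_self
  · refine (ae_restrict_mem measurableSet_Ioo).mono fun r hr => ?_
    exact mul_nonneg (pow_nonneg hr.1.le _) (neg_nonneg.2 (Real.log_nonpos hr.1.le hr.2.le))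

/-- The Dirichlet integral of `f` with the weight `log |(1 - \bar w z) / (z - w)|`. -/
noncomputable def localDirichlet (w : ℂ) (f : ℂ → ℂ) : ℝ≥0∞ :=
  ∫⁻ z, ‖deriv f z‖ₑ ^ 2 * greenKernel z w ∂discArea

theorem hasSum_taylor {f : ℂ → ℂ} (hf : DifferentiableOn ℂ f 𝔻) {z : ℂ} (hz : z ∈ 𝔻) :
    HasSum (fun n => ((n.factorial : ℂ)⁻¹ * iteratedDeriv n f 0) * z ^ n) (f z) := by
  have := Complex.hasSum_taylorSeries_on_ball (c := 0) (r := 1) hf (z := z) (by simpa using hz)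
  refine this.congr_fun fun n => ?_
  simp [mul_comm, mul_left_comm]

/-- If F = c + zk, the Taylor coefficients of k are those of F shifted by one, so F' has
coefficients (n + 1) a_n with no further shift. -/
theorem exists_hasSum_deriv {F k : ℂ → ℂ} {c : ℂ} (hk : DifferentiableOn ℂ k 𝔻)
    (hF : ∀ z ∈ 𝔻, F z = c + z * k z) :
    ∃ a : ℕ → ℂ, (∀ z ∈ 𝔻, HasSum (fun n => a n * z ^ n) (k z)) ∧
      ∀ z ∈ 𝔻, HasSum (fun n : ℕ => ((n : ℂ) + 1) * a n * z ^ n) (deriv F z) := by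
  have hFd : DifferentiableOn ℂ F 𝔻 :=
    (((differentiableOn_id.mul hk).const_add c).congr hF)
  set t : ℕ → ℂ := fun n => (n.factorial : ℂ)⁻¹ * iteratedDeriv n F 0 with ht
  have h0 : (0 : ℂ) ∈ 𝔻 := by simp
  have hF0 : F 0 = c := by rw [hF 0 h0]; simp
  have hk0 : k 0 = t 1 := by
    have h1 : HasDerivAt (fun z => c + z * k z) (1 * k 0 + 0 * deriv k 0) 0 :=
      ((hasDerivAt_id 0).mul
        (hk.differentiableAt (Metric.isOpen_ball.mem_nhds h0)).hasDerivAt).const_add c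
    have h2 : F =ᶠ[𝓝 0] fun z => c + z * k z := by
      filter_upwards [Metric.isOpen_ball.mem_nhds h0] with z hz using hF z hz
    rw [ht]
    simp [h2.deriv_eq, h1.deriv]
  refine ⟨fun n => t (n + 1), fun z hz => ?_, fun z hz => ?_⟩
  · rcases eq_or_ne z 0 with rfl | hz0
    · rw [hk0]
      have := hasSum_single (f := fun n => t (n + 1) * (0 : ℂ) ^ n) 0 (by
        intro n hn
        simp [hn])
      simpa using this
    · have h1 := hasSum_taylor hFd hz
      rw [hF z hz] at h1
      rw [← hasSum_nat_add_iff' 1] at h1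
      have h2 := h1.mul_left z⁻¹
      simp only [Finset.range_one, Finset.sum_singleton, Nat.factorial_zero, Nat.cast_one, inv_one,
        iteratedDeriv_zero, hF0, one_mul, pow_zero, mul_one, add_sub_cancel_left] at h2
      rw [inv_mul_cancel_left₀ hz0] at h2
      refine h2.congr_fun fun n => ?_
      simp only [ht, pow_succ]
      field_simp
  · have h1 := hasSum_taylor (hFd.deriv Metric.isOpen_ball) hz
    refine h1.congr_fun fun n => ?_
    simp only [ht, iteratedDeriv_succ', Nat.factorial_succ]
    have : (n.factorial : ℂ) ≠ 0 := by exact_mod_cast n.factorial_ne_zero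
    have h3 : ((n : ℂ) + 1) ≠ 0 := by exact_mod_cast n.succ_ne_zero
    push_cast
    field_simp

/-- The Littlewood–Paley identity: the Green kernel with pole 0 is log(1/|z|), and Parseval on each
circle separates the coefficients. The n-th one gets the factor 2 (n + 1)² ∫ r^(2n+1) log(1/r) dr =
2 (n + 1)²/(2n + 2)² = ½, independent of n. -/
theorem localDirichlet_zero {F k : ℂ → ℂ} {c : ℂ} (hk : DifferentiableOn ℂ k 𝔻)
    (hF : ∀ z ∈ 𝔻, F z = c + z * k z) :
    localDirichlet 0 F = 2⁻¹ * hardyNorm 2 k ^ 2 := by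
  obtain ⟨a, ha, hd⟩ := exists_hasSum_deriv hk hF
  have hm : Measurable fun z => greenKernel z 0 :=
    measurable_greenKernel.comp (measurable_id.prodMk measurable_const)
  rw [localDirichlet, lintegral_discArea (g := fun z => ‖deriv F z‖ₑ ^ 2 * greenKernel z 0)
    (((measurable_deriv F).enorm.pow_const 2).mul hm),
    hardyNorm_sq_eq ha]
  have h1 : ∀ r ∈ Ioo (0 : ℝ) 1, ENNReal.ofReal (2 * r) *
      ∫⁻ ζ, ‖deriv F (r * ζ)‖ₑ ^ 2 * greenKernel (r * ζ) 0 ∂arcLength =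
      ∑' n : ℕ, ENNReal.ofReal (r ^ (2 * n + 1) * (-Real.log r)) *
        (ENNReal.ofReal (2 * ((n : ℝ) + 1) ^ 2) * ‖a n‖ₑ ^ 2) := by
    intro r hr
    have hlog : 0 ≤ -Real.log r := neg_nonneg.2 (Real.log_nonpos hr.1.le hr.2.le)
    have h2 : ∫⁻ ζ, ‖deriv F (r * ζ)‖ₑ ^ 2 * greenKernel (r * ζ) 0 ∂arcLength =
        ∫⁻ ζ, ‖deriv F (r * ζ)‖ₑ ^ 2 * ENNReal.ofReal (-Real.log r) ∂arcLength := by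
      refine lintegral_congr_ae ?_
      filter_upwards [ae_norm_eq_one] with ζ hζ
      have hne : (r : ℂ) * ζ ≠ 0 := by
        rw [← norm_ne_zero_iff]
        simp [hζ, hr.1.ne']
      rw [greenKernel, if_neg hne]
      simp [hζ, abs_of_pos hr.1]
    rw [h2, lintegral_mul_const' _ _ ENNReal.ofReal_ne_top,
      lintegral_dilation_eq (f := deriv F) (a := fun n => ((n : ℂ) + 1) * a n) hr.1.le
        (fun z hz => hd z (by simp [hz, hr.2])), ← ENNReal.tsum_mul_right, ← ENNReal.tsum_mul_left]
    refine tsum_congr fun n => ?_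
    simp only [enorm_mul, mul_pow, enorm_pow]
    have e1 : ‖(n : ℂ) + 1‖ₑ = ENNReal.ofReal ((n : ℝ) + 1) := by
      rw [← ofReal_norm]
      congr 1
      have : (n : ℂ) + 1 = ((n + 1 : ℝ) : ℂ) := by push_cast; rfl
      rw [this, Complex.norm_real, Real.norm_eq_abs, abs_of_nonneg (by positivity)]
    have e2 : ‖(r : ℂ)‖ₑ = ENNReal.ofReal r := by
      rw [← ofReal_norm, Complex.norm_real, Real.norm_eq_abs, abs_of_pos hr.1]
    rw [e1, e2, ENNReal.ofReal_mul two_pos.le, ENNReal.ofReal_mul (pow_nonneg hr.1.le _),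
      ENNReal.ofReal_pow hr.1.le, ENNReal.ofReal_mul two_pos.le, ENNReal.ofReal_pow (by positivity)]
    ring
  rw [setLIntegral_congr_fun measurableSet_Ioo h1, lintegral_tsum, ← ENNReal.tsum_mul_left]
  · refine tsum_congr fun n => ?_
    have hfin : ENNReal.ofReal (2 * ((n : ℝ) + 1) ^ 2) * ‖a n‖ₑ ^ 2 ≠ ∞ :=
      ENNReal.mul_ne_top ENNReal.ofReal_ne_top (by simp)
    rw [lintegral_mul_const' _ _ hfin, lintegral_pow_mul_neg_log, ← mul_assoc,
      ← ENNReal.ofReal_mul (by positivity)]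
    congr 1
    have : (1 : ℝ) / (2 * n + 2) ^ 2 * (2 * (n + 1) ^ 2) = 2⁻¹ := by
      have : (n : ℝ) + 1 ≠ 0 := by positivity
      field_simp
    rw [this, ENNReal.ofReal_inv_of_pos two_pos]
    simp
  · intro n
    have : Measurable fun r : ℝ => r ^ (2 * n + 1) * (-Real.log r) :=
      (measurable_id.pow_const _).mul Real.measurable_log.neg
    exact (this.ennreal_ofReal.mul_const _).aemeasurable

theorem hardyNorm_const_mul (c : ℂ) (f : ℂ → ℂ) :
    hardyNorm 2 (fun z => c * f z) = ‖c‖ₑ * hardyNorm 2 f := by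
  simp only [hardyNorm, ENNReal.mul_iSup]
  refine iSup_congr fun r => iSup_congr fun _ => ?_
  exact eLpNorm_const_smul (c := c) (f := fun ζ : ℂ => f (r * ζ)) (p := 2) (μ := arcLength)

/-! ### Möbius change of variables in the local Dirichlet integral -/

theorem det_smul_one (c : ℂ) : (c • (1 : ℂ →L[ℝ] ℂ)).det = ‖c‖ ^ 2 := by
  have h : ((c • (1 : ℂ →L[ℝ] ℂ) : ℂ →L[ℝ] ℂ) : ℂ →ₗ[ℝ] ℂ) = Algebra.lmul ℝ ℂ c := by
    ext
    all_goals simp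
  rw [ContinuousLinearMap.det, h, ← Algebra.norm_apply, Algebra.norm_complex_apply,
    Complex.normSq_eq_norm_sq]

theorem greenKernel_mobius {w z : ℂ} (hw : w ∈ 𝔻) (hz : z ∈ 𝔻) :
    greenKernel (mobius w z) w = greenKernel z 0 := by
  have hz1 : ‖z‖ ≤ 1 := (mem_ball_zero_iff.1 hz).le
  have h1 := mobius_sub hw hz1
  have h2 := one_sub_conj_mul_mobius hw hz1
  have h3 : (1 - (‖w‖ : ℂ) ^ 2) / (1 - conj w * z) ≠ 0 :=
    div_ne_zero (by exact_mod_cast (one_sub_sq_pos hw).ne') (one_sub_conj_mul_ne_zero hw hz1)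
  by_cases hz0 : z = 0
  · have : mobius w z = w := by simp [mobius, hz0]
    rw [greenKernel, greenKernel, if_pos this, if_pos hz0]
  · have : mobius w z ≠ w := by
      rw [← sub_ne_zero, h1]
      exact neg_ne_zero.2 (mul_ne_zero hz0 h3)
    rw [greenKernel, greenKernel, if_neg this, if_neg hz0, h1, h2]
    simp only [map_zero, zero_mul, sub_zero]
    congr 2
    generalize (1 - (‖w‖ : ℂ) ^ 2) / (1 - conj w * z) = x at *
    rw [norm_div, norm_div, norm_neg, norm_mul, norm_one]
    have := norm_ne_zero_iff.2 h3
    have := norm_ne_zero_iff.2 hz0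
    rw [div_eq_div_iff (by positivity) (by positivity)]
    ring

theorem image_mobius {w : ℂ} (hw : w ∈ 𝔻) : mobius w '' 𝔻 = 𝔻 := by
  refine Subset.antisymm (image_subset_iff.2 fun z hz => mobius_mem hw hz) fun z hz => ?_
  exact ⟨mobius w z, mobius_mem hw hz, mobius_mobius hw (mem_ball_zero_iff.1 hz).le⟩

/-- The real Jacobian |φ_w'|² is absorbed by the chain rule for the derivative, and the Green kernel
is conformally invariant. -/
theorem localDirichlet_comp_mobius {F : ℂ → ℂ} (hF : DifferentiableOn ℂ F 𝔻) {w : ℂ}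
    (hw : w ∈ 𝔻) : localDirichlet 0 (F ∘ mobius w) = localDirichlet w F := by
  rw [localDirichlet, localDirichlet, discArea, lintegral_smul_measure, lintegral_smul_measure]
  congr 1
  have hd : ∀ z ∈ 𝔻, HasDerivAt (mobius w) (-((1 - ‖w‖ ^ 2) / (1 - conj w * z) ^ 2)) z :=
    fun z hz => hasDerivAt_mobius hw (mem_ball_zero_iff.1 hz).le
  have hinj : InjOn (mobius w) 𝔻 := by
    intro x hx y hy hxy
    rw [← mobius_mobius hw (mem_ball_zero_iff.1 hx).le, hxy,
      mobius_mobius hw (mem_ball_zero_iff.1 hy).le]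
  have h1 := lintegral_image_eq_lintegral_abs_det_fderiv_mul volume
    (s := 𝔻) Metric.isOpen_ball.measurableSet
    (fun z hz => (hd z hz).complexToReal_fderiv.hasFDerivWithinAt) hinj
    (fun z => ‖deriv F z‖ₑ ^ 2 * greenKernel z w)
  rw [image_mobius hw] at h1
  rw [h1]
  refine setLIntegral_congr_fun Metric.isOpen_ball.measurableSet fun z hz => ?_
  have h2 : deriv (F ∘ mobius w) z =
      deriv F (mobius w z) * (-((1 - ‖w‖ ^ 2) / (1 - conj w * z) ^ 2)) :=
    ((hF.differentiableAt (Metric.isOpen_ball.mem_nhds (mobius_mem hw hz))).hasDerivAt.comp z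
      (hd z hz)).deriv
  rw [det_smul_one, greenKernel_mobius hw hz, h2, enorm_mul, mul_pow, abs_of_nonneg (sq_nonneg _),
    ENNReal.ofReal_pow (norm_nonneg _), ofReal_norm]
  ring

/-- Let q be the difference quotient of F at w. Substituting φ_w in F = F(w) + (z - w) q and using
φ_w(z) - w = -z (1 - |w|²)/(1 - \bar w z) shows that F ∘ φ_w = F(w) + zk, where k is -√(1 - |w|²)
times the isometric lift of q. The case w = 0 then applies. -/
theorem localDirichlet_eq {F : ℂ → ℂ} (hF : DifferentiableOn ℂ F 𝔻) {w : ℂ} (hw : w ∈ 𝔻) :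
    localDirichlet w F =
      2⁻¹ * (ENNReal.ofReal (1 - ‖w‖ ^ 2) * hardyNorm 2 (dslope F w) ^ 2) := by
  have hq := differentiableOn_dslope_disc hF hw
  have hq' : DifferentiableOn ℂ (mobiusLift w (dslope F w)) 𝔻 := by
    refine differentiableOn_mobiusLift hw Metric.ball_subset_closedBall ?_
    exact hq.comp ((differentiableOn_mobius hw).mono Metric.ball_subset_closedBall)
      fun z hz => mobius_mem hw hz
  rw [← localDirichlet_comp_mobius hF hw, localDirichlet_zero
    (k := fun z => (-(√(1 - ‖w‖ ^ 2) : ℝ) : ℂ) * mobiusLift w (dslope F w) z) (c := F w)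
    (hq'.const_mul _), hardyNorm_const_mul, hardyNorm_mobiusLift hw hq, mul_pow]
  · congr 2
    rw [← ofReal_norm, norm_neg, Complex.norm_real, Real.norm_eq_abs,
      abs_of_nonneg (Real.sqrt_nonneg _), ← ENNReal.ofReal_pow (Real.sqrt_nonneg _),
      Real.sq_sqrt (one_sub_sq_pos hw).le]
  · intro z hz
    have h1 := eq_add_sub_mul_dslope F w (mobius w z)
    have h4 : ((√(1 - ‖w‖ ^ 2) : ℝ) : ℂ) ^ 2 = 1 - (‖w‖ : ℂ) ^ 2 := by
      rw [← Complex.ofReal_pow, Real.sq_sqrt (one_sub_sq_pos hw).le]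
      push_cast
      rfl
    rw [Function.comp_apply, h1, mobius_sub hw (mem_ball_zero_iff.1 hz).le, mobiusLift, ← h4]
    ring

/-! ### Estimates for the local Dirichlet integral -/

theorem localDirichlet_le_of_hardyNorm_le {F : ℂ → ℂ} (hF : DifferentiableOn ℂ F 𝔻) {w : ℂ}
    (hw : w ∈ 𝔻) {a b : ℝ≥0∞} (h : hardyNorm 2 (dslope F w) ≤ a + b) :
    localDirichlet w F ≤ 2 * (2⁻¹ * (ENNReal.ofReal (1 - ‖w‖ ^ 2) * a ^ 2)) +
      2 * (2⁻¹ * (ENNReal.ofReal (1 - ‖w‖ ^ 2) * b ^ 2)) := by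
  rw [localDirichlet_eq hF hw]
  calc 2⁻¹ * (ENNReal.ofReal (1 - ‖w‖ ^ 2) * hardyNorm 2 (dslope F w) ^ 2)
      ≤ 2⁻¹ * (ENNReal.ofReal (1 - ‖w‖ ^ 2) * (2 * a ^ 2 + 2 * b ^ 2)) := by
        gcongr
        exact (pow_le_pow_left' h 2).trans (add_sq_le_two_mul a b)
    _ = _ := by ring

theorem localDirichlet_sub_le {f g : ℂ → ℂ} (hf : DifferentiableOn ℂ f 𝔻)
    (hg : DifferentiableOn ℂ g 𝔻) {w : ℂ} (hw : w ∈ 𝔻) :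
    localDirichlet w (f - g) ≤ 2 * localDirichlet w f + 2 * localDirichlet w g := by
  have hf' := differentiableOn_dslope_disc hf hw
  have hg' := differentiableOn_dslope_disc hg hw
  have h : EqOn (dslope (f - g) w) (dslope f w - dslope g w) 𝔻 := by
    refine dslope_eqOn (c := f w - g w) hw (hf'.sub hg') fun z _ => ?_
    have e1 := eq_add_sub_mul_dslope f w z
    have e2 := eq_add_sub_mul_dslope g w z
    simp only [Pi.sub_apply]
    linear_combination e1 - e2
  rw [localDirichlet_eq hf hw, localDirichlet_eq hg hw]
  refine localDirichlet_le_of_hardyNorm_le (hf.sub hg) hw ?_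
  rw [hardyNorm_congr h]
  exact hardyNorm_sub_le hf' hg'

/-- The quotient of ψf at w is ψ times the quotient of f plus the constant f(w) times the quotient
of ψ. Only f(w), not f on the disc, multiplies the second term. -/
theorem localDirichlet_mul_le {f ψ : ℂ → ℂ} (hf : DifferentiableOn ℂ f 𝔻)
    (hψ : DifferentiableOn ℂ ψ 𝔻) {A : ℝ} (hA : ∀ z ∈ 𝔻, ‖ψ z‖ ≤ A) {w : ℂ} (hw : w ∈ 𝔻) :
    localDirichlet w (ψ * f) ≤ 2 * (ENNReal.ofReal A ^ 2 * localDirichlet w f) +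
      2 * (‖f w‖ₑ ^ 2 * localDirichlet w ψ) := by
  have hf' := differentiableOn_dslope_disc hf hw
  have hψ' := differentiableOn_dslope_disc hψ hw
  have h : EqOn (dslope (ψ * f) w) (ψ * dslope f w + fun z => f w * dslope ψ w z) 𝔻 := by
    refine dslope_eqOn (c := ψ w * f w) hw ((hψ.mul hf').add (hψ'.const_mul _)) fun z _ => ?_
    have e1 := eq_add_sub_mul_dslope f w z
    have e2 := eq_add_sub_mul_dslope ψ w z
    simp only [Pi.mul_apply, Pi.add_apply]
    linear_combination ψ z * e1 + f w * e2
  have hle : hardyNorm 2 (dslope (ψ * f) w) ≤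
      ENNReal.ofReal A * hardyNorm 2 (dslope f w) + ‖f w‖ₑ * hardyNorm 2 (dslope ψ w) := by
    rw [hardyNorm_congr h]
    refine (hardyNorm_add_le (hψ.mul hf') (hψ'.const_mul _)).trans ?_
    exact add_le_add (hardyNorm_mul_le hA) (hardyNorm_const_mul _ _).le
  refine (localDirichlet_le_of_hardyNorm_le (hψ.mul hf) hw hle).trans (le_of_eq ?_)
  rw [localDirichlet_eq hf hw, localDirichlet_eq hψ hw]
  ring

/-- The same product rule, solved for f(w) times the quotient of ψ. It controls this term by ψf and
f alone, so that ψ need not be a multiplier of 𝓓_μ. -/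
theorem enorm_sq_mul_localDirichlet_le {f ψ : ℂ → ℂ} (hf : DifferentiableOn ℂ f 𝔻)
    (hψ : DifferentiableOn ℂ ψ 𝔻) {A : ℝ} (hA : ∀ z ∈ 𝔻, ‖ψ z‖ ≤ A) {w : ℂ} (hw : w ∈ 𝔻) :
    ‖f w‖ₑ ^ 2 * localDirichlet w ψ ≤
      2 * localDirichlet w (ψ * f) + 2 * (ENNReal.ofReal A ^ 2 * localDirichlet w f) := by
  have hf' := differentiableOn_dslope_disc hf hw
  have hψ' := differentiableOn_dslope_disc hψ hw
  have hψf' := differentiableOn_dslope_disc (hψ.mul hf) hw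
  have hd : DifferentiableOn ℂ (fun z => f w * ψ z) 𝔻 := hψ.const_mul _
  have h0 : EqOn (dslope (fun z => f w * ψ z) w) (fun z => f w * dslope ψ w z) 𝔻 := by
    refine dslope_eqOn (c := f w * ψ w) hw (hψ'.const_mul _) fun z _ => ?_
    linear_combination f w * eq_add_sub_mul_dslope ψ w z
  have h : EqOn (dslope (fun z => f w * ψ z) w) (dslope (ψ * f) w - ψ * dslope f w) 𝔻 := by
    refine dslope_eqOn (c := f w * ψ w) hw (hψf'.sub (hψ.mul hf')) fun z _ => ?_
    have e1 := eq_add_sub_mul_dslope f w z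
    have e2 := eq_add_sub_mul_dslope (ψ * f) w z
    simp only [Pi.mul_apply, Pi.sub_apply] at e2 ⊢
    linear_combination e2 - ψ z * e1
  have hle : hardyNorm 2 (dslope (fun z => f w * ψ z) w) ≤
      hardyNorm 2 (dslope (ψ * f) w) + ENNReal.ofReal A * hardyNorm 2 (dslope f w) := by
    rw [hardyNorm_congr h]
    exact (hardyNorm_sub_le hψf' (hψ.mul hf')).trans (add_le_add_right (hardyNorm_mul_le hA) _)
  have h1 := localDirichlet_le_of_hardyNorm_le hd hw hle
  rw [localDirichlet_eq hd hw, hardyNorm_congr h0, hardyNorm_const_mul] at h1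
  rw [localDirichlet_eq hf hw, localDirichlet_eq hψ hw, localDirichlet_eq (hψ.mul hf) hw]
  calc _ = 2⁻¹ * (ENNReal.ofReal (1 - ‖w‖ ^ 2) * (‖f w‖ₑ * hardyNorm 2 (dslope ψ w)) ^ 2) := by ring
    _ ≤ _ := h1
    _ = _ := by ring

theorem two_inv_mul_le (a : ℝ≥0∞) : 2⁻¹ * a ≤ a := by
  refine mul_le_of_le_one_left' ?_
  simp

theorem localDirichlet_le_of_bound {f : ℂ → ℂ} (hf : DifferentiableOn ℂ f 𝔻) {A : ℝ}
    (hA : ∀ z ∈ 𝔻, ‖f z‖ ≤ A) {w : ℂ} (hw : w ∈ 𝔻) :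
    localDirichlet w f ≤ ENNReal.ofReal (4 * A ^ 2) := by
  rw [localDirichlet_eq hf hw]
  refine (two_inv_mul_le _).trans ?_
  have hp := one_sub_sq_pos hw
  calc _ ≤ ENNReal.ofReal (1 - ‖w‖ ^ 2) * ENNReal.ofReal (4 * A ^ 2 / (1 - ‖w‖ ^ 2)) := by
        gcongr
        exact hardyNorm_dslope_sq_le_of_bound hf hA hw
    _ = _ := by
        rw [← ENNReal.ofReal_mul hp.le]
        congr 1
        field_simp

theorem localDirichlet_dilate_le {f : ℂ → ℂ} (hf : DifferentiableOn ℂ f 𝔻) {w : ℂ} (hw : w ∈ 𝔻)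
    {r : ℝ} (h0 : 0 ≤ r) (h1 : r < 1) :
    localDirichlet w (fun z => f (r * z)) ≤ 9 * localDirichlet w f := by
  rw [localDirichlet_eq hf hw, localDirichlet_eq (differentiableOn_dilate hf h0 h1.le) hw]
  calc _ ≤ 2⁻¹ * (ENNReal.ofReal (1 - ‖w‖ ^ 2) * (3 * hardyNorm 2 (dslope f w)) ^ 2) := by
        gcongr
        exact hardyNorm_dslope_dilate_le hf hw h0 h1
    _ = _ := by ring

/-- The constant blows up as w approaches the circle; it is only used for pointwise convergence in
w. -/
theorem exists_localDirichlet_le {w : ℂ} (hw : w ∈ 𝔻) :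
    ∃ C : ℝ≥0∞, C ≠ ∞ ∧ ∀ f : ℂ → ℂ, DifferentiableOn ℂ f 𝔻 →
      localDirichlet w f ≤ C * hardyNorm 2 f ^ 2 := by
  have hw1 : ‖w‖ < 1 := by simpa using hw
  have hc0 : ENNReal.ofReal (1 - ‖w‖) ≠ 0 := by simpa using hw1
  refine ⟨2⁻¹ * (ENNReal.ofReal (1 - ‖w‖ ^ 2) * (2 * (ENNReal.ofReal (1 - ‖w‖))⁻¹) ^ 2), ?_, ?_⟩
  · refine ENNReal.mul_ne_top (by simp) (ENNReal.mul_ne_top ENNReal.ofReal_ne_top ?_)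
    exact ENNReal.pow_ne_top (ENNReal.mul_ne_top (by simp) (ENNReal.inv_ne_top.2 hc0))
  · intro f hf
    rw [localDirichlet_eq hf hw]
    have h := hardyNorm_dslope_le hf hw
    have h2 : hardyNorm 2 (dslope f w) ≤ 2 * (ENNReal.ofReal (1 - ‖w‖))⁻¹ * hardyNorm 2 f := by
      calc hardyNorm 2 (dslope f w) = (ENNReal.ofReal (1 - ‖w‖))⁻¹ *
            (ENNReal.ofReal (1 - ‖w‖) * hardyNorm 2 (dslope f w)) := by
            rw [← mul_assoc, ENNReal.inv_mul_cancel hc0 ENNReal.ofReal_ne_top, one_mul]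
        _ ≤ (ENNReal.ofReal (1 - ‖w‖))⁻¹ * (2 * hardyNorm 2 f) := by gcongr
        _ = _ := by ring
    calc _ ≤ 2⁻¹ * (ENNReal.ofReal (1 - ‖w‖ ^ 2) *
          (2 * (ENNReal.ofReal (1 - ‖w‖))⁻¹ * hardyNorm 2 f) ^ 2) := by gcongr
      _ = _ := by ring

/-- The difference quotient of δ is bounded by A, and the remaining factor |f(w)|² (1 - |w|²) is at
most ‖f‖² by the point evaluation bound. -/
theorem localDirichlet_mul_le_of_lipschitz {f δ : ℂ → ℂ} (hf : DifferentiableOn ℂ f 𝔻)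
    (hδ : DifferentiableOn ℂ δ 𝔻) {A : ℝ} (hA : ∀ z ∈ 𝔻, ‖δ z‖ ≤ A)
    (hL : ∀ z ∈ 𝔻, ∀ w ∈ 𝔻, ‖δ z - δ w‖ ≤ A * ‖z - w‖) {w : ℂ} (hw : w ∈ 𝔻) :
    localDirichlet w (δ * f) ≤ ENNReal.ofReal A ^ 2 * (2 * localDirichlet w f + hardyNorm 2 f ^ 2) := by
  have hA0 : 0 ≤ A := (norm_nonneg _).trans (hA w hw)
  have h1 : hardyNorm 2 (dslope δ w) ≤ ENNReal.ofReal A := by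
    refine hardyNorm_le_of_bound fun z hz => ?_
    rcases eq_or_ne z w with rfl | hzw
    · rw [dslope_same]
      refine norm_deriv_le_of_lip' hA0 ?_
      filter_upwards [Metric.isOpen_ball.mem_nhds hz] with y hy using hL y hy z hz
    · rw [dslope_norm_of_ne hzw, div_le_iff₀ (norm_pos_iff.2 (sub_ne_zero.2 hzw))]
      exact hL z hz w hw
  refine (localDirichlet_mul_le hf hδ hA hw).trans ?_
  rw [localDirichlet_eq hδ hw]
  calc _ ≤ 2 * (ENNReal.ofReal A ^ 2 * localDirichlet w f) + 2 * (‖f w‖ₑ ^ 2 *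
        (2⁻¹ * (ENNReal.ofReal (1 - ‖w‖ ^ 2) * ENNReal.ofReal A ^ 2))) := by gcongr
    _ = 2 * (ENNReal.ofReal A ^ 2 * localDirichlet w f) + (2 * 2⁻¹) *
        (ENNReal.ofReal A ^ 2 * (‖f w‖ₑ ^ 2 * ENNReal.ofReal (1 - ‖w‖ ^ 2))) := by ring
    _ ≤ 2 * (ENNReal.ofReal A ^ 2 * localDirichlet w f) + 1 *
        (ENNReal.ofReal A ^ 2 * hardyNorm 2 f ^ 2) := by
        rw [ENNReal.mul_inv_cancel two_ne_zero ENNReal.ofNat_ne_top]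
        gcongr
        exact enorm_sq_mul_le_hardyNorm_sq hf hw
    _ = _ := by ring

/-! ### The space `𝓓_μ` -/

instance : IsFiniteMeasure discArea := by
  constructor
  rw [discArea]
  simp only [Measure.smul_apply, Measure.restrict_apply MeasurableSet.univ, univ_inter, smul_eq_mul]
  refine ENNReal.mul_lt_top ?_ measure_ball_lt_top
  simp [Real.pi_pos]

theorem measurable_localDirichlet (f : ℂ → ℂ) : Measurable fun w => localDirichlet w f := by
  refine Measurable.lintegral_prod_right'
    (f := fun p : ℂ × ℂ => ‖deriv f p.2‖ₑ ^ 2 * greenKernel p.2 p.1) ?_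
  exact (((measurable_deriv f).comp measurable_snd).enorm.pow_const 2).mul
    (measurable_greenKernel.comp measurable_swap)

/-- Tonelli's theorem, applied to the Green potential written as an integral over poles. -/
theorem dirichletIntegral_eq (μ : Measure ℂ) [SFinite μ] (f : ℂ → ℂ) :
    dirichletIntegral μ f = ∫⁻ w, localDirichlet w f ∂μ := by
  have hm : Measurable fun p : ℂ × ℂ => ‖deriv f p.1‖ₑ ^ 2 * greenKernel p.1 p.2 :=
    (((measurable_deriv f).comp measurable_fst).enorm.pow_const 2).mul measurable_greenKernel
  calc dirichletIntegral μ f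
      = ∫⁻ z, ∫⁻ w, ‖deriv f z‖ₑ ^ 2 * greenKernel z w ∂μ ∂discArea :=
        lintegral_congr fun z => (lintegral_const_mul' _ _ (by simp)).symm
    _ = _ := lintegral_lintegral_swap hm.aemeasurable

theorem mem_dirichletSpace_iff {μ : Measure ℂ} [SFinite μ] {f : ℂ → ℂ} :
    f ∈ dirichletSpace μ ↔ DifferentiableOn ℂ f 𝔻 ∧ dirichletNormSq μ f < ∞ := by
  rw [dirichletNormSq, ENNReal.add_lt_top, ENNReal.pow_lt_top_iff]
  simp only [OfNat.ofNat_ne_zero, or_false]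
  exact and_assoc

section

variable {μ : Measure ℂ} [IsFiniteMeasure μ]

theorem dirichletIntegral_le_lintegral (hμ : μ (𝔻)ᶜ = 0) {f : ℂ → ℂ} {Φ : ℂ → ℝ≥0∞}
    (h : ∀ w ∈ 𝔻, localDirichlet w f ≤ Φ w) : dirichletIntegral μ f ≤ ∫⁻ w, Φ w ∂μ := by
  rw [dirichletIntegral_eq]
  refine lintegral_mono_ae ?_
  filter_upwards [mem_ae_iff.2 hμ] with w hw using h w hw

theorem mem_dirichletSpace_of_bound (hμ : μ (𝔻)ᶜ = 0) {f : ℂ → ℂ} (hf : DifferentiableOn ℂ f 𝔻)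
    {A : ℝ} (hA : ∀ z ∈ 𝔻, ‖f z‖ ≤ A) : f ∈ dirichletSpace μ := by
  refine ⟨⟨hf, (hardyNorm_le_of_bound hA).trans_lt ENNReal.ofReal_lt_top⟩, ?_⟩
  refine (dirichletIntegral_le_lintegral hμ fun w hw => localDirichlet_le_of_bound hf hA hw).trans_lt ?_
  rw [lintegral_const]
  exact ENNReal.mul_lt_top ENNReal.ofReal_lt_top (measure_lt_top _ _)

theorem dirichletNormSq_mul_le (hμ : μ (𝔻)ᶜ = 0) {f δ : ℂ → ℂ} (hf : DifferentiableOn ℂ f 𝔻)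
    (hδ : DifferentiableOn ℂ δ 𝔻) {A : ℝ} (hA : ∀ z ∈ 𝔻, ‖δ z‖ ≤ A)
    (hL : ∀ z ∈ 𝔻, ∀ w ∈ 𝔻, ‖δ z - δ w‖ ≤ A * ‖z - w‖) :
    dirichletNormSq μ (δ * f) ≤ ENNReal.ofReal A ^ 2 *
      (hardyNorm 2 f ^ 2 + (2 * dirichletIntegral μ f + hardyNorm 2 f ^ 2 * μ univ)) := by
  rw [dirichletNormSq, mul_add, ← mul_pow]
  refine add_le_add (pow_le_pow_left' (hardyNorm_mul_le hA) 2) ?_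
  refine (dirichletIntegral_le_lintegral hμ fun w hw =>
    localDirichlet_mul_le_of_lipschitz hf hδ hA hL hw).trans (le_of_eq ?_)
  rw [lintegral_const_mul' _ _ (by simp), lintegral_add_right _ measurable_const,
    lintegral_const_mul' _ _ (by simp), lintegral_const, ← dirichletIntegral_eq]

theorem dirichletNormSq_const_lt_top {f : ℂ → ℂ} (hf : f ∈ dirichletSpace μ) :
    hardyNorm 2 f ^ 2 + (2 * dirichletIntegral μ f + hardyNorm 2 f ^ 2 * μ univ) < ∞ := by
  have h1 : hardyNorm 2 f ^ 2 < ∞ := ENNReal.pow_lt_top hf.1.2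
  exact ENNReal.add_lt_top.2 ⟨h1, ENNReal.add_lt_top.2
    ⟨ENNReal.mul_lt_top (by simp) hf.2, ENNReal.mul_lt_top h1 (measure_lt_top _ _)⟩⟩

theorem shift_mem_dirichletSpace (hμ : μ (𝔻)ᶜ = 0) {f : ℂ → ℂ} (hf : f ∈ dirichletSpace μ) :
    (fun z => z * f z) ∈ dirichletSpace μ := by
  refine mem_dirichletSpace_iff.2 ⟨differentiableOn_id.mul hf.1.1, ?_⟩
  refine (dirichletNormSq_mul_le (δ := fun z => z) (A := 1) hμ hf.1.1 differentiableOn_id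
    (fun z hz => (mem_ball_zero_iff.1 hz).le) (fun z _ w _ => by simp)).trans_lt ?_
  exact ENNReal.mul_lt_top (by simp) (dirichletNormSq_const_lt_top hf)

theorem isClosedInvariant_dirichletSpace (hμ : μ (𝔻)ᶜ = 0) :
    IsClosedInvariant μ (dirichletSpace μ) :=
  ⟨le_rfl, fun _ hg _ => hg, fun _ hg => shift_mem_dirichletSpace hμ hg⟩

theorem mem_of_tendsto {M : Submodule ℂ (ℂ → ℂ)} (hM : IsClosedInvariant μ M) {g : ℂ → ℂ}
    (hg : g ∈ dirichletSpace μ) {ι : Type*} {l : Filter ι} [l.NeBot] {u : ι → ℂ → ℂ}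
    (hu : ∀ᶠ i in l, u i ∈ M) (h : Tendsto (fun i => dirichletNormSq μ (g - u i)) l (𝓝 0)) :
    g ∈ M := by
  refine hM.closed g hg fun ε hε => ?_
  obtain ⟨i, hi, hi'⟩ := (hu.and (h.eventually_lt_const hε)).exists
  exact ⟨u i, hi, hi'⟩

/-- For each w in the disc the local integral tends to 0 with the H² norm, and Φ allows dominated
convergence in w. Convergence in 𝓓_μ is thereby reduced to H² convergence and a majorant. -/
theorem tendsto_dirichletNormSq (hμ : μ (𝔻)ᶜ = 0) {ι : Type*} {l : Filter ι}
    [l.IsCountablyGenerated] {u : ι → ℂ → ℂ} (hu : ∀ᶠ i in l, DifferentiableOn ℂ (u i) 𝔻)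
    (hN : Tendsto (fun i => hardyNorm 2 (u i)) l (𝓝 0)) {Φ : ℂ → ℝ≥0∞}
    (hΦ : ∫⁻ w, Φ w ∂μ ≠ ∞) (h : ∀ᶠ i in l, ∀ w ∈ 𝔻, localDirichlet w (u i) ≤ Φ w) :
    Tendsto (fun i => dirichletNormSq μ (u i)) l (𝓝 0) := by
  have hN2 : Tendsto (fun i => hardyNorm 2 (u i) ^ 2) l (𝓝 0) := by
    have := ((ENNReal.continuous_pow 2).tendsto 0).comp hN
    rw [zero_pow two_ne_zero] at this
    exact this
  have hae : ∀ᵐ w ∂μ, w ∈ 𝔻 := mem_ae_iff.2 hμ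
  have hD : Tendsto (fun i => dirichletIntegral μ (u i)) l (𝓝 0) := by
    simp only [dirichletIntegral_eq]
    rw [← lintegral_zero (μ := μ)]
    refine tendsto_lintegral_filter_of_dominated_convergence Φ
      (Eventually.of_forall fun i => measurable_localDirichlet _) ?_ hΦ ?_
    · filter_upwards [h] with i hi
      filter_upwards [hae] with w hw using hi w hw
    · filter_upwards [hae] with w hw
      obtain ⟨C, hC, hCw⟩ := exists_localDirichlet_le hw
      have h3 : Tendsto (fun i => C * hardyNorm 2 (u i) ^ 2) l (𝓝 0) := by
        simpa using ENNReal.Tendsto.const_mul hN2 (Or.inr hC)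
      refine tendsto_of_tendsto_of_tendsto_of_le_of_le' tendsto_const_nhds h3
        (Eventually.of_forall fun _ => zero_le) ?_
      filter_upwards [hu] with i hi using hCw _ hi
  simpa [dirichletNormSq] using hN2.add hD

end

/-! ### Closed invariant subspaces -/

section

variable {μ : Measure ℂ} [IsFiniteMeasure μ] {M : Submodule ℂ (ℂ → ℂ)}

theorem sum_pow_mul_mem (hM : IsClosedInvariant μ M) {f : ℂ → ℂ} (hf : f ∈ M) (c : ℕ → ℂ)
    (N : ℕ) : (fun z => (∑ n ∈ Finset.range N, c n * z ^ n) * f z) ∈ M := by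
  have hpow : ∀ n : ℕ, (fun z => z ^ n * f z) ∈ M := by
    intro n
    induction n with
    | zero => simpa using hf
    | succ n ih =>
      have := hM.shift _ ih
      simp only [← mul_assoc, ← pow_succ'] at this
      exact this
  have h : (fun z => (∑ n ∈ Finset.range N, c n * z ^ n) * f z) =
      ∑ n ∈ Finset.range N, c n • (fun z => z ^ n * f z) := by
    ext z
    simp [Finset.sum_mul, mul_assoc]
  rw [h]
  exact M.sum_mem fun n _ => M.smul_mem _ (hpow n)

theorem norm_pow_sub_pow_le {z w : ℂ} (hz : ‖z‖ ≤ 1) (hw : ‖w‖ ≤ 1) (n : ℕ) :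
    ‖z ^ n - w ^ n‖ ≤ n * ‖z - w‖ := by
  induction n with
  | zero => simp
  | succ n ih =>
    have h : z ^ (n + 1) - w ^ (n + 1) = z * (z ^ n - w ^ n) + (z - w) * w ^ n := by ring
    rw [h]
    refine (norm_add_le _ _).trans ?_
    rw [norm_mul, norm_mul, norm_pow]
    have h1 : ‖w‖ ^ n ≤ 1 := pow_le_one₀ (norm_nonneg _) hw
    push_cast
    nlinarith [norm_nonneg (z ^ n - w ^ n), norm_nonneg (z - w)]

/-- The Taylor polynomials of z ↦ ψ(rz) converge to it uniformly and in Lipschitz constant on the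
disc, and such differences multiply f into small elements of 𝓓_μ by `dirichletNormSq_mul_le`. -/
theorem dilate_mul_mem (hμ : μ (𝔻)ᶜ = 0) (hM : IsClosedInvariant μ M) {f ψ : ℂ → ℂ} (hf : f ∈ M)
    (hψ : DifferentiableOn ℂ ψ 𝔻) {r : ℝ} (h0 : 0 ≤ r) (h1 : r < 1) :
    (fun z => ψ (r * z) * f z) ∈ M := by
  have hfD := hM.le hf
  -- The derivative of zψ(z) has coefficients (n + 1) a_n. Its convergence at r gives the
  -- summability of (n + 1)|a_n| r^n, whose tails T N bound both the supremum and the Lipschitz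
  -- constant of the remainder.
  obtain ⟨a, ha, hd⟩ := exists_hasSum_deriv (F := fun z => 0 + z * ψ z) hψ fun z _ => rfl
  have hr : (r : ℂ) ∈ 𝔻 := by simpa [abs_of_nonneg h0] using h1
  set c : ℕ → ℂ := fun n => a n * r ^ n with hc
  have hs : Summable fun n : ℕ => ((n : ℝ) + 1) * ‖c n‖ := by
    refine (hd r hr).summable.norm.congr fun n => ?_
    rw [mul_assoc, norm_mul]
    congr 1
    have : (n : ℂ) + 1 = ((n + 1 : ℝ) : ℂ) := by push_cast; rfl
    rw [this, Complex.norm_real, Real.norm_eq_abs, abs_of_nonneg (by positivity)]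
  set T : ℕ → ℝ := fun N => ∑' n : ℕ, (((n + N : ℕ) : ℝ) + 1) * ‖c (n + N)‖ with hT
  have hTt : Tendsto T atTop (𝓝 0) := tendsto_sum_nat_add fun n : ℕ => ((n : ℝ) + 1) * ‖c n‖
  set δ : ℕ → ℂ → ℂ := fun N z => ψ (r * z) - ∑ n ∈ Finset.range N, c n * z ^ n with hδ
  have hδsum : ∀ N, ∀ z ∈ 𝔻, HasSum (fun n => c (n + N) * z ^ (n + N)) (δ N z) := by
    intro N z hz
    have h2 : HasSum (fun n => c n * z ^ n) (ψ (r * z)) := by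
      refine (ha (r * z) (mul_mem_ball h0 h1 (mem_ball_zero_iff.1 hz).le)).congr_fun fun n => ?_
      rw [hc, mul_pow, mul_assoc]
    exact (hasSum_nat_add_iff' N).2 h2
  have hsN : ∀ N, Summable fun n : ℕ => (((n + N : ℕ) : ℝ) + 1) * ‖c (n + N)‖ := fun N =>
    (summable_nat_add_iff N).2 hs
  have hδd : ∀ N, DifferentiableOn ℂ (δ N) 𝔻 := fun N =>
    (differentiableOn_dilate hψ h0 h1.le).sub (by fun_prop)
  have hδA : ∀ N, ∀ z ∈ 𝔻, ‖δ N z‖ ≤ T N := by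
    intro N z hz
    rw [← (hδsum N z hz).tsum_eq]
    refine tsum_of_norm_bounded (hsN N).hasSum fun n => ?_
    rw [norm_mul, norm_pow]
    have h3 : ‖z‖ ^ (n + N) ≤ 1 := pow_le_one₀ (norm_nonneg _) (mem_ball_zero_iff.1 hz).le
    have h4 : (0 : ℝ) ≤ ((n + N : ℕ) : ℝ) := Nat.cast_nonneg _
    nlinarith [norm_nonneg (c (n + N))]
  have hδL : ∀ N, ∀ z ∈ 𝔻, ∀ w ∈ 𝔻, ‖δ N z - δ N w‖ ≤ T N * ‖z - w‖ := by
    intro N z hz w hw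
    rw [← ((hδsum N z hz).sub (hδsum N w hw)).tsum_eq]
    refine tsum_of_norm_bounded ((hsN N).hasSum.mul_right _) fun n => ?_
    rw [← mul_sub, norm_mul]
    have h3 := norm_pow_sub_pow_le (mem_ball_zero_iff.1 hz).le (mem_ball_zero_iff.1 hw).le (n + N)
    have h4 : ‖c (n + N)‖ * ‖z ^ (n + N) - w ^ (n + N)‖ ≤
        ‖c (n + N)‖ * (((n + N : ℕ) : ℝ) * ‖z - w‖) := by gcongr
    nlinarith [mul_nonneg (norm_nonneg (c (n + N))) (norm_nonneg (z - w))]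
  have hle : ∀ N, dirichletNormSq μ (δ N * f) ≤ ENNReal.ofReal (T N) ^ 2 *
      (hardyNorm 2 f ^ 2 + (2 * dirichletIntegral μ f + hardyNorm 2 f ^ 2 * μ univ)) := fun N =>
    dirichletNormSq_mul_le hμ hfD.1.1 (hδd N) (hδA N) (hδL N)
  have hK := dirichletNormSq_const_lt_top hfD
  have hmem : (fun z => ψ (r * z) * f z) ∈ dirichletSpace μ := by
    refine mem_dirichletSpace_iff.2
      ⟨(differentiableOn_dilate hψ h0 h1.le).mul hfD.1.1, ?_⟩
    have h2 : (fun z => ψ (r * z) * f z) = δ 0 * f := by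
      ext z
      simp [hδ]
    rw [h2]
    exact (hle 0).trans_lt (ENNReal.mul_lt_top (by simp) hK)
  refine mem_of_tendsto hM hmem (l := atTop)
    (u := fun N z => (∑ n ∈ Finset.range N, c n * z ^ n) * f z)
    (Eventually.of_forall fun N => sum_pow_mul_mem hM hf c N) ?_
  have hlim : Tendsto (fun N => ENNReal.ofReal (T N) ^ 2 *
      (hardyNorm 2 f ^ 2 + (2 * dirichletIntegral μ f + hardyNorm 2 f ^ 2 * μ univ))) atTop (𝓝 0) := by
    have h2 : Tendsto (fun N => ENNReal.ofReal (T N) ^ 2) atTop (𝓝 0) := by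
      have h3 := ((ENNReal.continuous_pow 2).tendsto _).comp (ENNReal.tendsto_ofReal hTt)
      rw [ENNReal.ofReal_zero, zero_pow two_ne_zero] at h3
      exact h3
    simpa using ENNReal.Tendsto.mul_const h2 (Or.inr hK.ne)
  refine tendsto_of_tendsto_of_tendsto_of_le_of_le tendsto_const_nhds hlim (fun _ => zero_le)
    fun N => ?_
  refine le_trans (le_of_eq ?_) (hle N)
  congr 1
  ext z
  simp only [hδ, Pi.sub_apply, Pi.mul_apply]
  ring

/-- As f need not be bounded, it is replaced by a dilation f_s that is close in H² and bounded. The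
error costs 2A ‖f_s - f‖ uniformly in r, and for fixed s the convergence of the dilations of ψ in H²
suffices. -/
theorem tendsto_hardyNorm_dilate_sub_mul {f ψ : ℂ → ℂ} (hf : MemHardy 2 f)
    (hψ : DifferentiableOn ℂ ψ 𝔻) {A : ℝ} (hA : ∀ z ∈ 𝔻, ‖ψ z‖ ≤ A) :
    Tendsto (fun r : ℝ => hardyNorm 2 ((fun z => ψ (r * z) * f z) - ψ * f)) (𝓝[<] 1) (𝓝 0) := by
  have hψH : MemHardy 2 ψ := ⟨hψ, (hardyNorm_le_of_bound hA).trans_lt ENNReal.ofReal_lt_top⟩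
  rw [ENNReal.tendsto_nhds_zero]
  intro ε hε
  have hε2 : 0 < ε / 2 := ENNReal.half_pos hε.ne'
  have h1 : Tendsto (fun s : ℝ => ENNReal.ofReal (2 * A) * hardyNorm 2 ((fun z => f (s * z)) - f))
      (𝓝[<] 1) (𝓝 0) := by
    have := ENNReal.Tendsto.const_mul (a := ENNReal.ofReal (2 * A))
      (tendsto_hardyNorm_dilate_sub hf) (Or.inr ENNReal.ofReal_ne_top)
    rwa [mul_zero] at this
  obtain ⟨s, hs, hs01⟩ := ((ENNReal.tendsto_nhds_zero.1 h1 _ hε2).and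
    (Ioo_mem_nhdsLT zero_lt_one)).exists
  have hfs := diffContOnCl_dilation hf.1 hs01.1.le hs01.2
  have hcont := hfs.continuousOn
  rw [closure_ball _ one_ne_zero] at hcont
  obtain ⟨B, hB⟩ := (isCompact_closedBall (0 : ℂ) 1).exists_bound_of_continuousOn hcont
  have h2 : Tendsto (fun r : ℝ => ENNReal.ofReal B * hardyNorm 2 ((fun z => ψ (r * z)) - ψ))
      (𝓝[<] 1) (𝓝 0) := by
    simpa using ENNReal.Tendsto.const_mul (tendsto_hardyNorm_dilate_sub hψH)
      (Or.inr ENNReal.ofReal_ne_top)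
  filter_upwards [ENNReal.tendsto_nhds_zero.1 h2 _ hε2, Ioo_mem_nhdsLT zero_lt_one] with r hr hr01
  set δ : ℂ → ℂ := (fun z => ψ (r * z)) - ψ with hδ
  set fs : ℂ → ℂ := fun z => f (s * z) with hfsdef
  have hδd : DifferentiableOn ℂ δ 𝔻 := (differentiableOn_dilate hψ hr01.1.le hr01.2.le).sub hψ
  have hδA : ∀ z ∈ 𝔻, ‖δ z‖ ≤ 2 * A := by
    intro z hz
    refine (norm_sub_le _ _).trans ?_
    have e1 := hA _ (mul_mem_ball hr01.1.le hr01.2 (mem_ball_zero_iff.1 hz).le)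
    have e2 := hA z hz
    simp only
    linarith
  have hsplit : (fun z => ψ (r * z) * f z) - ψ * f = fs * δ - δ * (fs - f) := by
    ext z
    simp only [hδ, Pi.sub_apply, Pi.mul_apply]
    ring
  rw [hsplit]
  calc _ ≤ hardyNorm 2 (fs * δ) + hardyNorm 2 (δ * (fs - f)) :=
        hardyNorm_sub_le (hfs.differentiableOn.mul hδd)
          (hδd.mul (hfs.differentiableOn.sub hf.1))
    _ ≤ ENNReal.ofReal B * hardyNorm 2 δ + ENNReal.ofReal (2 * A) * hardyNorm 2 (fs - f) :=
        add_le_add (hardyNorm_mul_le fun z hz => hB z (Metric.ball_subset_closedBall hz))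
          (hardyNorm_mul_le hδA)
    _ ≤ ε / 2 + ε / 2 := add_le_add hr hs
    _ = ε := ENNReal.add_halves ε

/-- If `ψ` is bounded and `f`, `ψ f` both belong to `𝓓_μ`, then `ψ f` belongs to `[f]`. -/
theorem mul_mem_of_bound (hμ : μ (𝔻)ᶜ = 0) (hM : IsClosedInvariant μ M) {f ψ : ℂ → ℂ} (hf : f ∈ M)
    (hψ : DifferentiableOn ℂ ψ 𝔻) {A : ℝ} (hA : ∀ z ∈ 𝔻, ‖ψ z‖ ≤ A)
    (hψf : ψ * f ∈ dirichletSpace μ) : ψ * f ∈ M := by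
  have hfD := hM.le hf
  have hIoo : ∀ᶠ r : ℝ in 𝓝[<] 1, r ∈ Ioo (0 : ℝ) 1 := Ioo_mem_nhdsLT zero_lt_one
  refine mem_of_tendsto hM hψf (l := 𝓝[<] (1 : ℝ)) (u := fun r z => ψ (r * z) * f z)
    (hIoo.mono fun r hr => dilate_mul_mem hμ hM hf hψ hr.1.le hr.2) ?_
  set C := ENNReal.ofReal A ^ 2 with hC
  -- The majorant composes four estimates: the difference, the product rule for the dilated ψ, the
  -- factor 9 for its dilation, and the reverse product rule for |f(w)|² times the local integral of
  -- ψ. Only the integrable local integrals of ψf and f remain.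
  refine tendsto_dirichletNormSq hμ (Φ := fun w => 2 * localDirichlet w (ψ * f) +
    2 * (2 * (C * localDirichlet w f) + 2 * (9 * (2 * localDirichlet w (ψ * f) +
      2 * (C * localDirichlet w f))))) ?_ ?_ ?_ ?_
  · filter_upwards [hIoo] with r hr
    exact (hψ.mul hfD.1.1).sub ((differentiableOn_dilate hψ hr.1.le hr.2.le).mul hfD.1.1)
  · refine (tendsto_hardyNorm_dilate_sub_mul hfD.1 hψ hA).congr fun r => hardyNorm_sub_comm _ _
  · have m1 := measurable_localDirichlet (ψ * f)
    have m2 := measurable_localDirichlet f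
    have f1 : ∫⁻ w, localDirichlet w (ψ * f) ∂μ ≠ ∞ := by
      rw [← dirichletIntegral_eq]
      exact hψf.2.ne
    have f2 : ∫⁻ w, localDirichlet w f ∂μ ≠ ∞ := by
      rw [← dirichletIntegral_eq]
      exact hfD.2.ne
    have hCt : C ≠ ∞ := by simp [hC]
    have e : ∀ w, 2 * localDirichlet w (ψ * f) + 2 * (2 * (C * localDirichlet w f) +
        2 * (9 * (2 * localDirichlet w (ψ * f) + 2 * (C * localDirichlet w f)))) =
        74 * localDirichlet w (ψ * f) + 76 * C * localDirichlet w f := fun w => by ring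
    simp only [e]
    rw [lintegral_add_left (m1.const_mul _), lintegral_const_mul _ m1, lintegral_const_mul _ m2]
    exact ENNReal.add_ne_top.2 ⟨ENNReal.mul_ne_top (by simp) f1,
      ENNReal.mul_ne_top (ENNReal.mul_ne_top (by simp) hCt) f2⟩
  · filter_upwards [hIoo] with r hr
    intro w hw
    have hd := differentiableOn_dilate hψ hr.1.le hr.2.le
    refine (localDirichlet_sub_le (hψ.mul hfD.1.1) (hd.mul hfD.1.1) hw).trans ?_
    refine add_le_add_right (mul_le_mul_right ?_ 2) _
    refine (localDirichlet_mul_le hfD.1.1 hd (A := A) (fun z hz =>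
      hA _ (mul_mem_ball hr.1.le hr.2 (mem_ball_zero_iff.1 hz).le)) hw).trans ?_
    refine add_le_add_right (mul_le_mul_right ?_ 2) _
    calc ‖f w‖ₑ ^ 2 * localDirichlet w (fun z => ψ (r * z))
        ≤ ‖f w‖ₑ ^ 2 * (9 * localDirichlet w ψ) := by
          gcongr
          exact localDirichlet_dilate_le hψ hw hr.1.le hr.2
      _ = 9 * (‖f w‖ₑ ^ 2 * localDirichlet w ψ) := by ring
      _ ≤ _ := by
          gcongr
          exact enorm_sq_mul_localDirichlet_le hfD.1.1 hψ hA hw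

/-- Dilations of f are dilated multipliers applied to 1, hence in M. They converge to f in 𝓓_μ with
majorant 2 + 2 · 9 = 20 times the local integral of f. -/
theorem dirichletSpace_le_of_one_mem (hμ : μ (𝔻)ᶜ = 0) (hM : IsClosedInvariant μ M)
    (h1 : (fun _ => 1 : ℂ → ℂ) ∈ M) : dirichletSpace μ ≤ M := by
  intro f hf
  have hIoo : ∀ᶠ r : ℝ in 𝓝[<] 1, r ∈ Ioo (0 : ℝ) 1 := Ioo_mem_nhdsLT zero_lt_one
  refine mem_of_tendsto hM hf (l := 𝓝[<] (1 : ℝ)) (u := fun r z => f (r * z)) ?_ ?_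
  · filter_upwards [hIoo] with r hr
    simpa using dilate_mul_mem hμ hM h1 hf.1.1 hr.1.le hr.2
  · refine tendsto_dirichletNormSq hμ (Φ := fun w => 20 * localDirichlet w f) ?_ ?_ ?_ ?_
    · filter_upwards [hIoo] with r hr
      exact hf.1.1.sub (differentiableOn_dilate hf.1.1 hr.1.le hr.2.le)
    · exact (tendsto_hardyNorm_dilate_sub hf.1).congr fun r => hardyNorm_sub_comm _ _
    · rw [lintegral_const_mul _ (measurable_localDirichlet f), ← dirichletIntegral_eq]
      exact ENNReal.mul_ne_top (by simp) hf.2.ne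
    · filter_upwards [hIoo] with r hr
      intro w hw
      refine (localDirichlet_sub_le hf.1.1
        (differentiableOn_dilate hf.1.1 hr.1.le hr.2.le) hw).trans ?_
      calc _ ≤ 2 * localDirichlet w f + 2 * (9 * localDirichlet w f) := by
            gcongr
            exact localDirichlet_dilate_le hf.1.1 hw hr.1.le hr.2
        _ = _ := by ring

end

/-! ### Herglotz integrals and outer functions -/

/-- The Herglotz integral of `h`. -/
noncomputable def herglotz (h : ℂ → ℝ) (z : ℂ) : ℂ :=
  ∫ ζ, (ζ + z) / (ζ - z) * (h ζ : ℂ) ∂arcLength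

theorem ne_of_mem_disc {ζ z : ℂ} (hζ : ‖ζ‖ = 1) (hz : z ∈ 𝔻) : ζ - z ≠ 0 := by
  rw [sub_ne_zero]
  rintro rfl
  simp [hζ] at hz

theorem continuousOn_kernel {z : ℂ} (hz : z ∈ 𝔻) :
    ContinuousOn (fun ζ : ℂ => (ζ + z) / (ζ - z)) (Metric.sphere 0 1) :=
  ContinuousOn.div (by fun_prop) (by fun_prop) fun _ hζ => ne_of_mem_disc (by simpa using hζ) hz

theorem integrable_continuousOn_mul {E : Type*} [NormedRing E] {k g : ℂ → E}
    (hk : ContinuousOn k (Metric.sphere 0 1)) (hg : Integrable g arcLength) :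
    Integrable (fun ζ => k ζ * g ζ) arcLength := by
  obtain ⟨C, hC⟩ := (isCompact_sphere (0 : ℂ) 1).exists_bound_of_continuousOn hk
  refine hg.bdd_mul (c := C) (aestronglyMeasurable_arcLength hk) ?_
  filter_upwards [ae_norm_eq_one] with ζ hζ
  exact hC ζ (by simpa using hζ)

theorem integrable_kernel_mul {h : ℂ → ℝ} (hh : Integrable h arcLength) {z : ℂ} (hz : z ∈ 𝔻) :
    Integrable (fun ζ : ℂ => (ζ + z) / (ζ - z) * (h ζ : ℂ)) arcLength :=
  integrable_continuousOn_mul (continuousOn_kernel hz) hh.ofReal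

theorem differentiableOn_herglotz {h : ℂ → ℝ} (hh : Integrable h arcLength) :
    DifferentiableOn ℂ (herglotz h) 𝔻 := by
  refine (differentiableOn_circleAverage_herglotzRieszKernel_smul (f := fun ζ => (h ζ : ℂ))
    (circleIntegrable_of_integrable hh.ofReal)).congr fun z hz => ?_
  rw [herglotz, integral_arcLength (integrable_kernel_mul hh hz).1]
  simp [herglotzRieszKernel_def]

theorem herglotz_zero (h : ℂ → ℝ) : herglotz h 0 = ((∫ ζ, h ζ ∂arcLength : ℝ) : ℂ) := by
  rw [herglotz, ← integral_complex_ofReal]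
  refine integral_congr_ae ?_
  filter_upwards [ae_norm_eq_one] with ζ hζ
  have : ζ ≠ 0 := by
    rintro rfl
    simp at hζ
  simp [this]

theorem herglotz_sub {h k : ℂ → ℝ} (hh : Integrable h arcLength) (hk : Integrable k arcLength)
    {z : ℂ} (hz : z ∈ 𝔻) : herglotz (fun ζ => h ζ - k ζ) z = herglotz h z - herglotz k z := by
  rw [herglotz, herglotz, herglotz, ← integral_sub (integrable_kernel_mul hh hz)
    (integrable_kernel_mul hk hz)]
  congr 1
  ext ζ
  push_cast
  ring

theorem re_herglotz {h : ℂ → ℝ} (hh : Integrable h arcLength) {z : ℂ} (hz : z ∈ 𝔻) :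
    (herglotz h z).re = ∫ ζ, (1 - ‖z‖ ^ 2) / ‖ζ - z‖ ^ 2 * h ζ ∂arcLength := by
  rw [herglotz, ← Complex.reCLM_apply, ← Complex.reCLM.integral_comp_comm (integrable_kernel_mul hh hz)]
  refine integral_congr_ae ?_
  filter_upwards [ae_norm_eq_one] with ζ hζ
  have h1 := congrFun (poissonKernel_eq_re_herglotzRieszKernel (c := 0) (w := z)) ζ
  simp only [poissonKernel_def, herglotzRieszKernel_def, sub_zero, hζ, one_pow,
    Function.comp_apply] at h1
  rw [Complex.reCLM_apply, Complex.re_mul_ofReal, h1]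

theorem integral_poisson {z : ℂ} (hz : z ∈ 𝔻) :
    ∫ ζ, (1 - ‖z‖ ^ 2) / ‖ζ - z‖ ^ 2 ∂arcLength = 1 := by
  have h := integral_poisson_mul (f := fun _ => 1) diffContOnCl_const hz
  simp only [Complex.real_smul, mul_one] at h
  rw [integral_complex_ofReal] at h
  exact Complex.ofReal_eq_one.1 h

theorem le_re_herglotz {h : ℂ → ℝ} (hh : Integrable h arcLength) {c : ℝ} (hc : ∀ ζ, c ≤ h ζ) {z : ℂ}
    (hz : z ∈ 𝔻) : c ≤ (herglotz h z).re := by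
  rw [re_herglotz hh hz]
  calc c = ∫ ζ, (1 - ‖z‖ ^ 2) / ‖ζ - z‖ ^ 2 * c ∂arcLength := by
        rw [integral_mul_const, integral_poisson hz, one_mul]
    _ ≤ _ := by
        refine integral_mono ((integrable_arcLength (continuousOn_poisson hz)).mul_const _)
          (integrable_continuousOn_mul (continuousOn_poisson hz) hh) fun ζ => ?_
        exact mul_le_mul_of_nonneg_left (hc ζ) (div_nonneg (one_sub_sq_pos hz).le (sq_nonneg _))

/-- If |g| ≤ 1 then |1 - g|² ≤ 2 - 2 Re g, and the mean of Re g over a circle about 0 is its value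
at 0. -/
theorem hardyNorm_one_sub_sq_le {g : ℂ → ℂ} (hg : DifferentiableOn ℂ g 𝔻)
    (h1 : ∀ z ∈ 𝔻, ‖g z‖ ≤ 1) :
    hardyNorm 2 ((fun _ => 1) - g) ^ 2 ≤ ENNReal.ofReal (2 - 2 * (g 0).re) := by
  rw [hardyNorm_sq_le_iff]
  intro r hr
  have hd := diffContOnCl_dilation hg hr.1 hr.2
  have hc := continuousOn_sphere_of_diffContOnCl hd
  have hint := integrable_arcLength hc
  calc ∫⁻ ζ, ‖1 - g (r * ζ)‖ₑ ^ 2 ∂arcLength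
      ≤ ∫⁻ ζ, ENNReal.ofReal (2 - 2 * (g (r * ζ)).re) ∂arcLength := by
        refine lintegral_mono_ae ?_
        filter_upwards [ae_norm_eq_one] with ζ hζ
        rw [← ofReal_norm, ← ENNReal.ofReal_pow (norm_nonneg _)]
        refine ENNReal.ofReal_le_ofReal ?_
        have h2 := h1 _ (mul_mem_ball hr.1 hr.2 hζ.le)
        have h3 : ‖g (r * ζ)‖ ^ 2 ≤ 1 := pow_le_one₀ (norm_nonneg _) h2
        rw [← Complex.normSq_eq_norm_sq, Complex.normSq_apply] at h3 ⊢
        simp only [Complex.sub_re, Complex.sub_im, Complex.one_re, Complex.one_im]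
        nlinarith
    _ = ENNReal.ofReal (∫ ζ, (2 - 2 * (g (r * ζ)).re) ∂arcLength) := by
        refine (ofReal_integral_eq_lintegral_ofReal ?_ ?_).symm
        · exact (integrable_const _).sub (hint.re.const_mul 2)
        · filter_upwards [ae_norm_eq_one] with ζ hζ
          have h2 := h1 _ (mul_mem_ball hr.1 hr.2 hζ.le)
          have h3 := Complex.re_le_norm (g (r * ζ))
          simp only [Pi.zero_apply]
          linarith
    _ = _ := by
        congr 1
        have h4 := integral_arcLength_eq hd
        simp only [mul_zero] at h4
        have hre : Integrable (fun ζ : ℂ => 2 * (g (r * ζ)).re) arcLength := hint.re.const_mul 2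
        rw [integral_sub (integrable_const _) hre, integral_const_mul, ← h4]
        have h5 := Complex.reCLM.integral_comp_comm hint
        simp only [Complex.reCLM_apply] at h5
        simp [h5]

section

variable {μ : Measure ℂ} [IsFiniteMeasure μ]

theorem one_mem_of_outer (hμ : μ (𝔻)ᶜ = 0) {M : Submodule ℂ (ℂ → ℂ)} (hM : IsClosedInvariant μ M)
    {f : ℂ → ℂ} (hf : f ∈ M) {α : ℂ} {h : ℂ → ℝ} (hα : ‖α‖ = 1) (hh : Integrable h arcLength)
    (hfh : ∀ z ∈ 𝔻, f z = α * Complex.exp (herglotz h z)) : (fun _ => 1 : ℂ → ℂ) ∈ M := by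
  have hα0 : α ≠ 0 := by rw [← norm_ne_zero_iff, hα]; exact one_ne_zero
  have hfD := hM.le hf
  have hmi : ∀ n : ℕ, Integrable (fun ζ => max (h ζ) (-n)) arcLength := fun n =>
    hh.sup (integrable_const _)
  -- The part of h cut off below -n: nonnegative, at most |h|, and zero at each point once n ≥ -h.
  set k : ℕ → ℂ → ℝ := fun n ζ => max (h ζ) (-n) - h ζ with hk
  have hk0 : ∀ n ζ, 0 ≤ k n ζ := fun n ζ => sub_nonneg.2 (le_max_left _ _)
  have hkle : ∀ n ζ, k n ζ ≤ |h ζ| := by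
    intro n ζ
    have h1 : (0 : ℝ) ≤ n := Nat.cast_nonneg n
    simp only [hk]
    rcases max_cases (h ζ) (-n) with ⟨e, _⟩ | ⟨e, _⟩ <;> rw [e]
    · simp
    · linarith [neg_abs_le (h ζ)]
  have hki : ∀ n, Integrable (k n) arcLength := fun n => (hmi n).sub hh
  -- Truncation from below bounds ψ n by e^n, and ψ n * f is α times the outer function g n with
  -- data -k n, which is bounded by 1.
  set ψ : ℕ → ℂ → ℂ := fun n z => Complex.exp (-herglotz (fun ζ => max (h ζ) (-n)) z) with hψ
  have hψd : ∀ n, DifferentiableOn ℂ (ψ n) 𝔻 := fun n =>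
    (differentiableOn_herglotz (hmi n)).neg.cexp
  have hψA : ∀ n, ∀ z ∈ 𝔻, ‖ψ n z‖ ≤ Real.exp n := by
    intro n z hz
    rw [hψ, Complex.norm_exp, Real.exp_le_exp, Complex.neg_re, neg_le]
    exact le_re_herglotz (hmi n) (fun ζ => le_max_right _ _) hz
  set g : ℕ → ℂ → ℂ := fun n z => Complex.exp (-herglotz (k n) z) with hg
  have hgd : ∀ n, DifferentiableOn ℂ (g n) 𝔻 := fun n =>
    (differentiableOn_herglotz (hki n)).neg.cexp
  have hgA : ∀ n, ∀ z ∈ 𝔻, ‖g n z‖ ≤ 1 := by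
    intro n z hz
    rw [hg, Complex.norm_exp, Real.exp_le_one_iff, Complex.neg_re, neg_nonpos]
    exact le_re_herglotz (hki n) (hk0 n) hz
  have hψf : ∀ n, EqOn (ψ n * f) (fun z => α * g n z) 𝔻 := by
    intro n z hz
    simp only [Pi.mul_apply, hψ, hg]
    rw [hfh z hz, herglotz_sub (hmi n) hh hz, neg_sub, Complex.exp_sub, Complex.exp_neg]
    field_simp
  have hmem : ∀ n, ψ n * f ∈ M := by
    intro n
    refine mul_mem_of_bound hμ hM hf (hψd n) (hψA n) ?_
    refine mem_dirichletSpace_of_bound hμ ((hψd n).mul hfD.1.1) (A := 1) fun z hz => ?_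
    rw [hψf n hz, norm_mul, hα, one_mul]
    exact hgA n z hz
  have hu : ∀ n, EqOn (α⁻¹ • (ψ n * f)) (g n) 𝔻 := by
    intro n z hz
    rw [Pi.smul_apply, hψf n hz, smul_eq_mul, inv_mul_cancel_left₀ hα0]
  have hud : ∀ n, DifferentiableOn ℂ (α⁻¹ • (ψ n * f)) 𝔻 := fun n => (hgd n).congr (hu n)
  have h1D : (fun _ => 1 : ℂ → ℂ) ∈ dirichletSpace μ :=
    mem_dirichletSpace_of_bound hμ (differentiableOn_const _) (A := 1) fun z _ => by simp
  refine mem_of_tendsto hM h1D (l := atTop) (u := fun n => α⁻¹ • (ψ n * f))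
    (Eventually.of_forall fun n => M.smul_mem _ (hmem n)) ?_
  -- Since |1 - g n| ≤ 2, the uniform estimate for bounded functions gives a constant majorant,
  -- integrable because μ is finite.
  refine tendsto_dirichletNormSq hμ (Φ := fun _ => ENNReal.ofReal (4 * 2 ^ 2))
    (Eventually.of_forall fun n => (differentiableOn_const _).sub (hud n)) ?_ ?_ ?_
  · have hlim : Tendsto (fun n => ∫ ζ, k n ζ ∂arcLength) atTop (𝓝 0) := by
      have := tendsto_integral_of_dominated_convergence (μ := arcLength) (F := k) (f := fun _ => 0)
        (fun ζ => |h ζ|) (fun n => (hki n).1) hh.abs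
        (fun n => ae_of_all _ fun ζ => by
          rw [Real.norm_eq_abs, abs_of_nonneg (hk0 n ζ)]
          exact hkle n ζ)
        (ae_of_all _ fun ζ => by
          refine tendsto_const_nhds.congr' ?_
          filter_upwards [tendsto_natCast_atTop_atTop.eventually_ge_atTop (-h ζ)] with n hn
          simp only [hk]
          rw [max_eq_left (by linarith), sub_self])
      simpa using this
    have hg0 : Tendsto (fun n => ENNReal.ofReal (2 - 2 * (g n 0).re)) atTop (𝓝 0) := by
      have h2 : ∀ n, (g n 0).re = Real.exp (-∫ ζ, k n ζ ∂arcLength) := by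
        intro n
        simp only [hg]
        rw [herglotz_zero, ← Complex.ofReal_neg, ← Complex.ofReal_exp, Complex.ofReal_re]
      simp only [h2]
      have h3 : Tendsto (fun n => 2 - 2 * Real.exp (-∫ ζ, k n ζ ∂arcLength)) atTop (𝓝 0) := by
        have := ((Real.continuous_exp.tendsto _).comp hlim.neg).const_mul 2 |>.const_sub 2
        simpa [Function.comp_def] using this
      simpa using ENNReal.tendsto_ofReal h3
    have hsq : Tendsto (fun n => hardyNorm 2 ((fun _ => 1) - α⁻¹ • (ψ n * f)) ^ 2) atTop (𝓝 0) := by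
      refine tendsto_of_tendsto_of_tendsto_of_le_of_le tendsto_const_nhds hg0 (fun _ => zero_le)
        fun n => ?_
      have h4 : hardyNorm 2 ((fun _ => 1) - α⁻¹ • (ψ n * f)) = hardyNorm 2 ((fun _ => 1) - g n) :=
        hardyNorm_congr fun z hz => by rw [Pi.sub_apply, Pi.sub_apply, hu n hz]
      simp only [h4]
      exact hardyNorm_one_sub_sq_le (hgd n) (hgA n)
    exact tendsto_of_tendsto_sq hsq
  · rw [lintegral_const]
    exact ENNReal.mul_ne_top ENNReal.ofReal_ne_top (measure_ne_top _ _)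
  · refine Eventually.of_forall fun n w hw => ?_
    refine localDirichlet_le_of_bound ((differentiableOn_const _).sub (hud n)) (fun z hz => ?_) hw
    rw [Pi.sub_apply, hu n hz]
    refine (norm_sub_le _ _).trans ?_
    have := hgA n z hz
    rw [norm_one]
    linarith

theorem isCyclic_of_isOuter (hμ : μ (𝔻)ᶜ = 0) {f : ℂ → ℂ} (hf : f ∈ dirichletSpace μ)
    (ho : IsOuter f) : IsCyclic μ f := by
  obtain ⟨-, α, h, hα, hh, hfh⟩ := ho
  refine ⟨hf, le_antisymm (sInf_le ⟨isClosedInvariant_dirichletSpace hμ, hf⟩) ?_⟩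
  refine le_sInf fun M hM => ?_
  exact dirichletSpace_le_of_one_mem hμ hM.1 (one_mem_of_outer hμ hM.1 hM.2 hα hh hfh)

end

/-! ### Polynomial multiples of cyclic functions -/

section

variable {μ : Measure ℂ} [IsFiniteMeasure μ]

/-- The elements of `𝓓_μ` that are limits in `H²` of polynomial multiples of `f`. -/
noncomputable def hardyClosure (μ : Measure ℂ) [IsFiniteMeasure μ] {f : ℂ → ℂ}
    (hf : DifferentiableOn ℂ f 𝔻) : Submodule ℂ (ℂ → ℂ) where
  carrier := {g | g ∈ dirichletSpace μ ∧
    ∀ ε : ℝ≥0∞, 0 < ε → ∃ p : Polynomial ℂ, hardyNorm 2 (g - fun z => p.eval z * f z) < ε}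
  add_mem' := by
    rintro g h ⟨hg, hg'⟩ ⟨hh, hh'⟩
    refine ⟨add_mem hg hh, fun ε hε => ?_⟩
    obtain ⟨p, hp⟩ := hg' (ε / 2) (ENNReal.half_pos hε.ne')
    obtain ⟨q, hq⟩ := hh' (ε / 2) (ENNReal.half_pos hε.ne')
    refine ⟨p + q, ?_⟩
    have e : (g + h - fun z => (p + q).eval z * f z) =
        (g - fun z => p.eval z * f z) + (h - fun z => q.eval z * f z) := by
      ext z
      simp only [Pi.sub_apply, Pi.add_apply, Polynomial.eval_add]
      ring
    rw [e]
    refine (hardyNorm_add_le (hg.1.1.sub (p.differentiable.differentiableOn.mul hf))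
      (hh.1.1.sub (q.differentiable.differentiableOn.mul hf))).trans_lt ?_
    calc _ < ε / 2 + ε / 2 := ENNReal.add_lt_add hp hq
      _ = ε := ENNReal.add_halves ε
  zero_mem' := by
    refine ⟨zero_mem _, fun ε hε => ⟨0, ?_⟩⟩
    simpa [hardyNorm] using hε
  smul_mem' := by
    rintro c g ⟨hg, hg'⟩
    refine ⟨Submodule.smul_mem _ c hg, fun ε hε => ?_⟩
    obtain ⟨p, hp⟩ := hg' (ε / (‖c‖ₑ + 1)) (ENNReal.div_pos hε.ne' (by simp))
    refine ⟨Polynomial.C c * p, ?_⟩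
    have e : (c • g - fun z => (Polynomial.C c * p).eval z * f z) =
        (fun _ => c) * (g - fun z => p.eval z * f z) := by
      ext z
      simp
      ring
    rw [e]
    have h1 := hardyNorm_mul_le (f := g - fun z => p.eval z * f z) (ψ := fun _ => c) (A := ‖c‖)
      fun z _ => le_rfl
    rw [ofReal_norm] at h1
    refine h1.trans_lt ?_
    calc _ ≤ (‖c‖ₑ + 1) * hardyNorm 2 (g - fun z => p.eval z * f z) := by
          gcongr
          exact le_self_add
      _ < ε := ENNReal.mul_lt_of_lt_div' hp

/-- Closedness in 𝓓_μ holds because its norm dominates the H² norm; invariance holds because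
multiplication by z does not increase the H² norm. -/
theorem isClosedInvariant_hardyClosure (hμ : μ (𝔻)ᶜ = 0) {f : ℂ → ℂ}
    (hf : DifferentiableOn ℂ f 𝔻) : IsClosedInvariant μ (hardyClosure μ hf) where
  le := fun g hg => hg.1
  closed := by
    intro g hg hcl
    refine ⟨hg, fun ε hε => ?_⟩
    have hε2 := ENNReal.half_pos hε.ne'
    obtain ⟨u, ⟨hu, hu'⟩, hgu⟩ := hcl ((ε / 2) ^ 2) (ENNReal.pow_pos hε2 2)
    obtain ⟨p, hp⟩ := hu' (ε / 2) hε2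
    refine ⟨p, ?_⟩
    have h1 : hardyNorm 2 (g - u) < ε / 2 := by
      by_contra! h
      exact absurd (le_self_add.trans_lt hgu) (not_lt.2 (pow_le_pow_left' h 2))
    have e : (g - fun z => p.eval z * f z) = (g - u) + (u - fun z => p.eval z * f z) := by
      ext z
      simp
    rw [e]
    refine (hardyNorm_add_le (hg.1.1.sub hu.1.1)
      (hu.1.1.sub (p.differentiable.differentiableOn.mul hf))).trans_lt ?_
    calc _ < ε / 2 + ε / 2 := ENNReal.add_lt_add h1 hp
      _ = ε := ENNReal.add_halves ε
  shift := by
    rintro g ⟨hg, hg'⟩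
    refine ⟨shift_mem_dirichletSpace hμ hg, fun ε hε => ?_⟩
    obtain ⟨p, hp⟩ := hg' ε hε
    refine ⟨Polynomial.X * p, ?_⟩
    have e : ((fun z => z * g z) - fun z => (Polynomial.X * p).eval z * f z) =
        (fun z => z) * (g - fun z => p.eval z * f z) := by
      ext z
      simp
      ring
    rw [e]
    have h1 := hardyNorm_mul_le (f := g - fun z => p.eval z * f z) (ψ := fun z => z) (A := 1)
      fun z hz => (mem_ball_zero_iff.1 hz).le
    rw [ENNReal.ofReal_one, one_mul] at h1
    exact h1.trans_lt hp

/-- The H² closure contains f (take p = 1), hence all of [f] = 𝓓_μ and in particular 1. -/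
theorem exists_polynomial_of_isCyclic (hμ : μ (𝔻)ᶜ = 0) {f : ℂ → ℂ} (hf : IsCyclic μ f)
    {ε : ℝ≥0∞} (hε : 0 < ε) :
    ∃ p : Polynomial ℂ, hardyNorm 2 ((fun _ => 1) - fun z => p.eval z * f z) < ε := by
  have hfd := hf.1.1.1
  have h1D : (fun _ => 1 : ℂ → ℂ) ∈ dirichletSpace μ :=
    mem_dirichletSpace_of_bound hμ (differentiableOn_const _) (A := 1) fun z _ => by simp
  rw [← hf.2] at h1D
  have hle : generatedSubspace μ f ≤ hardyClosure μ hfd := by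
    refine sInf_le ⟨isClosedInvariant_hardyClosure hμ hfd, hf.1, fun ε hε => ⟨1, ?_⟩⟩
    have : (f - fun z => (1 : Polynomial ℂ).eval z * f z) = 0 := by
      ext z
      simp
    simpa [this, hardyNorm] using hε
  exact (hle h1D).2 ε hε

end

/-- An element of `H²` whose polynomial multiples approximate `1` has no zeros. -/
theorem ne_zero_of_approx {f : ℂ → ℂ} (hf : DifferentiableOn ℂ f 𝔻)
    (happ : ∀ ε : ℝ≥0∞, 0 < ε →
      ∃ p : Polynomial ℂ, hardyNorm 2 ((fun _ => 1) - fun z => p.eval z * f z) < ε)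
    {w : ℂ} (hw : w ∈ 𝔻) : f w ≠ 0 := by
  intro h0
  have hpos : 0 < ENNReal.ofReal (1 - ‖w‖ ^ 2) := ENNReal.ofReal_pos.2 (one_sub_sq_pos hw)
  have h1 : ENNReal.ofReal (1 - ‖w‖ ^ 2) ≤ 1 := by
    rw [ENNReal.ofReal_le_one]
    linarith [sq_nonneg ‖w‖]
  -- If f(w) = 0 then 1 - pf equals 1 at w, so point evaluation forces ‖1 - pf‖² ≥ 1 - |w|². The
  -- choice ε = 1 - |w|² ≤ 1 gives ‖1 - pf‖² < ε instead.
  obtain ⟨p, hp⟩ := happ _ hpos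
  have h2 := enorm_sq_mul_le_hardyNorm_sq (f := (fun _ => 1) - fun z => p.eval z * f z)
    ((differentiableOn_const _).sub (p.differentiable.differentiableOn.mul hf)) hw
  simp only [Pi.sub_apply, h0, mul_zero, sub_zero, enorm_one, one_pow, one_mul] at h2
  refine absurd h2 (not_le.2 ?_)
  calc _ = hardyNorm 2 ((fun _ => 1) - fun z => p.eval z * f z) *
        hardyNorm 2 ((fun _ => 1) - fun z => p.eval z * f z) := sq _
    _ ≤ 1 * hardyNorm 2 ((fun _ => 1) - fun z => p.eval z * f z) := by
        gcongr
        exact hp.le.trans h1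
    _ < _ := by rwa [one_mul]

/-! ### Boundary values -/

/-- Scheffé's lemma: for nonnegative functions, almost everywhere convergence and convergence of the
integrals imply convergence in `L¹`. -/
theorem tendsto_integral_abs_sub {X : Type*} [MeasurableSpace X] {ν : Measure X}
    {a : ℕ → X → ℝ} {A : X → ℝ} {c : ℝ} (ha : ∀ k, Integrable (a k) ν)
    (h0 : ∀ k, ∀ᵐ x ∂ν, 0 ≤ a k x) (hA : Integrable A ν)
    (hae : ∀ᵐ x ∂ν, Tendsto (fun k => a k x) atTop (𝓝 (A x)))
    (hlim : Tendsto (fun k => ∫ x, a k x ∂ν) atTop (𝓝 c)) (hc : c ≤ ∫ x, A x ∂ν) :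
    Tendsto (fun k => ∫ x, |a k x - A x| ∂ν) atTop (𝓝 0) := by
  have hpos : ∀ k, Integrable (fun x => max (A x - a k x) 0) ν := fun k => (hA.sub (ha k)).pos_part
  have h1 : Tendsto (fun k => ∫ x, max (A x - a k x) 0 ∂ν) atTop (𝓝 0) := by
    have := tendsto_integral_of_dominated_convergence (μ := ν)
      (F := fun k x => max (A x - a k x) 0) (f := fun _ => 0) (fun x => |A x|)
      (fun k => (hpos k).1) hA.abs (fun k => by
        filter_upwards [h0 k] with x hx
        rw [Real.norm_eq_abs, abs_of_nonneg (le_max_right _ _)]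
        exact max_le (by linarith [le_abs_self (A x)]) (abs_nonneg _)) (by
        filter_upwards [hae] with x hx
        have := (hx.const_sub (A x)).max (tendsto_const_nhds (x := (0 : ℝ)))
        simpa using this)
    simpa using this
  have h2 : ∀ k, ∫ x, |a k x - A x| ∂ν =
      2 * ∫ x, max (A x - a k x) 0 ∂ν + (∫ x, a k x ∂ν - ∫ x, A x ∂ν) := by
    intro k
    rw [← integral_sub (ha k) hA, ← integral_const_mul,
      ← integral_add (f := fun x => 2 * max (A x - a k x) 0) (g := fun x => a k x - A x)
        ((hpos k).const_mul 2) ((ha k).sub hA)]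
    refine integral_congr_ae (ae_of_all _ fun x => ?_)
    simp only []
    rcases le_total (a k x) (A x) with h | h
    · rw [abs_of_nonpos (by linarith), max_eq_left (by linarith)]
      ring
    · rw [abs_of_nonneg (by linarith), max_eq_right (by linarith)]
      ring
  -- From |a - A| = 2 (A - a)⁺ + (a - A), the integrals tend to c - ∫ A. As a limit of nonnegative
  -- numbers this is nonnegative, so the one-sided hypothesis on c suffices.
  have h3 : Tendsto (fun k => ∫ x, |a k x - A x| ∂ν) atTop (𝓝 (c - ∫ x, A x ∂ν)) := by
    simp only [h2]
    simpa using (h1.const_mul 2).add (hlim.sub_const _)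
  have h4 : 0 ≤ c - ∫ x, A x ∂ν :=
    ge_of_tendsto' h3 fun k => integral_nonneg fun x => abs_nonneg _
  rwa [show c - ∫ x, A x ∂ν = 0 by linarith] at h3

theorem eLpNorm_dilate_sub_le (f : ℂ → ℂ) {s t : ℝ} (hs : s ∈ Ico (0 : ℝ) 1) :
    eLpNorm (fun ζ : ℂ => f (t * s * ζ) - f (s * ζ)) 2 arcLength ≤
      hardyNorm 2 ((fun z => f (t * z)) - f) := by
  refine le_of_eq_of_le ?_ (le_iSup₂_of_le s hs le_rfl)
  simp [mul_assoc]

/-- Radial boundary values of a function of `H²`, along a sequence of radii. -/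
theorem exists_boundary_values {f : ℂ → ℂ} (hf : MemHardy 2 f) :
    ∃ (F : ℂ → ℂ) (r : ℕ → ℝ), (∀ k, r k ∈ Ioo (0 : ℝ) 1) ∧ Tendsto r atTop (𝓝[<] 1) ∧
      MemLp F 2 arcLength ∧
      (∀ᵐ ζ ∂arcLength, Tendsto (fun k => f (r k * ζ)) atTop (𝓝 (F ζ))) ∧
      Tendsto (fun k => eLpNorm (fun ζ => f (r k * ζ) - F ζ) 2 arcLength) atTop (𝓝 0) := by
  have hrad : ∀ k, radius k ∈ Ico (0 : ℝ) 1 := fun k => ⟨(radius_mem k).1.le, (radius_mem k).2⟩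
  have hm : ∀ k, MemLp (fun ζ : ℂ => f (radius k * ζ)) 2 arcLength := fun k =>
    ⟨aestronglyMeasurable_dilation hf.1 (hrad k),
      lt_of_le_of_lt (le_iSup₂_of_le (radius k) (hrad k) le_rfl) hf.2⟩
  have hmono : Monotone radius := by
    intro m n h
    simp only [radius]
    have : (m : ℝ) ≤ n := by exact_mod_cast h
    gcongr
  -- The values on the smaller circle are those of the dilation by t = radius m / radius n on the
  -- larger one, and t ≥ radius m. The Cauchy property thus follows from the H² convergence of
  -- dilations.
  have hle : ∀ m n, m ≤ n → ∀ ε : ℝ≥0∞, 0 < ε →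
      (∀ t ∈ Ico (radius m) 1, hardyNorm 2 ((fun z => f (t * z)) - f) < ε) →
      eLpNorm (fun ζ : ℂ => f (radius m * ζ) - f (radius n * ζ)) 2 arcLength < ε := by
    intro m n hmn ε hε ht
    have hn := (radius_mem n).1
    rcases (hmono hmn).eq_or_lt with e | e
    · simpa [e] using hε
    · refine lt_of_le_of_lt ?_ (ht (radius m / radius n) ⟨?_, ?_⟩)
      · have := eLpNorm_dilate_sub_le f (t := radius m / radius n) (hrad n)
        rwa [← Complex.ofReal_mul, div_mul_cancel₀ _ hn.ne'] at this
      · exact le_div_self (radius_mem m).1.le hn (radius_mem n).2.le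
      · rwa [div_lt_one hn]
  have hcau : CauchySeq fun k => (hm k).toLp := by
    rw [EMetric.cauchySeq_iff]
    intro ε hε
    have h1 := (tendsto_hardyNorm_dilate_sub hf).eventually_lt_const hε
    obtain ⟨a, ha, ha'⟩ := (mem_nhdsLT_iff_exists_Ico_subset (a := (1 : ℝ))).1 h1
    obtain ⟨N, hN⟩ := ((tendsto_radius.mono_right nhdsWithin_le_nhds).eventually_const_le ha).exists
    refine ⟨N, fun m hm' n hn' => ?_⟩
    rw [Lp.edist_toLp_toLp]
    have key : ∀ m, N ≤ m → ∀ t ∈ Ico (radius m) 1,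
        hardyNorm 2 ((fun z => f (t * z)) - f) < ε := fun m hm t ht =>
      ha' ⟨hN.trans ((hmono hm).trans ht.1), ht.2⟩
    rcases le_total m n with h | h
    · exact hle m n h ε hε (key m hm')
    · rw [eLpNorm_sub_comm]
      exact hle n m h ε hε (key n hn')
  obtain ⟨F, hF⟩ := cauchySeq_tendsto_of_complete hcau
  have hF2 : Tendsto (fun k => eLpNorm (fun ζ : ℂ => f (radius k * ζ) - F ζ) 2 arcLength)
      atTop (𝓝 0) := by
    refine ((Lp.tendsto_Lp_iff_tendsto_eLpNorm' _ _).1 hF).congr fun k => eLpNorm_congr_ae ?_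
    exact (hm k).coeFn_toLp.sub (ae_eq_refl _)
  obtain ⟨ns, hns, hae⟩ := (tendstoInMeasure_of_tendsto_eLpNorm (by norm_num)
    (fun k => (hm k).1) (Lp.memLp F).1 hF2).exists_seq_tendsto_ae
  exact ⟨F, fun k => radius (ns k), fun k => radius_mem _,
    tendsto_radius.comp hns.tendsto_atTop, Lp.memLp F, hae, hF2.comp hns.tendsto_atTop⟩

/-- The Poisson integral formula for `log |f|` on a circle around which `f` has no zeros. -/
theorem integral_poisson_log_norm {f : ℂ → ℂ} (hf : DifferentiableOn ℂ f 𝔻)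
    (h0 : ∀ z ∈ 𝔻, f z ≠ 0) {r : ℝ} (hr : r ∈ Ico (0 : ℝ) 1) {w : ℂ} (hw : w ∈ 𝔻) :
    ∫ ζ : ℂ, (1 - ‖w‖ ^ 2) / ‖ζ - w‖ ^ 2 * Real.log ‖f (r * ζ)‖ ∂arcLength =
      Real.log ‖f (r * w)‖ := by
  have hmem : ∀ z ∈ Metric.closedBall (0 : ℂ) 1, (r : ℂ) * z ∈ 𝔻 := fun z hz =>
    mul_mem_ball hr.1 hr.2 (by simpa using hz)
  have hharm : InnerProductSpace.HarmonicOnNhd (fun z : ℂ => Real.log ‖f (r * z)‖)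
      (Metric.closedBall 0 1) := by
    intro z hz
    refine AnalyticAt.harmonicAt_log_norm (f := fun z : ℂ => f (r * z)) ?_ (h0 _ (hmem z hz))
    have h1 : AnalyticAt ℂ f (r * z) := hf.analyticAt (Metric.isOpen_ball.mem_nhds (hmem z hz))
    exact h1.comp (f := fun z : ℂ => (r : ℂ) * z) (analyticAt_const.mul analyticAt_id)
  have hcont : ContinuousOn (fun ζ : ℂ => Real.log ‖f (r * ζ)‖) (Metric.sphere 0 1) := by
    refine ContinuousOn.log (ContinuousOn.norm (hf.continuousOn.comp (by fun_prop) fun ζ hζ => ?_))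
      fun ζ hζ => norm_ne_zero_iff.2 (h0 _ ?_) <;>
    exact hmem ζ (Metric.sphere_subset_closedBall hζ)
  rw [integral_arcLength (aestronglyMeasurable_arcLength (f := fun ζ : ℂ =>
      (1 - ‖w‖ ^ 2) / ‖ζ - w‖ ^ 2 * Real.log ‖f (r * ζ)‖) ((continuousOn_poisson hw).mul hcont)),
    ← InnerProductSpace.HarmonicOnNhd.circleAverage_poissonKernel_smul hharm hw]
  refine Real.circleAverage_congr_sphere fun ζ hζ => ?_
  have : ‖ζ‖ = 1 := by simpa using hζ
  simp [poissonKernel_def, this]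

/-- Jensen's inequality for polynomials. -/
theorem log_norm_eval_zero_le (p : Polynomial ℂ) (h0 : p.eval 0 ≠ 0) :
    Integrable (fun ζ => Real.log ‖p.eval ζ‖) arcLength ∧
      Real.log ‖p.eval 0‖ ≤ ∫ ζ, Real.log ‖p.eval ζ‖ ∂arcLength := by
  have hms : AEStronglyMeasurable (fun ζ => Real.log ‖p.eval ζ‖) arcLength :=
    (Real.measurable_log.comp p.continuous.norm.measurable).aestronglyMeasurable
  refine ⟨integrable_of_circleIntegrable hms ?_, ?_⟩
  · exact (circleIntegrable_def _ _ _).2 p.intervalIntegrable_mahlerMeasure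
  · rw [integral_arcLength hms, ← Polynomial.logMahlerMeasure_def,
      Polynomial.logMahlerMeasure_eq_log_MahlerMeasure]
    -- The coefficient bound by the Mahler measure at index 0 is Jensen's inequality at the origin.
    have := p.norm_coeff_le_choose_mul_mahlerMeasure 0
    rw [Polynomial.coeff_zero_eq_eval_zero, Nat.choose_zero_right, Nat.cast_one, one_mul] at this
    exact Real.log_le_log (norm_pos_iff.2 h0) this

theorem ae_eval_ne_zero {p : Polynomial ℂ} (hp : p ≠ 0) :
    ∀ᵐ ζ ∂arcLength, p.eval ζ ≠ 0 := by
  have hfin : {ζ : ℂ | p.eval ζ = 0}.Finite :=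
    (p.roots.toFinset.finite_toSet).subset fun ζ hζ => by
      simpa [hp] using hζ
  rw [ae_iff]
  simp only [not_not]
  rw [arcLength, Measure.map_apply (continuous_circleMap 0 1).measurable hfin.measurableSet]
  have := hfin.countable.preimage_circleMap 0 (R := 1) one_ne_zero
  rw [Measure.smul_apply, nonpos_iff_eq_zero.1 ((Measure.restrict_apply_le _ _).trans_eq
    (this.measure_zero volume)), smul_zero]

/-! ### Cyclic functions are outer -/

section

variable {f F : ℂ → ℂ} {r : ℕ → ℝ}

theorem integrable_log_norm_dilation (hf : DifferentiableOn ℂ f 𝔻) (h0 : ∀ z ∈ 𝔻, f z ≠ 0) {s : ℝ}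
    (hs : s ∈ Ico (0 : ℝ) 1) : Integrable (fun ζ : ℂ => Real.log ‖f (s * ζ)‖) arcLength := by
  have hmem : ∀ ζ ∈ Metric.sphere (0 : ℂ) 1, (s : ℂ) * ζ ∈ 𝔻 := fun ζ hζ =>
    mul_mem_ball hs.1 hs.2 (by simpa using hζ.le)
  exact integrable_arcLength (ContinuousOn.log
    (ContinuousOn.norm (hf.continuousOn.comp (by fun_prop) hmem))
    fun ζ hζ => norm_ne_zero_iff.2 (h0 _ (hmem ζ hζ)))

theorem integral_log_norm_dilation (hf : DifferentiableOn ℂ f 𝔻) (h0 : ∀ z ∈ 𝔻, f z ≠ 0) {s : ℝ}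
    (hs : s ∈ Ico (0 : ℝ) 1) : ∫ ζ : ℂ, Real.log ‖f (s * ζ)‖ ∂arcLength = Real.log ‖f 0‖ := by
  have h1 := integral_poisson_log_norm hf h0 hs (w := 0) (by simp)
  rw [mul_zero] at h1
  rw [← h1]
  refine integral_congr_ae ?_
  filter_upwards [ae_norm_eq_one] with ζ hζ
  simp [hζ]

theorem integrable_norm_dilation (hf : DifferentiableOn ℂ f 𝔻) {s : ℝ}
    (hs : s ∈ Ico (0 : ℝ) 1) : Integrable (fun ζ : ℂ => ‖f (s * ζ)‖) arcLength :=
  (integrable_arcLength (continuousOn_sphere_of_diffContOnCl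
    (diffContOnCl_dilation hf hs.1 hs.2))).norm

theorem aemeasurable_liminf {X : Type*} [MeasurableSpace X] {ν : Measure X} {a : ℕ → X → ℝ≥0∞}
    (ha : ∀ k, AEMeasurable (a k) ν) : AEMeasurable (fun x => liminf (fun k => a k x) atTop) ν := by
  refine ⟨fun x => liminf (fun k => (ha k).mk _ x) atTop,
    Measurable.liminf fun k => (ha k).measurable_mk, ?_⟩
  filter_upwards [ae_all_iff.2 fun k => (ha k).ae_eq_mk] with x hx
  simp only [hx]

theorem log_le_self {x : ℝ} (hx : 0 ≤ x) : 0 ≤ x - Real.log x :=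
  sub_nonneg.2 (Real.log_le_self hx)

theorem tendsto_integral_norm_dilation (hf : DifferentiableOn ℂ f 𝔻)
    (hr : ∀ k, r k ∈ Ioo (0 : ℝ) 1) (hF : MemLp F 2 arcLength)
    (hL : Tendsto (fun k => eLpNorm (fun ζ => f (r k * ζ) - F ζ) 2 arcLength) atTop (𝓝 0)) :
    Tendsto (fun k => ∫ ζ : ℂ, ‖f (r k * ζ)‖ ∂arcLength) atTop (𝓝 (∫ ζ, ‖F ζ‖ ∂arcLength)) := by
  have hFi : Integrable F arcLength := hF.integrable (by norm_num)
  have hi := fun k => integrable_norm_dilation hf ⟨(hr k).1.le, (hr k).2⟩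
  have hm := fun k => aestronglyMeasurable_dilation hf (r := r k) ⟨(hr k).1.le, (hr k).2⟩
  refine tendsto_integral_of_L1 _ hFi.norm.1 (Eventually.of_forall hi) ?_
  refine tendsto_of_tendsto_of_tendsto_of_le_of_le tendsto_const_nhds hL (fun _ => zero_le)
    fun k => ?_
  calc ∫⁻ ζ, ‖‖f (r k * ζ)‖ - ‖F ζ‖‖ₑ ∂arcLength
      ≤ ∫⁻ ζ, ‖f (r k * ζ) - F ζ‖ₑ ∂arcLength := by
        refine lintegral_mono fun ζ => ?_
        rw [← ofReal_norm, ← ofReal_norm]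
        exact ENNReal.ofReal_le_ofReal (abs_norm_sub_norm_le _ _)
    _ = eLpNorm (fun ζ => f (r k * ζ) - F ζ) 1 arcLength := eLpNorm_one_eq_lintegral_enorm.symm
    _ ≤ _ := eLpNorm_le_eLpNorm_of_exponent_le (by norm_num) ((hm k).sub hF.1)

/-- Fatou's lemma is applied to |f| - log|f| ≥ 0. As log|f| is harmonic, its mean on every circle is
log|f(0)|, so the integrals stay bounded. -/
theorem boundary_log_integrable (hf : DifferentiableOn ℂ f 𝔻) (h0 : ∀ z ∈ 𝔻, f z ≠ 0)
    (hr : ∀ k, r k ∈ Ioo (0 : ℝ) 1) (hF : MemLp F 2 arcLength)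
    (hae : ∀ᵐ ζ ∂arcLength, Tendsto (fun k => f (r k * ζ)) atTop (𝓝 (F ζ)))
    (hL : Tendsto (fun k => eLpNorm (fun ζ => f (r k * ζ) - F ζ) 2 arcLength) atTop (𝓝 0)) :
    (∀ᵐ ζ ∂arcLength, F ζ ≠ 0) ∧ Integrable (fun ζ => Real.log ‖F ζ‖) arcLength := by
  have hr' : ∀ k, r k ∈ Ico (0 : ℝ) 1 := fun k => ⟨(hr k).1.le, (hr k).2⟩
  set a : ℕ → ℂ → ℝ := fun k ζ => ‖f (r k * ζ)‖ - Real.log ‖f (r k * ζ)‖ with ha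
  have ha0 : ∀ k ζ, 0 ≤ a k ζ := fun k ζ => log_le_self (norm_nonneg _)
  have hai : ∀ k, Integrable (a k) arcLength := fun k =>
    (integrable_norm_dilation hf (hr' k)).sub (integrable_log_norm_dilation hf h0 (hr' k))
  have hlim : Tendsto (fun k => ∫⁻ ζ, ENNReal.ofReal (a k ζ) ∂arcLength) atTop
      (𝓝 (ENNReal.ofReal (∫ ζ, ‖F ζ‖ ∂arcLength - Real.log ‖f 0‖))) := by
    refine (ENNReal.tendsto_ofReal
      ((tendsto_integral_norm_dilation hf hr hF hL).sub_const _)).congr fun k => ?_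
    rw [← ofReal_integral_eq_lintegral_ofReal (hai k) (ae_of_all _ (ha0 k)),
      integral_sub (integrable_norm_dilation hf (hr' k)) (integrable_log_norm_dilation hf h0 (hr' k)),
      integral_log_norm_dilation hf h0 (hr' k)]
  have hfatou : ∫⁻ ζ, liminf (fun k => ENNReal.ofReal (a k ζ)) atTop ∂arcLength < ∞ := by
    refine (lintegral_liminf_le' fun k => (hai k).1.aemeasurable.ennreal_ofReal).trans_lt ?_
    rw [hlim.liminf_eq]
    exact ENNReal.ofReal_lt_top
  -- This must come first because `Real.log 0 = 0`: at a zero of F the lower limit is ∞ although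
  -- log‖F‖ is finite there.
  have hne : ∀ᵐ ζ ∂arcLength, F ζ ≠ 0 := by
    have hm : AEMeasurable (fun ζ => liminf (fun k => ENNReal.ofReal (a k ζ)) atTop) arcLength :=
      aemeasurable_liminf fun k => (hai k).1.aemeasurable.ennreal_ofReal
    filter_upwards [ae_lt_top' hm hfatou.ne, hae, ae_norm_eq_one] with ζ hζ hlimζ hn hFζ
    rw [hFζ] at hlimζ
    have h1 : Tendsto (fun k => ‖f (r k * ζ)‖) atTop (𝓝[≠] 0) :=
      tendsto_nhdsWithin_iff.2 ⟨by simpa using hlimζ.norm, Eventually.of_forall fun k =>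
        norm_ne_zero_iff.2 (h0 _ (mul_mem_ball (hr' k).1 (hr' k).2 hn.le))⟩
    have h2 : Tendsto (fun k => a k ζ) atTop atTop := by
      refine tendsto_atTop_mono (f := fun k => -Real.log ‖f (r k * ζ)‖) (fun k => ?_)
        (tendsto_neg_atBot_atTop.comp (Real.tendsto_log_nhdsNE_zero.comp h1))
      simp only [ha]
      linarith [norm_nonneg (f (r k * ζ))]
    have h3 : Tendsto (fun k => ENNReal.ofReal (a k ζ)) atTop (𝓝 ∞) :=
      ENNReal.tendsto_ofReal_atTop.comp h2
    rw [h3.liminf_eq] at hζ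
    exact lt_irrefl _ hζ
  refine ⟨hne, ?_⟩
  have hFn := (hF.integrable (by norm_num)).norm
  have hms : AEStronglyMeasurable (fun ζ => ‖F ζ‖ - Real.log ‖F ζ‖) arcLength :=
    hFn.1.sub (Real.measurable_log.comp_aemeasurable hFn.1.aemeasurable).aestronglyMeasurable
  have hA : Integrable (fun ζ => ‖F ζ‖ - Real.log ‖F ζ‖) arcLength := by
    refine ⟨hms, ?_⟩
    rw [hasFiniteIntegral_iff_ofReal (ae_of_all _ fun ζ => log_le_self (norm_nonneg _))]
    refine lt_of_eq_of_lt (lintegral_congr_ae ?_) hfatou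
    filter_upwards [hae, hne] with ζ hζ hn
    refine (Tendsto.liminf_eq (ENNReal.tendsto_ofReal ?_)).symm
    exact hζ.norm.sub (hζ.norm.log (norm_ne_zero_iff.2 hn))
  refine (hFn.sub hA).congr (ae_of_all _ fun ζ => ?_)
  simp

theorem log_le_half_sq {x : ℝ} (hx : 0 < x) : Real.log x ≤ (x ^ 2 - 1) / 2 := by
  have := Real.log_le_sub_one_of_pos (pow_pos hx 2)
  rw [Real.log_pow] at this
  push_cast at this
  linarith

/-- Jensen bounds log|p(0)| by ∫ log|p|, and log x ≤ (x² - 1)/2 bounds ∫ log|pF| through ‖pf‖ ≤ 1 +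
ε. Since |p(0) f(0)| ≥ 1 - ε, the unknown p cancels. -/
theorem integral_log_boundary_le_add (hf : DifferentiableOn ℂ f 𝔻)
    (hr : ∀ k, r k ∈ Ioo (0 : ℝ) 1) (hr1 : Tendsto r atTop (𝓝[<] 1)) (hF : MemLp F 2 arcLength)
    (hae : ∀ᵐ ζ ∂arcLength, Tendsto (fun k => f (r k * ζ)) atTop (𝓝 (F ζ)))
    (hne : ∀ᵐ ζ ∂arcLength, F ζ ≠ 0) (hu : Integrable (fun ζ => Real.log ‖F ζ‖) arcLength)
    {ε : ℝ} (hε : ε ∈ Ioo (0 : ℝ) 1) {p : Polynomial ℂ}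
    (hp : hardyNorm 2 ((fun _ => 1) - fun z => p.eval z * f z) ≤ ENNReal.ofReal ε) :
    ∫ ζ, Real.log ‖F ζ‖ ∂arcLength ≤
      Real.log ‖f 0‖ + ((1 + ε) ^ 2 - 1) / 2 - Real.log (1 - ε) := by
  have hpf : DifferentiableOn ℂ (fun z => p.eval z * f z) 𝔻 :=
    p.differentiable.differentiableOn.mul hf
  have h0 : ‖1 - p.eval 0 * f 0‖ ≤ ε := by
    have h1 := enorm_sq_mul_le_hardyNorm_sq (f := (fun _ => 1) - fun z => p.eval z * f z)
      ((differentiableOn_const _).sub hpf) (w := 0) (by simp)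
    simp only [Pi.sub_apply, norm_zero, ne_eq, OfNat.ofNat_ne_zero, not_false_eq_true, zero_pow,
      sub_zero, ENNReal.ofReal_one, mul_one] at h1
    have h2 := (ENNReal.pow_le_pow_left_iff two_ne_zero).1 h1
    rw [← ofReal_norm] at h2
    exact (ENNReal.ofReal_le_ofReal_iff hε.1.le).1 (h2.trans hp)
  have h1 : 1 - ε ≤ ‖p.eval 0‖ * ‖f 0‖ := by
    rw [← norm_mul]
    have := norm_sub_norm_le (1 : ℂ) (p.eval 0 * f 0)
    rw [norm_one] at this
    linarith
  have hpos : 0 < ‖p.eval 0‖ * ‖f 0‖ := lt_of_lt_of_le (by linarith [hε.2]) h1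
  have hp0 : ‖p.eval 0‖ ≠ 0 := left_ne_zero_of_mul hpos.ne'
  have hf0 : ‖f 0‖ ≠ 0 := right_ne_zero_of_mul hpos.ne'
  obtain ⟨hpi, hpj⟩ := log_norm_eval_zero_le p (norm_ne_zero_iff.1 hp0)
  have hpne : p ≠ 0 := by
    rintro rfl
    simp at hp0
  have hN : hardyNorm 2 (fun z => p.eval z * f z) ^ 2 ≤ ENNReal.ofReal ((1 + ε) ^ 2) := by
    rw [ENNReal.ofReal_pow (by linarith [hε.1])]
    refine pow_le_pow_left' ?_ 2
    have h2 := hardyNorm_sub_le (f := fun _ => 1)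
      (g := (fun _ => 1) - fun z => p.eval z * f z) (differentiableOn_const _)
      ((differentiableOn_const _).sub hpf)
    rw [sub_sub_cancel] at h2
    refine h2.trans ?_
    rw [ENNReal.ofReal_add zero_le_one hε.1.le, ENNReal.ofReal_one]
    exact add_le_add ((hardyNorm_const (c := 1)).trans (by simp)) hp
  have hfat : ∫⁻ ζ, ‖p.eval ζ * F ζ‖ₑ ^ 2 ∂arcLength ≤ ENNReal.ofReal ((1 + ε) ^ 2) := by
    calc ∫⁻ ζ, ‖p.eval ζ * F ζ‖ₑ ^ 2 ∂arcLength
        = ∫⁻ ζ, liminf (fun k => ‖p.eval (r k * ζ) * f (r k * ζ)‖ₑ ^ 2) atTop ∂arcLength := by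
          refine lintegral_congr_ae ?_
          filter_upwards [hae] with ζ hζ
          have h3 : Tendsto (fun k => p.eval (r k * ζ)) atTop (𝓝 (p.eval ζ)) := by
            have h4 : Tendsto (fun k => (r k : ℂ) * ζ) atTop (𝓝 (1 * ζ)) :=
              (Complex.continuous_ofReal.tendsto' 1 1 (by simp)).comp
                (hr1.mono_right nhdsWithin_le_nhds) |>.mul_const ζ
            rw [one_mul] at h4
            exact (p.continuous.tendsto _).comp h4
          exact (((ENNReal.continuous_pow 2).tendsto _).comp (h3.mul hζ).enorm).liminf_eq.symm
      _ ≤ liminf (fun k => ∫⁻ ζ, ‖p.eval (r k * ζ) * f (r k * ζ)‖ₑ ^ 2 ∂arcLength) atTop :=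
          lintegral_liminf_le' fun k => (aestronglyMeasurable_dilation hpf
            ⟨(hr k).1.le, (hr k).2⟩).enorm.pow_const 2
      _ ≤ liminf (fun _ : ℕ => hardyNorm 2 (fun z => p.eval z * f z) ^ 2) atTop :=
          liminf_le_liminf (Eventually.of_forall fun k =>
            lintegral_le_hardyNorm_sq (fun z => p.eval z * f z) ⟨(hr k).1.le, (hr k).2⟩)
      _ ≤ _ := by rwa [liminf_const]
  have hpFm : AEStronglyMeasurable (fun ζ => ‖p.eval ζ * F ζ‖ ^ 2) arcLength :=
    (p.continuous.aestronglyMeasurable.mul hF.1).norm.pow 2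
  have hpe : ∫⁻ ζ, ENNReal.ofReal (‖p.eval ζ * F ζ‖ ^ 2) ∂arcLength =
      ∫⁻ ζ, ‖p.eval ζ * F ζ‖ₑ ^ 2 ∂arcLength := by
    refine lintegral_congr fun ζ => ?_
    rw [ENNReal.ofReal_pow (norm_nonneg _), ofReal_norm]
  have hpFi : Integrable (fun ζ => ‖p.eval ζ * F ζ‖ ^ 2) arcLength := by
    refine ⟨hpFm, ?_⟩
    rw [hasFiniteIntegral_iff_ofReal (ae_of_all _ fun ζ => sq_nonneg _), hpe]
    exact hfat.trans_lt ENNReal.ofReal_lt_top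
  have hsq : ∫ ζ, ‖p.eval ζ * F ζ‖ ^ 2 ∂arcLength ≤ (1 + ε) ^ 2 := by
    rw [← ENNReal.ofReal_le_ofReal_iff (sq_nonneg _),
      ofReal_integral_eq_lintegral_ofReal hpFi (ae_of_all _ fun ζ => sq_nonneg _), hpe]
    exact hfat
  have hmain : ∫ ζ, Real.log ‖p.eval ζ‖ ∂arcLength + ∫ ζ, Real.log ‖F ζ‖ ∂arcLength ≤
      (∫ ζ, ‖p.eval ζ * F ζ‖ ^ 2 ∂arcLength - 1) / 2 := by
    have h5 : ∫ ζ, (‖p.eval ζ * F ζ‖ ^ 2 - 1) / 2 ∂arcLength =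
        (∫ ζ, ‖p.eval ζ * F ζ‖ ^ 2 ∂arcLength - 1) / 2 := by
      rw [integral_div, integral_sub hpFi (integrable_const _)]
      simp
    rw [← integral_add hpi hu, ← h5]
    refine integral_mono_ae (hpi.add hu) ((hpFi.sub (integrable_const _)).div_const 2) ?_
    filter_upwards [hne, ae_eval_ne_zero hpne] with ζ h6 h7
    rw [← Real.log_mul (norm_ne_zero_iff.2 h7) (norm_ne_zero_iff.2 h6), ← norm_mul]
    exact log_le_half_sq (norm_pos_iff.2 (mul_ne_zero h7 h6))
  have hlog := Real.log_le_log (by linarith [hε.2]) h1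
  rw [Real.log_mul hp0 hf0] at hlog
  linarith

theorem integral_log_boundary_le (hf : DifferentiableOn ℂ f 𝔻)
    (hr : ∀ k, r k ∈ Ioo (0 : ℝ) 1) (hr1 : Tendsto r atTop (𝓝[<] 1)) (hF : MemLp F 2 arcLength)
    (hae : ∀ᵐ ζ ∂arcLength, Tendsto (fun k => f (r k * ζ)) atTop (𝓝 (F ζ)))
    (hne : ∀ᵐ ζ ∂arcLength, F ζ ≠ 0) (hu : Integrable (fun ζ => Real.log ‖F ζ‖) arcLength)
    (happ : ∀ ε : ℝ≥0∞, 0 < ε →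
      ∃ p : Polynomial ℂ, hardyNorm 2 ((fun _ => 1) - fun z => p.eval z * f z) < ε) :
    ∫ ζ, Real.log ‖F ζ‖ ∂arcLength ≤ Real.log ‖f 0‖ := by
  have hlim : Tendsto (fun ε : ℝ => Real.log ‖f 0‖ + ((1 + ε) ^ 2 - 1) / 2 - Real.log (1 - ε))
      (𝓝[>] 0) (𝓝 (Real.log ‖f 0‖)) := by
    have hc : ContinuousAt
        (fun ε : ℝ => Real.log ‖f 0‖ + ((1 + ε) ^ 2 - 1) / 2 - Real.log (1 - ε)) 0 := by
      refine ContinuousAt.sub (by fun_prop) (ContinuousAt.log (by fun_prop) (by norm_num))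
    simpa [ContinuousAt] using hc.tendsto.mono_left (nhdsWithin_le_nhds (s := Ioi 0))
  refine ge_of_tendsto hlim ?_
  filter_upwards [Ioo_mem_nhdsGT zero_lt_one] with ε hε
  obtain ⟨p, hp⟩ := happ (ENNReal.ofReal ε) (ENNReal.ofReal_pos.2 hε.1)
  exact integral_log_boundary_le_add hf hr hr1 hF hae hne hu hε hp.le

/-- Scheffé's lemma gives L¹ convergence of both |f| - log|f| and |f| along the radii, hence of
log|f|; `hle` supplies its mass hypothesis. The Poisson kernel is bounded on the circle, so the
Poisson formula passes to the limit. -/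
theorem log_norm_eq_re_herglotz (hf : DifferentiableOn ℂ f 𝔻) (h0 : ∀ z ∈ 𝔻, f z ≠ 0)
    (hr : ∀ k, r k ∈ Ioo (0 : ℝ) 1) (hr1 : Tendsto r atTop (𝓝[<] 1)) (hF : MemLp F 2 arcLength)
    (hae : ∀ᵐ ζ ∂arcLength, Tendsto (fun k => f (r k * ζ)) atTop (𝓝 (F ζ)))
    (hL : Tendsto (fun k => eLpNorm (fun ζ => f (r k * ζ) - F ζ) 2 arcLength) atTop (𝓝 0))
    (hne : ∀ᵐ ζ ∂arcLength, F ζ ≠ 0) (hu : Integrable (fun ζ => Real.log ‖F ζ‖) arcLength)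
    (hle : ∫ ζ, Real.log ‖F ζ‖ ∂arcLength ≤ Real.log ‖f 0‖) {w : ℂ} (hw : w ∈ 𝔻) :
    Real.log ‖f w‖ = (herglotz (fun ζ => Real.log ‖F ζ‖) w).re := by
  have hr' : ∀ k, r k ∈ Ico (0 : ℝ) 1 := fun k => ⟨(hr k).1.le, (hr k).2⟩
  have hFn := (hF.integrable (by norm_num)).norm
  have hvi := fun k => integrable_norm_dilation hf (hr' k)
  have hui := fun k => integrable_log_norm_dilation hf h0 (hr' k)
  have hsch := tendsto_integral_abs_sub (ν := arcLength)
    (a := fun k ζ => ‖f (r k * ζ)‖ - Real.log ‖f (r k * ζ)‖)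
    (A := fun ζ => ‖F ζ‖ - Real.log ‖F ζ‖) (c := ∫ ζ, ‖F ζ‖ ∂arcLength - Real.log ‖f 0‖)
    (fun k => (hvi k).sub (hui k)) (fun k => ae_of_all _ fun ζ => log_le_self (norm_nonneg _))
    (hFn.sub hu) (by
      filter_upwards [hae, hne] with ζ hζ hn
      exact hζ.norm.sub (hζ.norm.log (norm_ne_zero_iff.2 hn)))
    (by
      refine ((tendsto_integral_norm_dilation hf hr hF hL).sub_const _).congr fun k => ?_
      rw [integral_sub (hvi k) (hui k), integral_log_norm_dilation hf h0 (hr' k)])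
    (by
      rw [integral_sub hFn hu]
      linarith)
  have hv1 := tendsto_integral_abs_sub (ν := arcLength)
    (a := fun k ζ => ‖f (r k * ζ)‖) (A := fun ζ => ‖F ζ‖) hvi
    (fun k => ae_of_all _ fun ζ => norm_nonneg _) hFn (hae.mono fun ζ hζ => hζ.norm)
    (tendsto_integral_norm_dilation hf hr hF hL) le_rfl
  obtain ⟨C, hC⟩ := (isCompact_sphere (0 : ℂ) 1).exists_bound_of_continuousOn
    (continuousOn_poisson hw)
  have hPi := fun k => integrable_continuousOn_mul (continuousOn_poisson hw) (hui k)
  have hPu := integrable_continuousOn_mul (continuousOn_poisson hw) hu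
  have hlim : Tendsto (fun k => ∫ ζ : ℂ, (1 - ‖w‖ ^ 2) / ‖ζ - w‖ ^ 2 * Real.log ‖f (r k * ζ)‖
      ∂arcLength) atTop (𝓝 (herglotz (fun ζ => Real.log ‖F ζ‖) w).re) := by
    rw [re_herglotz hu hw, tendsto_iff_norm_sub_tendsto_zero]
    refine squeeze_zero (fun _ => norm_nonneg _) (fun k => ?_)
      (by simpa using (hsch.add hv1).const_mul C)
    rw [← integral_sub (hPi k) hPu]
    refine (norm_integral_le_integral_norm _).trans ?_
    rw [← integral_add
        (f := fun ζ => |‖f (r k * ζ)‖ - Real.log ‖f (r k * ζ)‖ - (‖F ζ‖ - Real.log ‖F ζ‖)|)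
        (g := fun ζ => |‖f (r k * ζ)‖ - ‖F ζ‖|)
        (((hvi k).sub (hui k)).sub (hFn.sub hu)).abs ((hvi k).sub hFn).abs,
      ← integral_const_mul]
    refine integral_mono_ae ((hPi k).sub hPu).norm
      (((((hvi k).sub (hui k)).sub (hFn.sub hu)).abs.add ((hvi k).sub hFn).abs).const_mul C) ?_
    filter_upwards [ae_norm_eq_one] with ζ hζ
    rw [← mul_sub, norm_mul]
    refine mul_le_mul (hC ζ (by simpa using hζ)) ?_ (norm_nonneg _)
      ((norm_nonneg _).trans (hC ζ (by simpa using hζ)))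
    rw [Real.norm_eq_abs, abs_le]
    constructor <;> cases abs_cases (‖f (r k * ζ)‖ - Real.log ‖f (r k * ζ)‖ - (‖F ζ‖ - Real.log ‖F ζ‖))
      <;> cases abs_cases (‖f (r k * ζ)‖ - ‖F ζ‖) <;> linarith
  refine tendsto_nhds_unique ?_ hlim
  simp only [integral_poisson_log_norm hf h0 (hr' _) hw]
  have h1 : Tendsto (fun k => (r k : ℂ) * w) atTop (𝓝 w) := by
    simpa using (((Complex.continuous_ofReal.tendsto' 1 1 (by simp)).comp
      (hr1.mono_right nhdsWithin_le_nhds)).mul_const w)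
  exact (((hf.continuousOn.continuousAt (Metric.isOpen_ball.mem_nhds hw)).tendsto.comp h1).norm).log
    (norm_ne_zero_iff.2 (h0 w hw))

end

theorem isOuter_of_isCyclic {μ : Measure ℂ} [IsFiniteMeasure μ] (hμ : μ (𝔻)ᶜ = 0) {f : ℂ → ℂ}
    (hc : IsCyclic μ f) : IsOuter f := by
  have hf2 := hc.1.1
  have hf := hf2.1
  have happ := fun ε hε => exists_polynomial_of_isCyclic hμ hc (ε := ε) hε
  have h0 : ∀ z ∈ 𝔻, f z ≠ 0 := fun z hz => ne_zero_of_approx hf happ hz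
  obtain ⟨F, r, hr, hr1, hF, hae, hL⟩ := exists_boundary_values hf2
  obtain ⟨hne, hu⟩ := boundary_log_integrable hf h0 hr hF hae hL
  have hle := integral_log_boundary_le hf hr hr1 hF hae hne hu happ
  set h : ℂ → ℝ := fun ζ => Real.log ‖F ζ‖ with hh
  have hlog : ∀ z ∈ 𝔻, Real.log ‖f z‖ = (herglotz h z).re := fun z hz =>
    log_norm_eq_re_herglotz hf h0 hr hr1 hF hae hL hne hu hle hz
  have hG : DifferentiableOn ℂ (fun z => f z * Complex.exp (-herglotz h z)) 𝔻 :=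
    hf.mul (differentiableOn_herglotz hu).neg.cexp
  have hG1 : ∀ z ∈ 𝔻, ‖f z * Complex.exp (-herglotz h z)‖ = 1 := by
    intro z hz
    rw [norm_mul, Complex.norm_exp, Complex.neg_re, ← hlog z hz, Real.exp_neg,
      Real.exp_log (norm_pos_iff.2 (h0 z hz)), mul_inv_cancel₀ (norm_ne_zero_iff.2 (h0 z hz))]
  have h0m : (0 : ℂ) ∈ 𝔻 := by simp
  -- An analytic function of modulus 1 everywhere attains its maximum modulus at 0, so it is
  -- constant.
  have hconst := Complex.eqOn_of_isPreconnected_of_isMaxOn_norm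
    (convex_ball (0 : ℂ) 1).isPreconnected Metric.isOpen_ball hG h0m
    (fun z hz => by simp only [Function.comp_apply, Set.mem_ofPred_eq, hG1 z hz, hG1 0 h0m, le_refl])
  refine ⟨⟨hf, lt_of_le_of_lt (iSup₂_le fun s hs => ?_) hf2.2⟩,
    f 0 * Complex.exp (-herglotz h 0), h, hG1 0 h0m, hu, fun z hz => ?_⟩
  · exact (eLpNorm_le_eLpNorm_of_exponent_le (by norm_num)
      (aestronglyMeasurable_dilation hf hs)).trans (le_iSup₂_of_le s hs le_rfl)
  · have h1 := hconst hz
    simp only [Function.const_apply] at h1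
    rw [← h1, mul_assoc]
    change f z = f z * (Complex.exp (-herglotz h z) * Complex.exp (herglotz h z))
    rw [← Complex.exp_add, neg_add_cancel, Complex.exp_zero, mul_one]

/-! ### Radial zeros of outer functions -/

/-- With k the negative part of h, -log|f| is at most the positive harmonic function Re `herglotz
k`, whose circular means are constant. By Fatou its lower radial limit is finite almost everywhere,
while at a radial zero of f it is infinite. -/
theorem arcLength_radialZeroSet {f : ℂ → ℂ} (hf : IsOuter f) :
    arcLength (radialZeroSet f) = 0 := by
  obtain ⟨-, α, h, hα, hh, hfh⟩ := hf
  have hpi : Integrable (fun ζ => max (h ζ) 0) arcLength := hh.pos_part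
  set k : ℂ → ℝ := fun ζ => max (h ζ) 0 - h ζ with hk
  have hki : Integrable k arcLength := hpi.sub hh
  have hkd := differentiableOn_herglotz hki
  have hk0 : ∀ z ∈ 𝔻, 0 ≤ (herglotz k z).re := fun z hz =>
    le_re_herglotz hki (fun ζ => sub_nonneg.2 (le_max_left _ _)) hz
  have hlog : ∀ z ∈ 𝔻, -Real.log ‖f z‖ ≤ (herglotz k z).re := by
    intro z hz
    have h1 : Real.log ‖f z‖ = (herglotz h z).re := by
      rw [hfh z hz, norm_mul, hα, one_mul, Complex.norm_exp, Real.log_exp, herglotz]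
    rw [h1, hk, herglotz_sub hpi hh hz, Complex.sub_re]
    linarith [le_re_herglotz hpi (fun ζ => le_max_right (h ζ) 0) hz]
  have hd := fun n => diffContOnCl_dilation hkd (radius_mem n).1.le (radius_mem n).2
  have hint := fun n => integrable_arcLength (continuousOn_sphere_of_diffContOnCl (hd n))
  have hre : ∀ n, Integrable (fun ζ : ℂ => (herglotz k (radius n * ζ)).re) arcLength :=
    fun n => (hint n).re
  have hmean : ∀ n, ∫⁻ ζ, ENNReal.ofReal (herglotz k (radius n * ζ)).re ∂arcLength =
      ENNReal.ofReal (herglotz k 0).re := by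
    intro n
    rw [← ofReal_integral_eq_lintegral_ofReal (hre n)]
    · congr 1
      have h4 := integral_arcLength_eq (hd n)
      simp only [mul_zero] at h4
      rw [← h4]
      exact Complex.reCLM.integral_comp_comm (hint n)
    · filter_upwards [ae_norm_eq_one] with ζ hζ
      exact hk0 _ (mul_mem_ball (radius_mem n).1.le (radius_mem n).2 hζ.le)
  have hm := fun n => (hre n).1.aemeasurable.ennreal_ofReal
  have hfatou : ∫⁻ ζ, liminf (fun n => ENNReal.ofReal (herglotz k (radius n * ζ)).re) atTop
      ∂arcLength ≠ ∞ := by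
    refine ((lintegral_liminf_le' hm).trans_lt ?_).ne
    simp only [hmean, liminf_const]
    exact ENNReal.ofReal_lt_top
  rw [measure_eq_zero_iff_ae_notMem]
  filter_upwards [ae_lt_top' (aemeasurable_liminf hm) hfatou] with ζ hζ hmem
  have hζ1 : ‖ζ‖ = 1 := by simpa using hmem.1
  have hball := fun n => mul_mem_ball (radius_mem n).1.le (radius_mem n).2 hζ1.le
  -- The punctured neighbourhood matters, since `Real.log 0 = 0`; an outer function has no zeros in
  -- the disc.
  have h1 : Tendsto (fun n => ‖f (radius n * ζ)‖) atTop (𝓝[≠] 0) := by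
    refine tendsto_nhdsWithin_iff.2 ⟨by simpa using (hmem.2.comp tendsto_radius).norm,
      Eventually.of_forall fun n => ?_⟩
    rw [Set.mem_compl_singleton_iff, norm_ne_zero_iff, hfh _ (hball n)]
    refine mul_ne_zero (norm_ne_zero_iff.1 ?_) (Complex.exp_ne_zero _)
    rw [hα]
    exact one_ne_zero
  have h2 : Tendsto (fun n => (herglotz k (radius n * ζ)).re) atTop atTop :=
    tendsto_atTop_mono (fun n => hlog _ (hball n))
      (tendsto_neg_atBot_atTop.comp (Real.tendsto_log_nhdsNE_zero.comp h1))
  have h3 : Tendsto (fun n => ENNReal.ofReal (herglotz k (radius n * ζ)).re) atTop (𝓝 ∞) :=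
    ENNReal.tendsto_ofReal_atTop.comp h2
  rw [h3.liminf_eq] at hζ
  exact lt_irrefl _ hζ

/-! ### Capacity -/

theorem arcLength_le_capacity (μ : Measure ℂ) (E : Set ℂ) : arcLength E ≤ capacity μ E := by
  refine le_iInf fun g => le_iInf fun _ => le_iInf fun hU => ?_
  obtain ⟨U, hUo, hEU, hg⟩ := hU
  calc arcLength E ≤ arcLength U := measure_mono hEU
    _ = ∫⁻ ζ, U.indicator 1 ζ ∂arcLength := (lintegral_indicator_one hUo.measurableSet).symm
    _ ≤ ∫⁻ ζ, ‖g ζ‖ₑ ^ 2 ∂arcLength := by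
        refine lintegral_mono_ae ?_
        filter_upwards [hg] with ζ hζ
        by_cases h : ζ ∈ U
        · rw [indicator_of_mem h, Pi.one_apply]
          refine one_le_pow₀ ?_
          rw [← ofReal_norm]
          exact ENNReal.one_le_ofReal.2 (hζ h)
        · rw [indicator_of_notMem h]
          exact zero_le
    _ = eLpNorm g 2 arcLength ^ 2 := eLpNorm_two_sq.symm
    _ ≤ _ := le_self_add

/-- The Poisson kernel as a function of both variables, with values in `[0, ∞]`. -/
noncomputable def poissonENN (ζ z : ℂ) : ℝ≥0∞ :=
  ENNReal.ofReal ((1 - ‖z‖ ^ 2) / ‖ζ - z‖ ^ 2)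

theorem measurable_poissonENN : Measurable fun p : ℂ × ℂ => poissonENN p.1 p.2 := by
  unfold poissonENN
  exact (((measurable_const.sub (measurable_snd.norm.pow_const 2)).div
    ((measurable_fst.sub measurable_snd).norm.pow_const 2))).ennreal_ofReal

theorem measurable_poissonENN_left (z : ℂ) : Measurable fun ζ => poissonENN ζ z :=
  Measurable.of_uncurry_right (f := poissonENN) measurable_poissonENN

/-- The sweep of `μ` to the circle, as a density with respect to arc length. -/
noncomputable def sweep (μ : Measure ℂ) (ζ : ℂ) : ℝ≥0∞ := ∫⁻ z, poissonENN ζ z ∂μ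

theorem measurable_sweep (μ : Measure ℂ) [SFinite μ] : Measurable (sweep μ) :=
  measurable_poissonENN.lintegral_prod_right'

theorem douglasKernel_comm (μ : Measure ℂ) (ζ l : ℂ) :
    douglasKernel μ ζ l = douglasKernel μ l ζ := by
  simp only [douglasKernel, mul_comm]

theorem douglasKernel_eq {μ : Measure ℂ} (hμ : μ (𝔻)ᶜ = 0) (ζ l : ℂ) :
    douglasKernel μ ζ l = ∫⁻ z, poissonENN ζ z * poissonENN l z ∂μ := by
  refine lintegral_congr_ae ?_
  filter_upwards [mem_ae_iff.2 hμ] with z hz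
  exact ENNReal.ofReal_mul (div_nonneg (one_sub_sq_pos hz).le (sq_nonneg _))

section

variable {μ : Measure ℂ} [IsFiniteMeasure μ]

theorem lintegral_sweep (hμ : μ (𝔻)ᶜ = 0) : ∫⁻ ζ, sweep μ ζ ∂arcLength = μ univ := by
  unfold sweep
  rw [lintegral_lintegral_swap measurable_poissonENN.aemeasurable, ← lintegral_one]
  refine lintegral_congr_ae ?_
  filter_upwards [mem_ae_iff.2 hμ] with z hz
  exact lintegral_poisson hz

theorem measurable_douglasKernel (μ : Measure ℂ) [SFinite μ] :
    Measurable fun p : ℂ × ℂ => douglasKernel μ p.1 p.2 := by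
  refine Measurable.lintegral_prod_right' (f := fun q : (ℂ × ℂ) × ℂ => ENNReal.ofReal
    ((1 - ‖q.2‖ ^ 2) / ‖q.1.1 - q.2‖ ^ 2 * ((1 - ‖q.2‖ ^ 2) / ‖q.1.2 - q.2‖ ^ 2))) ?_
  fun_prop

/-- One of the two Poisson kernels integrates to 1, leaving the sweep of μ. -/
theorem lintegral_douglasKernel (hμ : μ (𝔻)ᶜ = 0) (l : ℂ) :
    ∫⁻ ζ, douglasKernel μ ζ l ∂arcLength = sweep μ l := by
  simp only [douglasKernel_eq hμ]
  rw [lintegral_lintegral_swap]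
  · refine lintegral_congr_ae ?_
    filter_upwards [mem_ae_iff.2 hμ] with z hz
    rw [lintegral_mul_const _ (measurable_poissonENN_left z)]
    exact (congrArg (· * poissonENN l z) (lintegral_poisson hz)).trans (one_mul _)
  · exact (measurable_poissonENN.mul (measurable_poissonENN.comp
      (measurable_const.prodMk measurable_snd))).aemeasurable

/-- The squared difference of indicator values is at most their sum, and each summand integrates to
the sweep over U by symmetry of the kernel. -/
theorem harmonicDirichletIntegral_indicator_le (hμ : μ (𝔻)ᶜ = 0) {U : Set ℂ}
    (hU : MeasurableSet U) : harmonicDirichletIntegral μ (U.indicator 1) ≤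
      2 * ∫⁻ ζ in U, sweep μ ζ ∂arcLength := by
  have hK := measurable_douglasKernel μ
  have hK' : Measurable fun p : ℂ × ℂ => douglasKernel μ p.2 p.1 := by
    simpa only [douglasKernel_comm μ] using hK
  have h1 : Measurable (U.indicator (1 : ℂ → ℝ≥0∞)) := measurable_one.indicator hU
  calc harmonicDirichletIntegral μ (U.indicator 1)
      ≤ ∫⁻ l, ∫⁻ ζ, (U.indicator 1 ζ * douglasKernel μ ζ l + U.indicator 1 l * douglasKernel μ ζ l)
          ∂arcLength ∂arcLength := by
        refine lintegral_mono fun l => lintegral_mono fun ζ => ?_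
        simp only []
        rw [← add_mul]
        gcongr
        by_cases h2 : ζ ∈ U <;> by_cases h3 : l ∈ U <;> simp [h2, h3]
    _ = ∫⁻ l, ∫⁻ ζ, U.indicator 1 ζ * douglasKernel μ ζ l ∂arcLength ∂arcLength +
          ∫⁻ l, U.indicator 1 l * sweep μ l ∂arcLength := by
        rw [← lintegral_add_right (g := fun l => U.indicator 1 l * sweep μ l) _
          (h1.mul (measurable_sweep μ))]
        refine lintegral_congr fun l => ?_
        have h4 : Measurable fun ζ => douglasKernel μ ζ l := 
          Measurable.of_uncurry_right (f := douglasKernel μ) hK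
        rw [lintegral_add_left (f := fun ζ => U.indicator 1 ζ * douglasKernel μ ζ l) (h1.mul h4), lintegral_const_mul _ h4, lintegral_douglasKernel hμ]
    _ = ∫⁻ ζ, U.indicator 1 ζ * sweep μ ζ ∂arcLength +
          ∫⁻ l, U.indicator 1 l * sweep μ l ∂arcLength := by
        congr 1
        rw [lintegral_lintegral_swap]
        · refine lintegral_congr fun ζ => ?_
          have h4 : Measurable fun l => douglasKernel μ ζ l := 
            Measurable.of_uncurry_left (f := douglasKernel μ) hK
          rw [lintegral_const_mul _ h4, ← lintegral_douglasKernel hμ ζ]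
          simp only [douglasKernel_comm μ ζ]
        · exact ((h1.comp measurable_snd).mul hK').aemeasurable
    _ = _ := by
        rw [two_mul, ← lintegral_indicator hU]
        have h5 : ∀ ζ, U.indicator 1 ζ * sweep μ ζ = U.indicator (sweep μ) ζ := fun ζ => by
          by_cases h : ζ ∈ U <;> simp [h]
        simp only [h5]

theorem capacity_le_of_isOpen (hμ : μ (𝔻)ᶜ = 0) {E U : Set ℂ} (hU : IsOpen U) (hE : E ⊆ U) :
    capacity μ E ≤ arcLength U + 2 * ∫⁻ ζ in U, sweep μ ζ ∂arcLength := by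
  have hD := harmonicDirichletIntegral_indicator_le hμ hU.measurableSet
  have hfin : ∫⁻ ζ in U, sweep μ ζ ∂arcLength < ∞ :=
    (setLIntegral_le_lintegral _ _).trans_lt (by
      rw [lintegral_sweep hμ]
      exact measure_lt_top _ _)
  have hmem : MemLp (U.indicator (1 : ℂ → ℂ)) 2 arcLength :=
    (memLp_const (1 : ℂ)).indicator hU.measurableSet
  have hle : capacity μ E ≤ eLpNorm (U.indicator (1 : ℂ → ℂ)) 2 arcLength ^ 2 +
      harmonicDirichletIntegral μ (U.indicator 1) := by
    unfold capacity
    exact iInf₂_le_of_le _ ⟨hmem, hD.trans_lt (ENNReal.mul_lt_top (by simp) hfin)⟩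
      (iInf_le _ ⟨U, hU, hE, ae_of_all _ fun ζ hζ => by simp [hζ]⟩)
  refine hle.trans (add_le_add ?_ hD)
  rw [eLpNorm_two_sq, ← lintegral_indicator_one hU.measurableSet]
  refine lintegral_mono fun ζ => ?_
  by_cases h : ζ ∈ U <;> simp [h]

theorem capacity_eq_zero_iff (hμ : μ (𝔻)ᶜ = 0) (E : Set ℂ) :
    capacity μ E = 0 ↔ arcLength E = 0 := by
  refine ⟨fun h => nonpos_iff_eq_zero.1 (h ▸ arcLength_le_capacity μ E), fun h => ?_⟩
  -- The upper bound for the capacity is ν U. This finite measure is absolutely continuous with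
  -- respect to arc length, so outer regularity gives open U ⊇ E with ν U arbitrarily small. No
  -- measurability of E is needed.
  set ν : Measure ℂ := arcLength + (2 : ℝ≥0∞) • arcLength.withDensity (sweep μ) with hν
  have hfin : IsFiniteMeasure ν := by
    have : IsFiniteMeasure (arcLength.withDensity (sweep μ)) :=
      isFiniteMeasure_withDensity (by
        rw [lintegral_sweep hμ]
        exact measure_ne_top _ _)
    have : IsFiniteMeasure ((2 : ℝ≥0∞) • arcLength.withDensity (sweep μ)) :=
      Measure.smul_finite _ (by simp)
    infer_instance
  have h0 : ν E = 0 := by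
    rw [hν, Measure.add_apply, Measure.smul_apply, h,
      withDensity_absolutelyContinuous arcLength (sweep μ) h]
    simp
  refine nonpos_iff_eq_zero.1 (le_of_forall_gt fun ε hε => ?_)
  obtain ⟨U, hEU, hU, hUε⟩ := E.exists_isOpen_lt_of_lt (μ := ν) ε (by rwa [h0])
  refine (capacity_le_of_isOpen hμ hU hEU).trans_lt (lt_of_eq_of_lt ?_ hUε)
  rw [hν, Measure.add_apply, Measure.smul_apply, withDensity_apply _ hU.measurableSet, smul_eq_mul]

end

end BrownShields

/-! ### The three equivalences -/

theorem corollary6p2 (μ : MeasureTheory.Measure ℂ) [MeasureTheory.IsFiniteMeasure μ]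
    (hμ : μ (Metric.ball (0 : ℂ) 1)ᶜ = 0) :
    (∀ f ∈ BrownShields.dirichletSpace μ,
      (BrownShields.IsCyclic μ f ↔ BrownShields.IsOuter f)) ∧
    (∀ f ∈ BrownShields.dirichletSpace μ,
      (BrownShields.IsCyclic μ f ↔
        BrownShields.IsOuter f ∧ BrownShields.capacity μ (BrownShields.radialZeroSet f) = 0)) ∧
    (∀ E : Set ℂ, E ⊆ Metric.sphere 0 1 →
      (BrownShields.capacity μ E = 0 ↔ BrownShields.arcLength E = 0)) := by
  have h1 : ∀ f ∈ BrownShields.dirichletSpace μ,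
      (BrownShields.IsCyclic μ f ↔ BrownShields.IsOuter f) := fun f hf =>
    ⟨BrownShields.isOuter_of_isCyclic hμ, BrownShields.isCyclic_of_isOuter hμ hf⟩
  refine ⟨h1, fun f hf => ?_, fun E _ => BrownShields.capacity_eq_zero_iff hμ E⟩
  rw [h1 f hf, BrownShields.capacity_eq_zero_iff hμ]
  exact ⟨fun h => ⟨h, BrownShields.arcLength_radialZeroSet h⟩, fun h => h.1⟩
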